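/- Let $A\to M$ be a Lie algebroid of finite rank over a smooth (Hausdorff, $\sigma$-compact, boundaryless, finite-dimensional) manifold, with anchor $\sharp$ and bracket $[\cdot,\cdot]$, let $\pi:A\to M$ be the projection and let $I=[0,1]$; all maps are $C^\infty$. *The groupoid $\pi_1(A)$.* A Lie algebroid morphism $a=\sum_k a_k\,dt_k:TI^n\to A$ is a bundle map whose pull-back of forms commutes with the differentials $d$ and $d_A$. A $1$-sphere is a morphism $a:TI\to A$. Two $1$-spheres $a_0,a_1$ are homotopic if there is a morphism $h=h_1\,dt_1+h_2\,dt_2:TI^2\to A$ with $h_1(t,\epsilon)=a_\epsilon(t)$ for $\epsilon=0,1$ and $h_2(t,\epsilon)=0$ for $t\in\{0,1\}$. Let $\pi_1(A)$ be the set of $1$-spheres modulo homotopy, with source and target of $[a]$ the end points $\gamma(0)$ and $\gamma(1)$ of the base path $\gamma$ of $a$, and with product $[a^1][a^0]=[a^1\odot a^0]$, where $a^1\odot a^0$ is $2\tau'(2t)\,a^0(\tau(2t))$ for $t\le\frac12$ and $2\tau'(2t-1)\,a^1(\tau(2t-1))$ for $t\ge\frac12$. Here $\tau$ is a cut-off function: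 $\tau=0$ on $(-\infty,0]$, $\tau=1$ on $[1,\infty)$ and $\tau'>0$ on $(0,1)$. *The Weinstein groupoid $\mathcal G(A)$.* An $A$-path is a path $a:I\to A$ with $\sharp a=\frac{d}{dt}(\pi\circ a)$. Fix a connection $\nabla$ on the vector bundle $A$, with torsion $T_\nabla(X,Y)=\nabla_{\sharp X}Y-\nabla_{\sharp Y}X-[X,Y]$. Two $A$-paths $a_0,a_1$ are $A$-homotopic if there is a variation $a_\epsilon(t)=a(\epsilon,t)$, $\epsilon\in I$, of $A$-paths joining $a_0$ to $a_1$, whose base paths $\gamma_\epsilon$ have fixed end points, such that the solution $b(\epsilon,t)\in A_{\gamma_\epsilon(t)}$ of $\partial_t b-\partial_\epsilon a=T_\nabla(a,b)$, $b(\epsilon,0)=0$, satisfies $b(\epsilon,1)=0$ for all $\epsilon$ (the derivatives are covariant derivatives along $\gamma$). Let $\mathcal G(A)$ be the set of $A$-paths modulo $A$-homotopy, with source $\pi(a(0))$ and target $\pi(a(1))$, with unit at $x$ the class of the zero path at $x$, with $[a]^{-1}$ the class of $t\mapsto -a(1-t)$, and with product $[a_1][a_0]=[a_1^\tau\odot a_0^\tau]$,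 where $a^\tau(t)=\tau'(t)a(\tau(t))$, and $a_1\odot a_0$ is $2a_0(2t)$ for $t\le\frac12$ and $2a_1(2t-1)$ for $t>\frac12$. For $0\le r\le\infty$, give the spaces of $1$-spheres and of $A$-paths the topology of uniform convergence of all derivatives of order at most $r$, and give $\pi_1(A)$ and $\mathcal G(A)$ the quotient topologies. **Proposition.** Homotopy of $1$-spheres and $A$-homotopy of $A$-paths are equivalence relations, and the operations above are well defined, are independent of $\tau$, and make $\pi_1(A)$ and $\mathcal G(A)$ groupoids over $M$. The map $a_1\,dt_1\mapsto a_1$ is a bijection from the $1$-spheres onto the $A$-paths, and two $1$-spheres are homotopic if and only if the corresponding $A$-paths are $A$-homotopic. The induced map $\pi_1(A)\to\mathcal G(A)$ is an isomorphism of groupoids over $\mathrm{id}_M$ and, for every $r$, a homeomorphism. This holds for every choice of $\nabla$. -/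

import Mathlib

open Bundle Set
open scoped Manifold ContDiff Topology UniformConvergence unitInterval

noncomputable section

/-! ### Smooth maps on cubes -/

/-- Extend a map on the cube `I^n` to `ℝ^n` by clamping every coordinate to `[0, 1]`. -/
def cubeExtend {n : ℕ} {N : Type*} (p : (Fin n → I) → N) : (Fin n → ℝ) → N :=
  fun s => p (fun i => projIcc 0 1 zero_le_one (s i))

/-- Extend a map on `I` to `ℝ` by clamping. -/
def intervalExtend {N : Type*} (p : I → N) : ℝ → N :=
  fun s => p (projIcc 0 1 zero_le_one s)

/-- Extend a map on `I × I` to `ℝ × ℝ` by clamping both coordinates. -/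
def squareExtend {N : Type*} (p : I → I → N) : ℝ × ℝ → N :=
  fun s => p (projIcc 0 1 zero_le_one s.1) (projIcc 0 1 zero_le_one s.2)

/-- The derivative at `t` of a real function on the closed interval `I` (one-sided at the ends). -/
def intervalDeriv (g : I → ℝ) (t : I) : ℝ :=
  derivWithin (intervalExtend g) (Icc 0 1) (t : ℝ)

/-- The partial derivative `∂g/∂tᵢ` at `t` of a real function on the closed cube `I^n`. -/
def cubePartialDeriv {n : ℕ} (i : Fin n) (g : (Fin n → I) → ℝ) (t : Fin n → I) : ℝ :=
  intervalDeriv (fun s => g (Function.update t i s)) (t i)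

/-- The `C^r` topology on a set `P` of smooth maps from `K ⊆ W` to the manifold `N`, where
`ext p : W → N` is any map that restricts on `K` to the map `p`: the coarsest topology for which,
for each smooth `f : N → ℝ` and each `j ≤ r`, the `j`-th derivative of `f ∘ p` depends continuously
on `p`, uniformly on `K`.  It is the topology of uniform convergence of the maps together with
their derivatives of order at most `r`. -/
abbrev crTopology {P W EN HN N : Type*} [NormedAddCommGroup W] [NormedSpace ℝ W]
    [NormedAddCommGroup EN] [NormedSpace ℝ EN] [TopologicalSpace HN]
    (J : ModelWithCorners ℝ EN HN) [TopologicalSpace N] [ChartedSpace HN N]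
    (K : Set W) (ext : P → W → N) (r : ℕ∞) : TopologicalSpace P :=
  ⨅ (f : C^∞⟮J, N; ℝ⟯) (j : ℕ) (_ : (j : ℕ∞) ≤ r),
    TopologicalSpace.induced
      (fun p => UniformFun.ofFun
        (fun s : K => iteratedFDerivWithin ℝ j (fun w => f (ext p w)) K (s : W)))
      inferInstance

/-- A cut-off function: smooth, `0` for `t ≤ 0`, `1` for `t ≥ 1`, positive slope on `]0, 1[`. -/
structure IsCutoff (τ : ℝ → ℝ) : Prop where
  smooth : ContDiff ℝ ∞ τ
  eq_zero : ∀ t, t ≤ 0 → τ t = 0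
  eq_one : ∀ t, 1 ≤ t → τ t = 1
  deriv_pos : ∀ t ∈ Ioo (0 : ℝ) 1, 0 < deriv τ t

/-! ### Groupoids -/

/-- A groupoid with set of arrows `G` and set of objects `M`; `mul g h` is `g ∘ h` (first `h`,
then `g`), defined when the source of `g` is the target of `h`. -/
structure ArrowGroupoid (G M : Type*) where
  source : G → M
  target : G → M
  unit : M → G
  inv : G → G
  mul : ∀ g h : G, source g = target h → G
  source_unit : ∀ x, source (unit x) = x
  target_unit : ∀ x, target (unit x) = x
  source_inv : ∀ g, source (inv g) = target g
  target_inv : ∀ g, target (inv g) = source g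
  source_mul : ∀ g h p, source (mul g h p) = source h
  target_mul : ∀ g h p, target (mul g h p) = target g
  mul_assoc : ∀ g h k (p : source g = target h) (q : source h = target k)
    (p' : source (mul g h p) = target k) (q' : source g = target (mul h k q)),
    mul (mul g h p) k p' = mul g (mul h k q) q'
  mul_unit : ∀ g (p : source g = target (unit (source g))), mul g (unit (source g)) p = g
  unit_mul : ∀ g (p : source (unit (target g)) = target g), mul (unit (target g)) g p = g
  mul_inv : ∀ g (p : source g = target (inv g)), mul g (inv g) p = unit (target g)
  inv_mul : ∀ g (p : source (inv g) = target g), mul (inv g) g p = unit (source g)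

/-- An isomorphism of groupoids over the identity of the set of objects. -/
structure ArrowGroupoid.IsIso {G G' M : Type*} (𝒢 : ArrowGroupoid G M) (𝒢' : ArrowGroupoid G' M)
    (Φ : G ≃ G') : Prop where
  source_map : ∀ g, 𝒢'.source (Φ g) = 𝒢.source g
  target_map : ∀ g, 𝒢'.target (Φ g) = 𝒢.target g
  map_unit : ∀ x, Φ (𝒢.unit x) = 𝒢'.unit x
  map_inv : ∀ g, Φ (𝒢.inv g) = 𝒢'.inv (Φ g)
  map_mul : ∀ g h p p', Φ (𝒢.mul g h p) = 𝒢'.mul (Φ g) (Φ h) p'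

section Algebroid

variable {E : Type*} [NormedAddCommGroup E] [NormedSpace ℝ E]
  {M : Type*} [TopologicalSpace M] [ChartedSpace E M] [IsManifold 𝓘(ℝ, E) ∞ M]

/-- The velocity `dγ/dt` of a path in a manifold, a tangent vector at `γ t`. -/
def pathVelocity (γ : I → M) (t : I) : TangentSpace 𝓘(ℝ, E) (γ t) :=
  (mfderivWithin 𝓘(ℝ, ℝ) 𝓘(ℝ, E) (intervalExtend γ) (Icc 0 1) (t : ℝ) (1 : ℝ) : E)

variable (E) in
/-- The derivative `v(f)` of a smooth function in the direction of a tangent vector. -/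
def tangentApply {x : M} (v : TangentSpace 𝓘(ℝ, E) x) (f : M → ℝ) : ℝ :=
  mfderiv 𝓘(ℝ, E) 𝓘(ℝ, ℝ) f x v

variable (F : Type*) [NormedAddCommGroup F] [NormedSpace ℝ F]
  (V : M → Type*) [TopologicalSpace (TotalSpace F V)]
  [∀ x, AddCommGroup (V x)] [∀ x, Module ℝ (V x)] [∀ x, TopologicalSpace (V x)]
  [FiberBundle F V] [VectorBundle ℝ F V]

variable {F V} in
/-- The product of a scalar and a vector of a vector bundle. -/
def fiberSMul (c : ℝ) (v : TotalSpace F V) : TotalSpace F V :=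
  ⟨v.proj, c • v.snd⟩

variable (E) in
/-- A Lie algebroid structure on the smooth vector bundle `V → M`: a smooth anchor `V → TM` and a
Lie bracket on the space `Γ(V)` of smooth sections, with the Leibniz rule
`[X, fY] = f[X, Y] + (♯X)(f) Y`. -/
structure LieAlgebroid where
  anchor : ∀ x, V x →ₗ[ℝ] TangentSpace 𝓘(ℝ, E) x
  smooth_anchor : ContMDiff (𝓘(ℝ, E).prod 𝓘(ℝ, F)) 𝓘(ℝ, E).tangent ∞
    (fun v : TotalSpace F V => (⟨v.proj, anchor v.proj v.snd⟩ : TangentBundle 𝓘(ℝ, E) M))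
  bracket : Cₛ^∞⟮𝓘(ℝ, E); F, V⟯ →ₗ[ℝ] Cₛ^∞⟮𝓘(ℝ, E); F, V⟯ →ₗ[ℝ] Cₛ^∞⟮𝓘(ℝ, E); F, V⟯
  bracket_self : ∀ X, bracket X X = 0
  jacobi : ∀ X Y Z,
    bracket (bracket X Y) Z + bracket (bracket Y Z) X + bracket (bracket Z X) Y = 0
  leibniz : ∀ (X Y : Cₛ^∞⟮𝓘(ℝ, E); F, V⟯) (f : C^∞⟮𝓘(ℝ, E), M; ℝ⟯) (x : M),
    bracket X ⟨fun y => f y • Y y, f.contMDiff.smul_section Y.contMDiff⟩ x =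
      f x • bracket X Y x + tangentApply E (anchor x (X x)) f • Y x

variable (E) in
/-- A smooth section of the dual bundle `V*`, that is an element of `Ω¹(V)`, as a fiberwise linear
smooth function on the total space of `V`. -/
structure BundleOneForm where
  toFun : ∀ x, V x →ₗ[ℝ] ℝ
  smooth : ContMDiff (𝓘(ℝ, E).prod 𝓘(ℝ, F)) 𝓘(ℝ, ℝ) ∞
    (fun v : TotalSpace F V => toFun v.proj v.snd)

variable {F V}

/-- The value of a one-form at a vector. -/
def BundleOneForm.eval (ξ : BundleOneForm E F V) (v : TotalSpace F V) : ℝ :=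
  ξ.toFun v.proj v.snd

namespace LieAlgebroid

variable (A : LieAlgebroid E F V)

/-- The differential `d_A f ∈ Ω¹(A)` of a function, evaluated at a vector of `A`. -/
def dFun (f : M → ℝ) (v : TotalSpace F V) : ℝ :=
  tangentApply E (A.anchor v.proj v.snd) f

/-- The differential `d_A ξ ∈ Ω²(A)` of a one-form, evaluated at two sections:
`(d_A ξ)(X, Y) = ♯X (ξ(Y)) - ♯Y (ξ(X)) - ξ([X, Y])`. -/
def dOneForm (ξ : BundleOneForm E F V) (X Y : Cₛ^∞⟮𝓘(ℝ, E); F, V⟯) (x : M) : ℝ :=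
  tangentApply E (A.anchor x (X x)) (fun y => ξ.toFun y (Y y))
    - tangentApply E (A.anchor x (Y x)) (fun y => ξ.toFun y (X y))
    - ξ.toFun x (A.bracket X Y x)

/-! ### Morphisms `TI^n → A`, spheres and homotopy groups -/

/-- A Lie algebroid morphism `a = ∑ₖ aₖ dtₖ : TI^n → A`: a smooth bundle map, with base map
`base : I^n → M` and components `aₖ = a(∂/∂tₖ)`, whose pull-back of forms commutes with the
differentials, `d ∘ a^* = a^* ∘ d_A`, on `Ω⁰(A)` and on `Ω¹(A)` (which generate `Ω(A)`).
As `d_A ξ` is tensorial, `(d_A ξ)(aᵢ(t), aⱼ(t))` is computed with sections through `aᵢ(t)` and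
`aⱼ(t)`. -/
@[ext]
structure CubeMorphism (n : ℕ) where
  base : (Fin n → I) → M
  comp : Fin n → (Fin n → I) → TotalSpace F V
  proj_comp : ∀ k t, (comp k t).proj = base t
  smooth_base : ContMDiffOn 𝓘(ℝ, Fin n → ℝ) 𝓘(ℝ, E) ∞ (cubeExtend base) (Icc 0 1)
  smooth_comp : ∀ k, ContMDiffOn 𝓘(ℝ, Fin n → ℝ) (𝓘(ℝ, E).prod 𝓘(ℝ, F)) ∞
    (cubeExtend (comp k)) (Icc 0 1)
  pullback_d_zero : ∀ (f : C^∞⟮𝓘(ℝ, E), M; ℝ⟯) (k : Fin n) (t : Fin n → I),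
    cubePartialDeriv k (fun s => f (base s)) t = A.dFun f (comp k t)
  pullback_d_one : ∀ (ξ : BundleOneForm E F V) (i j : Fin n) (t : Fin n → I)
    (X Y : Cₛ^∞⟮𝓘(ℝ, E); F, V⟯),
    TotalSpace.mk' F (base t) (X (base t)) = comp i t →
    TotalSpace.mk' F (base t) (Y (base t)) = comp j t →
    cubePartialDeriv i (fun s => ξ.eval (comp j s)) t
      - cubePartialDeriv j (fun s => ξ.eval (comp i s)) t = A.dOneForm ξ X Y (base t)

/-- An `n`-dimensional `A`-sphere: a morphism `a : TI^n → A` such that `aₖ(t) = 0` as soon as one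
of the `tⱼ`, `j ≠ k`, is `0` or `1`. -/
def Sphere (n : ℕ) : Type _ :=
  {a : A.CubeMorphism n //
    ∀ k t, (∃ j, j ≠ k ∧ (t j = 0 ∨ t j = 1)) → (a.comp k t).snd = 0}

/-- The point `(t₁, …, tₙ, ε)` of `I^(n+1)`. -/
def cubeSnoc {n : ℕ} (t : Fin n → I) (ε : I) : Fin (n + 1) → I :=
  Fin.snoc (α := fun _ => I) t ε

/-- The restriction of `h : TI^(n+1) → A` to the face `t_{n+1} = ε` is `a : TI^n → A`. -/
def IsLastFace {n : ℕ} (h : A.CubeMorphism (n + 1)) (ε : I) (a : A.CubeMorphism n) : Prop :=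
  (∀ t, h.base (cubeSnoc t ε) = a.base t) ∧
    ∀ k t, h.comp (Fin.castSucc k) (cubeSnoc t ε) = a.comp k t

/-- Homotopy of `A`-spheres: there is a morphism `h : TI^(n+1) → A` that restricts to `a₀` and `a₁`
on the faces `t_{n+1} = 0, 1` and such that `h_{n+1}` vanishes whenever one of `t₁, …, tₙ` is `0`
or `1`. -/
def SphereHomotopic {n : ℕ} (a₀ a₁ : A.Sphere n) : Prop :=
  ∃ h : A.CubeMorphism (n + 1),
    A.IsLastFace h 0 a₀.1 ∧ A.IsLastFace h 1 a₁.1 ∧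
      ∀ (t : Fin n → I) (ε : I), (∃ j, t j = 0 ∨ t j = 1) →
        (h.comp (Fin.last n) (cubeSnoc t ε)).snd = 0

/-- `πₙ(A)`: the set of `n`-dimensional `A`-spheres modulo homotopy. -/
def HomotopyGroup (n : ℕ) : Type _ :=
  Quot (A.SphereHomotopic (n := n))

/-- The class of a sphere in `πₙ(A)`. -/
def sphereClass {n : ℕ} (a : A.Sphere n) : A.HomotopyGroup n :=
  Quot.mk _ a

/-- The `C^r` topology on `n`-dimensional spheres, as a space of maps. -/
abbrev sphereTopology (n : ℕ) (r : ℕ∞) : TopologicalSpace (A.Sphere n) :=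
  crTopology 𝓘(ℝ, E) (Icc 0 1) (fun a : A.Sphere n => cubeExtend a.1.base) r ⊓
    ⨅ k : Fin n, crTopology (𝓘(ℝ, E).prod 𝓘(ℝ, F)) (Icc 0 1)
      (fun a : A.Sphere n => cubeExtend (a.1.comp k)) r

/-- The quotient topology on `πₙ(A)`. -/
abbrev homotopyGroupTopology (n : ℕ) (r : ℕ∞) : TopologicalSpace (A.HomotopyGroup n) :=
  TopologicalSpace.coinduced A.sphereClass (A.sphereTopology n r)

/-- `c` is the concatenation `a¹ ⊙ a⁰` of two morphisms `TI^(n+1) → A` along the last coordinate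
`s = t_{n+1}`, with cut-off `τ`: it is `a⁰ ∘ d(τ(2s))` for `s ≤ 1/2` and `a¹ ∘ d(τ(2s - 1))` for
`s ≥ 1/2`, where only the last coordinate is reparametrized. -/
def IsConcat {n : ℕ} (τ : ℝ → ℝ) (a₁ a₀ c : A.CubeMorphism (n + 1)) : Prop :=
  let l : Fin (n + 1) := Fin.last n
  let pt (t : Fin (n + 1) → I) (s : ℝ) : Fin (n + 1) → I :=
    Function.update t l (projIcc 0 1 zero_le_one (τ s))
  let coeff (k : Fin (n + 1)) (s : ℝ) : ℝ := if k = l then 2 * deriv τ s else 1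
  ∀ t : Fin (n + 1) → I,
    ((t l : ℝ) ≤ 1 / 2 →
      c.base t = a₀.base (pt t (2 * t l)) ∧
        ∀ k, c.comp k t = fiberSMul (coeff k (2 * t l)) (a₀.comp k (pt t (2 * t l)))) ∧
    (1 / 2 ≤ (t l : ℝ) →
      c.base t = a₁.base (pt t (2 * t l - 1)) ∧
        ∀ k, c.comp k t = fiberSMul (coeff k (2 * t l - 1)) (a₁.comp k (pt t (2 * t l - 1))))

/-- The groupoid structure on `π₁(A)`: source and target of `[a]` are the end points of the base
path, the product is induced by concatenation (which is again a sphere), for every cut-off. -/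
structure IsPiOneGroupoid (P₁ : ArrowGroupoid (A.HomotopyGroup 1) M) : Prop where
  source_eq : ∀ a : A.Sphere 1, P₁.source (A.sphereClass a) = a.1.base 0
  target_eq : ∀ a : A.Sphere 1, P₁.target (A.sphereClass a) = a.1.base 1
  mul_eq : ∀ τ, IsCutoff τ → ∀ (a₁ a₀ : A.Sphere 1)
    (p : P₁.source (A.sphereClass a₁) = P₁.target (A.sphereClass a₀)),
    ∃ c : A.Sphere 1, A.IsConcat τ a₁.1 a₀.1 c.1 ∧
      P₁.mul (A.sphereClass a₁) (A.sphereClass a₀) p = A.sphereClass c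

/-! ### `A`-paths, `A`-homotopy and the Weinstein groupoid -/

/-- An `A`-path: a smooth path in the total space of `A` whose anchor is the velocity of its base
path. -/
@[ext]
structure APath where
  toFun : I → TotalSpace F V
  smooth : ContMDiffOn 𝓘(ℝ, ℝ) (𝓘(ℝ, E).prod 𝓘(ℝ, F)) ∞ (intervalExtend toFun) (Icc 0 1)
  anchor_eq : ∀ t, A.anchor (toFun t).proj (toFun t).snd = pathVelocity (fun s => (toFun s).proj) t

variable [∀ x, IsTopologicalAddGroup (V x)] [∀ x, ContinuousSMul ℝ (V x)]

/-- `w = D_t u` is the covariant derivative at time `t` of the path `u` in the vector bundle, along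
its base path `γ`.  It is characterized by
`d/dt ⟨ξ, u⟩ = ⟨ξ, D_t u⟩ + ⟨∇^*_{dγ/dt} ξ, u⟩` for all one-forms `ξ`, where
`⟨∇^*_v ξ, Y⟩ = v(ξ(Y)) - ξ(∇_v Y)` is tensorial in `Y` and is computed with a section `Y`
through `u(t)`. -/
def _root_.IsCovDerivAlong (nabla : CovariantDerivative 𝓘(ℝ, E) F V) (u : I → TotalSpace F V)
    (t : I) (w : V (u t).proj) : Prop :=
  ∀ (ξ : BundleOneForm E F V) (Y : Cₛ^∞⟮𝓘(ℝ, E); F, V⟯), Y (u t).proj = (u t).snd →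
    intervalDeriv (fun s => ξ.eval (u s)) t =
      ξ.toFun _ w +
        (tangentApply E (pathVelocity (fun s => (u s).proj) t) (fun y => ξ.toFun y (Y y))
          - ξ.toFun _ (nabla (fun y => Y y) (u t).proj (pathVelocity (fun s => (u s).proj) t)))

/-- The torsion `T_∇(X, Y) = ∇_{♯X} Y - ∇_{♯Y} X - [X, Y]` at a point. -/
def torsionAt (nabla : CovariantDerivative 𝓘(ℝ, E) F V) (X Y : Cₛ^∞⟮𝓘(ℝ, E); F, V⟯) (x : M) : V x :=
  nabla (fun y => Y y) x (A.anchor x (X x)) - nabla (fun y => X y) x (A.anchor x (Y x))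
    - A.bracket X Y x

/-- `A`-homotopy of `A`-paths: there is a variation `a(ε, t)` of `A`-paths from `a₀` to `a₁`, whose
base paths `γ_ε` have fixed end points, such that the solution `b(ε, t) ∈ A_{γ(ε, t)}` of
`∂_t b - ∂_ε a = T_∇(a, b)`, `b(ε, 0) = 0`, satisfies `b(ε, 1) = 0` for all `ε`.
Here `∂_t`, `∂_ε` are covariant derivatives along `γ`. -/
def APathHomotopic (nabla : CovariantDerivative 𝓘(ℝ, E) F V) (a₀ a₁ : A.APath) : Prop :=
  ∃ (a : I → A.APath) (b : ∀ ε t : I, V ((a ε).toFun t).proj),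
    a 0 = a₀ ∧ a 1 = a₁ ∧
    ContMDiffOn 𝓘(ℝ, ℝ × ℝ) (𝓘(ℝ, E).prod 𝓘(ℝ, F)) ∞
      (squareExtend (fun ε t => (a ε).toFun t)) (Icc 0 1 ×ˢ Icc 0 1) ∧
    (∀ ε, ((a ε).toFun 0).proj = (a₀.toFun 0).proj ∧
      ((a ε).toFun 1).proj = (a₀.toFun 1).proj) ∧
    ContMDiffOn 𝓘(ℝ, ℝ × ℝ) (𝓘(ℝ, E).prod 𝓘(ℝ, F)) ∞
      (squareExtend (fun ε t => TotalSpace.mk' F ((a ε).toFun t).proj (b ε t)))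
      (Icc 0 1 ×ˢ Icc 0 1) ∧
    (∀ ε t, ∃ (Db Da : V ((a ε).toFun t).proj),
      IsCovDerivAlong nabla (fun s => TotalSpace.mk' F ((a ε).toFun s).proj (b ε s)) t Db ∧
      IsCovDerivAlong nabla (fun s => (a s).toFun t) ε Da ∧
      ∀ X Y : Cₛ^∞⟮𝓘(ℝ, E); F, V⟯, X _ = ((a ε).toFun t).snd → Y _ = b ε t →
        Db - Da = A.torsionAt nabla X Y _) ∧
    (∀ ε, b ε 0 = 0) ∧ ∀ ε, b ε 1 = 0

/-- The set `𝒢(A)` of arrows of the Weinstein groupoid: `A`-paths modulo `A`-homotopy (defined by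
means of a connection). -/
def WeinsteinArrows (nabla : CovariantDerivative 𝓘(ℝ, E) F V) : Type _ :=
  Quot (A.APathHomotopic nabla)

/-- The class of an `A`-path in `𝒢(A)`. -/
def pathClass (nabla : CovariantDerivative 𝓘(ℝ, E) F V) (a : A.APath) : A.WeinsteinArrows nabla :=
  Quot.mk _ a

/-- The `C^r` topology on the space `P(A)` of `A`-paths. -/
abbrev pathTopology (r : ℕ∞) : TopologicalSpace A.APath :=
  crTopology (𝓘(ℝ, E).prod 𝓘(ℝ, F)) (Icc 0 1) (fun a : A.APath => intervalExtend a.toFun) r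

/-- The quotient topology on `𝒢(A)`. -/
abbrev weinsteinTopology (nabla : CovariantDerivative 𝓘(ℝ, E) F V) (r : ℕ∞) :
    TopologicalSpace (A.WeinsteinArrows nabla) :=
  TopologicalSpace.coinduced (A.pathClass nabla) (pathTopology A r)

/-- The reparametrization `a^τ(t) = τ'(t) a(τ(t))`. -/
def pathReparam (τ : ℝ → ℝ) (a : I → TotalSpace F V) : I → TotalSpace F V :=
  fun t => fiberSMul (deriv τ (t : ℝ)) (intervalExtend a (τ (t : ℝ)))

/-- The concatenation `a₁ ⊙ a₀`, equal to `2 a₀(2t)` for `t ≤ 1/2` and to `2 a₁(2t - 1)` for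
`t > 1/2`. -/
def pathOdot (a₁ a₀ : I → TotalSpace F V) : I → TotalSpace F V :=
  fun t => if (t : ℝ) ≤ 1 / 2 then fiberSMul 2 (intervalExtend a₀ (2 * (t : ℝ)))
    else fiberSMul 2 (intervalExtend a₁ (2 * (t : ℝ) - 1))

/-- The groupoid structure of the Weinstein groupoid `𝒢(A)`: source and target of `[a]` are the end
points of the base path, the unit at `x` is the class of the zero path at `x`, the inverse of `[a]`
is the class of `t ↦ -a(1 - t)`, and `[a₁][a₀] = [a₁^τ ⊙ a₀^τ]` for every cut-off `τ` (all these
paths are again `A`-paths). -/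
structure IsWeinsteinGroupoid (nabla : CovariantDerivative 𝓘(ℝ, E) F V)
    (𝒢 : ArrowGroupoid (A.WeinsteinArrows nabla) M) : Prop where
  source_eq : ∀ a : A.APath, 𝒢.source (A.pathClass nabla a) = (a.toFun 0).proj
  target_eq : ∀ a : A.APath, 𝒢.target (A.pathClass nabla a) = (a.toFun 1).proj
  unit_eq : ∀ x : M, ∃ c : A.APath, (∀ t, c.toFun t = TotalSpace.mk' F x (0 : V x)) ∧
    𝒢.unit x = A.pathClass nabla c
  inv_eq : ∀ a : A.APath, ∃ c : A.APath,
    (∀ t, c.toFun t = fiberSMul (-1) (a.toFun (unitInterval.symm t))) ∧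
    𝒢.inv (A.pathClass nabla a) = A.pathClass nabla c
  mul_eq : ∀ τ, IsCutoff τ → ∀ (a₁ a₀ : A.APath)
    (p : 𝒢.source (A.pathClass nabla a₁) = 𝒢.target (A.pathClass nabla a₀)),
    ∃ c : A.APath,
      c.toFun = pathOdot (pathReparam τ a₁.toFun) (pathReparam τ a₀.toFun) ∧
      𝒢.mul (A.pathClass nabla a₁) (A.pathClass nabla a₀) p = A.pathClass nabla c

end LieAlgebroid

end Algebroid

end

set_option linter.unusedSectionVars false

noncomputable section

/-! ### Smoothness of maps into a manifold, tested on smooth functions -/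

section Detection

variable {E : Type*} [NormedAddCommGroup E] [NormedSpace ℝ E] [FiniteDimensional ℝ E]
  {M : Type*} [TopologicalSpace M] [T2Space M] [ChartedSpace E M] [IsManifold 𝓘(ℝ, E) ∞ M]

/-! Both homotopy relations are compared with a third one, `SquareHomotopic`: homotopy through a
morphism `p dt + q dε` on the square with `q = 0` on the sides t = 0 and t = 1. Such a morphism is
expressed by real functions only (`IsSquareMorphism`). This loses nothing, because smooth functions
and one-forms detect smoothness, points, tangent vectors and vectors of A
(`contMDiffOn_totalSpace_of_forall`, `eq_of_forall_smooth`, `eq_of_forall_tangentApply`,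
`eq_of_forall_oneForm`). What remains is calculus on the closed unit square.

For spheres the comparison is a change of notation (`sphereHomotopic_iff`). For A-homotopy, pair ∂_t
b − ∂_ε a = T_∇(a, b) with a one-form ξ. By `toFun_torsionAt` it becomes ∂_t ξ(b) − ∂_ε ξ(a) = (d_A
ξ)(a, b) − ⟨∇*_v ξ, a⟩, where v = ∂_ε γ − ♯b. A square morphism has v = 0, which gives one
implication. Conversely take ξ = d_A f. Since d_A d_A f = 0 and mixed partial derivatives commute,
∂_t v(f) = ⟨∇*_v (d_A f), a⟩, a homogeneous linear equation for v along each path. As v = 0 at t =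
0, v vanishes identically (`eq_zero_of_linear_ode`) and the error term disappears. In particular the
relation does not depend on ∇.

The groupoid laws come from one homotopy: two reparametrizations of a path with the same end points
are joined by linear interpolation (`pull_homotopic`). Hence the segments from s to t and from t to
u of one path compose to the segment from s to u, for s, t, u in any order (`concat_seg_homotopic`).
The factors of a concatenation are themselves homotopic to segments of it, so associativity, units,
inverses and independence of τ are all instances. Cut-offs serve to make gluing smooth
(`IsSquareMorphism.glue`).

Finally a₁ dt₁ ↦ a₁ is a homeomorphism for the C^r topologies (`sphereTopology_eq_induced`) that
matches the two relations, so it descends to the quotients. -/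

theorem exists_smooth_bump (x₀ : M) {U : Set M} (hU : U ∈ 𝓝 x₀) :
    ∃ ψ : C^∞⟮𝓘(ℝ, E), M; ℝ⟯, (∀ᶠ y in 𝓝 x₀, ψ y = 1) ∧ tsupport ψ ⊆ U := by
  obtain ⟨f, -, hf⟩ := (SmoothBumpFunction.nhds_basis_tsupport (E := E) (H := E) x₀).mem_iff.1 hU
  exact ⟨⟨f, f.contMDiff⟩, f.eventuallyEq_one, hf⟩

/-- A bump function times the chart. The two agree as germs at all points near `x₀`, so that their
derivatives agree there too. -/
theorem exists_smooth_extChartAt (x₀ : M) :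
    ∃ Φ : M → E, ContMDiff 𝓘(ℝ, E) 𝓘(ℝ, E) ∞ Φ ∧
      ∀ᶠ y in 𝓝 x₀, Φ =ᶠ[𝓝 y] extChartAt 𝓘(ℝ, E) x₀ := by
  obtain ⟨f⟩ : Nonempty (SmoothBumpFunction 𝓘(ℝ, E) x₀) := inferInstance
  refine ⟨fun y => f y • extChartAt 𝓘(ℝ, E) x₀ y, f.contMDiff_smul contMDiffOn_extChartAt, ?_⟩
  refine Filter.Eventually.mono (eventually_eventually_nhds.2 f.eventuallyEq_one) fun y hy => ?_
  filter_upwards [hy] with z hz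
  simp [hz]

theorem contDiffWithinAt_of_forall_dual {W G : Type*} [NormedAddCommGroup W] [NormedSpace ℝ W]
    [NormedAddCommGroup G] [NormedSpace ℝ G] [FiniteDimensional ℝ G] {g : W → G} {K : Set W} {w : W}
    (h : ∀ l : G →L[ℝ] ℝ, ContDiffWithinAt ℝ ∞ (fun w => l (g w)) K w) :
    ContDiffWithinAt ℝ ∞ g K w := by
  let b := Module.finBasis ℝ G
  refine b.equivFunL.comp_contDiffWithinAt_iff.1 (contDiffWithinAt_pi.2 ?_)
  intro i
  exact h (LinearMap.toContinuousLinearMap (b.coord i))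

/-- Continuity of γ is not assumed and has to come first. A bump function supported in a given
neighbourhood U of γ(w) is non-zero along γ near w, which forces γ into U. Only then does the chart,
extended to a global map, compute the coordinates of γ. -/
theorem contMDiffOn_of_forall_smooth {W : Type*} [NormedAddCommGroup W] [NormedSpace ℝ W]
    {γ : W → M} {K : Set W}
    (h : ∀ f : C^∞⟮𝓘(ℝ, E), M; ℝ⟯, ContDiffOn ℝ ∞ (fun w => f (γ w)) K) :
    ContMDiffOn 𝓘(ℝ, W) 𝓘(ℝ, E) ∞ γ K := by
  intro w hw
  rw [contMDiffWithinAt_iff_target]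
  have hc : ContinuousWithinAt γ K w := by
    intro U hU
    obtain ⟨ψ, hψ, hsupp⟩ := exists_smooth_bump (E := E) (γ w) hU
    have h1 : ψ (γ w) = 1 := hψ.self_of_nhds
    have h0 : ψ (γ w) ≠ 0 := by rw [h1]; exact one_ne_zero
    refine Filter.mem_map.2 ?_
    filter_upwards [((h ψ).continuousOn w hw).eventually_ne h0] with z hz
    exact hsupp (subset_tsupport _ hz)
  refine ⟨hc, ?_⟩
  obtain ⟨Φ, hΦ, hΦe⟩ := exists_smooth_extChartAt (E := E) (γ w)
  rw [contMDiffWithinAt_iff_contDiffWithinAt]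
  have : ContDiffWithinAt ℝ ∞ (fun z => Φ (γ z)) K w := by
    refine contDiffWithinAt_of_forall_dual fun l => ?_
    exact h ⟨fun y => l (Φ y), l.contMDiff.comp hΦ⟩ w hw
  refine this.congr_of_eventuallyEq_of_mem ?_ hw
  filter_upwards [hc (hΦe.self_of_nhds)] with z hz
  exact hz.symm

end Detection

/-! ### Global sections and one-forms that form dual frames near a point -/

section Frames

variable {E : Type*} [NormedAddCommGroup E] [NormedSpace ℝ E] [FiniteDimensional ℝ E]
  {M : Type*} [TopologicalSpace M] [T2Space M] [ChartedSpace E M] [IsManifold 𝓘(ℝ, E) ∞ M]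
  {F : Type*} [NormedAddCommGroup F] [NormedSpace ℝ F] [FiniteDimensional ℝ F]
  {V : M → Type*} [TopologicalSpace (TotalSpace F V)]
  [∀ x, AddCommGroup (V x)] [∀ x, Module ℝ (V x)] [∀ x, TopologicalSpace (V x)]
  [FiberBundle F V] [VectorBundle ℝ F V] [ContMDiffVectorBundle ∞ F V 𝓘(ℝ, E)]

/-- The coordinate form of a trivialization, cut off by a bump function. -/
theorem exists_cutoff_trivialization (x₀ : M) (ψ : C^∞⟮𝓘(ℝ, E), M; ℝ⟯)
    (hψ : tsupport ψ ⊆ (trivializationAt F V x₀).baseSet) :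
    ContMDiff (𝓘(ℝ, E).prod 𝓘(ℝ, F)) 𝓘(ℝ, F) ∞
      (fun v : TotalSpace F V => ψ v.proj • (trivializationAt F V x₀ v).2) := by
  set e := trivializationAt F V x₀
  intro v
  by_cases hv : v.proj ∈ e.baseSet
  · refine ContMDiffAt.smul ((ψ.contMDiff.comp (contMDiff_proj V)) v) ?_
    have := (e.contMDiffOn (IB := 𝓘(ℝ, E)) (n := ∞)) v (e.mem_source.2 hv)
    exact (this.contMDiffAt (e.open_source.mem_nhds (e.mem_source.2 hv))).snd
  -- Outside the base set the trivialization has arbitrary values, but there ψ vanishes on a whole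
  -- neighbourhood, the support being closed.
  · have hv' : v.proj ∉ tsupport ψ := fun h => hv (hψ h)
    have : ∀ᶠ u : TotalSpace F V in 𝓝 v, ψ u.proj = 0 := by
      have h1 : ∀ᶠ y in 𝓝 v.proj, ψ y = 0 := by
        filter_upwards [(isClosed_tsupport ψ).isOpen_compl.mem_nhds hv'] with y hy
        exact image_eq_zero_of_notMem_tsupport hy
      exact (FiberBundle.continuous_proj F V).continuousAt.eventually h1
    refine (contMDiffAt_const (c := (0 : F))).congr_of_eventuallyEq ?_
    filter_upwards [this] with u hu
    simp [hu]

/-- Near each point there are a frame of global sections and the dual frame of global one-forms. -/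
theorem exists_local_frame (x₀ : M) :
    ∃ (e : Fin (Module.finrank ℝ F) → Cₛ^∞⟮𝓘(ℝ, E); F, V⟯)
      (ε : Fin (Module.finrank ℝ F) → BundleOneForm E F V) (χ : C^∞⟮𝓘(ℝ, E), M; ℝ⟯),
      (∀ᶠ y in 𝓝 x₀, χ y = 1) ∧ (∀ y (v : V y), ∑ k, (ε k).toFun y v • e k y = χ y • v) ∧
      ∀ᶠ y in 𝓝 x₀, ∀ k (v : V y), (ε k).toFun y v =
        (Module.finBasis ℝ F).coord k ((trivializationAt F V x₀).linearMapAt ℝ y v) := by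
  set t := trivializationAt F V x₀ with ht
  obtain ⟨ψ, hψ1, hψ⟩ := exists_smooth_bump (E := E) x₀
    (t.open_baseSet.mem_nhds (FiberBundle.mem_baseSet_trivializationAt' x₀))
  let b := Module.finBasis ℝ F
  -- The frame and the coframe are both cut off by ψ, so their contraction is χ = ψ². The identity
  -- with χ then holds on all of M, not only near `x₀`.
  refine ⟨fun k => ⟨(ψ : M → ℝ) • t.localFrame b k, ContMDiffOn.smul_section_of_tsupport
      ψ.contMDiff.contMDiffOn t.open_baseSet hψ (t.contMDiffOn_localFrame_baseSet ∞ b k)⟩,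
    fun k => ⟨fun y => (b.coord k) ∘ₗ (ψ y • t.linearMapAt ℝ y), ?_⟩,
    ⟨fun y => ψ y * ψ y, ψ.contMDiff.mul ψ.contMDiff⟩, ?_, ?_, ?_⟩
  · have h1 := exists_cutoff_trivialization (F := F) (V := V) x₀ ψ hψ
    have h2 : ContMDiff (𝓘(ℝ, E).prod 𝓘(ℝ, F)) 𝓘(ℝ, ℝ) ∞ (fun v : TotalSpace F V =>
        (b.coord k).toContinuousLinearMap (ψ v.proj • (t v).2)) :=
      (ContinuousLinearMap.contMDiff _).comp h1
    refine h2.congr fun v => ?_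
    by_cases hv : v.proj ∈ t.baseSet
    · simp [Trivialization.coe_linearMapAt_of_mem _ hv]
    · simp [image_eq_zero_of_notMem_tsupport (fun h => hv (hψ h))]
  · filter_upwards [hψ1] with y hy
    simp [hy]
  · intro y v
    by_cases hy : y ∈ t.baseSet
    · have h1 : ∑ k, (t.basisAt b hy).repr v k • t.basisAt b hy k = v := (t.basisAt b hy).sum_repr v
      have h2 : ∀ k, (b.coord k) (t.linearMapAt ℝ y v) = (t.basisAt b hy).repr v k := by
        intro k
        simp [Trivialization.basisAt, Trivialization.coe_linearMapAt_of_mem _ hy]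
      simp only [ContMDiffSection.coeFn_mk, LinearMap.comp_apply, LinearMap.smul_apply, map_smul, h2,
        Pi.smul_apply', t.localFrame_apply_of_mem_baseSet b hy, ContMDiffMap.coeFn_mk]
      conv_rhs => rw [← h1, Finset.smul_sum]
      refine Finset.sum_congr rfl fun k _ => ?_
      rw [smul_smul, smul_smul]
      congr 1
      simp
      ring
    · have : ψ y = 0 := image_eq_zero_of_notMem_tsupport (fun h => hy (hψ h))
      simp [this]
  · filter_upwards [hψ1] with y hy k v
    simp [hy, b, t]

/-- A linear form on F composed with a cut-off trivialization is a global one-form, so one-forms see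
the fibre coordinates; functions on M take care of the base map. -/
theorem contMDiffOn_totalSpace_of_forall {W : Type*} [NormedAddCommGroup W] [NormedSpace ℝ W]
    {p : W → TotalSpace F V} {K : Set W}
    (hb : ∀ f : C^∞⟮𝓘(ℝ, E), M; ℝ⟯, ContDiffOn ℝ ∞ (fun w => f (p w).proj) K)
    (hf : ∀ ξ : BundleOneForm E F V, ContDiffOn ℝ ∞ (fun w => ξ.eval (p w)) K) :
    ContMDiffOn 𝓘(ℝ, W) (𝓘(ℝ, E).prod 𝓘(ℝ, F)) ∞ p K := by
  have hbase := contMDiffOn_of_forall_smooth hb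
  intro w hw
  rw [contMDiffWithinAt_totalSpace]
  refine ⟨hbase w hw, ?_⟩
  set t := trivializationAt F V (p w).proj with ht
  obtain ⟨ψ, hψ1, hψ⟩ := exists_smooth_bump (E := E) (p w).proj
    (t.open_baseSet.mem_nhds (FiberBundle.mem_baseSet_trivializationAt' _))
  have h1 := exists_cutoff_trivialization (F := F) (V := V) (p w).proj ψ hψ
  rw [contMDiffWithinAt_iff_contDiffWithinAt]
  have : ContDiffWithinAt ℝ ∞ (fun z => ψ (p z).proj • (t (p z)).2) K w := by
    refine contDiffWithinAt_of_forall_dual fun l => ?_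
    have h2 : ContMDiff (𝓘(ℝ, E).prod 𝓘(ℝ, F)) 𝓘(ℝ, ℝ) ∞ (fun v : TotalSpace F V =>
      l (ψ v.proj • (t v).2)) := l.contMDiff.comp h1
    have h3 : ∀ v : TotalSpace F V, (l.toLinearMap ∘ₗ (ψ v.proj • t.linearMapAt ℝ v.proj)) v.snd
        = l (ψ v.proj • (t v).2) := by
      intro v
      by_cases hv : v.proj ∈ t.baseSet
      · simp [Trivialization.coe_linearMapAt_of_mem _ hv]
      · simp [image_eq_zero_of_notMem_tsupport (fun h => hv (hψ h))]
    have h4 := hf ⟨fun y => l.toLinearMap ∘ₗ (ψ y • t.linearMapAt ℝ y), h2.congr h3⟩ w hw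
    exact h4.congr (fun z _ => (h3 (p z)).symm) (h3 (p w)).symm
  refine this.congr_of_eventuallyEq_of_mem ?_ hw
  filter_upwards [(hbase w hw).continuousWithinAt hψ1] with z hz
  have : ψ (p z).proj = 1 := hz
  simp [this]

/-- Every vector is the value of a global section. -/
theorem exists_section_eq (x : M) (v : V x) : ∃ X : Cₛ^∞⟮𝓘(ℝ, E); F, V⟯, X x = v := by
  obtain ⟨e, ε, χ, hχ, h, -⟩ := exists_local_frame (E := E) (F := F) (V := V) x
  refine ⟨∑ k, (ε k).toFun x v • e k, ?_⟩
  have h1 := h x v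
  rw [hχ.self_of_nhds, one_smul] at h1
  have : ∀ s : Finset (Fin (Module.finrank ℝ F)),
      (∑ k ∈ s, (ε k).toFun x v • e k) x = ∑ k ∈ s, (ε k).toFun x v • e k x := by
    intro s
    induction s using Finset.induction_on with
    | empty => simp
    | insert a s ha ih => simp only [Finset.sum_insert ha, ContMDiffSection.coe_add, Pi.add_apply, ih,
        ContMDiffSection.coe_smul, Pi.smul_apply]
  rw [this, h1]

/-- One-forms separate vectors. -/
theorem eq_of_forall_oneForm {x : M} {u v : V x}
    (h : ∀ ξ : BundleOneForm E F V, ξ.toFun x u = ξ.toFun x v) : u = v := by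
  obtain ⟨e, ε, χ, hχ, he, -⟩ := exists_local_frame (E := E) (F := F) (V := V) x
  have hu := he x u
  have hv := he x v
  rw [hχ.self_of_nhds, one_smul] at hu hv
  rw [← hu, ← hv]
  simp [h]

end Frames

/-! ### Tangent vectors as derivations -/

section Tangent

variable {E : Type*} [NormedAddCommGroup E] [NormedSpace ℝ E] [FiniteDimensional ℝ E]
  {M : Type*} [TopologicalSpace M] [T2Space M] [ChartedSpace E M] [IsManifold 𝓘(ℝ, E) ∞ M]

theorem C_mdifferentiableAt (f : C^∞⟮𝓘(ℝ, E), M; ℝ⟯) (x : M) :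
    MDifferentiableAt 𝓘(ℝ, E) 𝓘(ℝ, ℝ) f x :=
  f.contMDiff.mdifferentiable (by simp) x

theorem tangentApply_add_left {x : M} (v w : TangentSpace 𝓘(ℝ, E) x) (f : M → ℝ) :
    tangentApply E (v + w) f = tangentApply E v f + tangentApply E w f :=
  map_add _ _ _

theorem tangentApply_smul_left {x : M} (c : ℝ) (v : TangentSpace 𝓘(ℝ, E) x) (f : M → ℝ) :
    tangentApply E (c • v) f = c * tangentApply E v f :=
  map_smul _ _ _

theorem tangentApply_sub_left {x : M} (v w : TangentSpace 𝓘(ℝ, E) x) (f : M → ℝ) :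
    tangentApply E (v - w) f = tangentApply E v f - tangentApply E w f :=
  map_sub _ _ _

theorem tangentApply_zero_left {x : M} (f : M → ℝ) :
    tangentApply E (0 : TangentSpace 𝓘(ℝ, E) x) f = 0 :=
  map_zero _

theorem tangentApply_mul {x : M} (v : TangentSpace 𝓘(ℝ, E) x) {f g : M → ℝ}
    (hf : MDifferentiableAt 𝓘(ℝ, E) 𝓘(ℝ, ℝ) f x) (hg : MDifferentiableAt 𝓘(ℝ, E) 𝓘(ℝ, ℝ) g x) :
    tangentApply E v (fun y => f y * g y) = f x * tangentApply E v g + g x * tangentApply E v f := by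
  have h := (hf.hasMFDerivAt.mul hg.hasMFDerivAt).mfderiv
  exact congrArg (fun L => L v) h

theorem tangentApply_add {x : M} (v : TangentSpace 𝓘(ℝ, E) x) {f g : M → ℝ}
    (hf : MDifferentiableAt 𝓘(ℝ, E) 𝓘(ℝ, ℝ) f x) (hg : MDifferentiableAt 𝓘(ℝ, E) 𝓘(ℝ, ℝ) g x) :
    tangentApply E v (fun y => f y + g y) = tangentApply E v f + tangentApply E v g := by
  have h := (hf.hasMFDerivAt.add hg.hasMFDerivAt).mfderiv
  exact congrArg (fun L => L v) h

theorem tangentApply_const {x : M} (v : TangentSpace 𝓘(ℝ, E) x) (c : ℝ) :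
    tangentApply E v (fun _ => c) = 0 := by
  simp only [tangentApply, mfderiv_const]
  rfl

theorem tangentApply_congr {x : M} (v : TangentSpace 𝓘(ℝ, E) x) {f g : M → ℝ}
    (h : f =ᶠ[𝓝 x] g) : tangentApply E v f = tangentApply E v g := by
  simp only [tangentApply]
  rw [h.mfderiv_eq]
  rfl

theorem tangentApply_eq_zero_of_eventually_one {x : M} (v : TangentSpace 𝓘(ℝ, E) x) {χ : M → ℝ}
    (h : ∀ᶠ y in 𝓝 x, χ y = 1) : tangentApply E v χ = 0 := by
  rw [tangentApply_congr v (g := fun _ => 1) h, tangentApply_const]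

/-- Near each point there are smooth functions whose differentials are a coframe with a smooth dual
frame. -/
theorem exists_local_coordinates (x₀ : M) :
    ∃ (f : Fin (Module.finrank ℝ E) → C^∞⟮𝓘(ℝ, E), M; ℝ⟯)
      (Z : Fin (Module.finrank ℝ E) → Cₛ^∞⟮𝓘(ℝ, E); E, (TangentSpace 𝓘(ℝ, E) : M → Type _)⟯),
      ∀ᶠ y in 𝓝 x₀, ∀ v : TangentSpace 𝓘(ℝ, E) y, v = ∑ i, tangentApply E v (f i) • Z i y := by
  obtain ⟨Z, ε, χ, hχ, h1, h2⟩ := exists_local_frame (E := E) (F := E)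
    (V := (TangentSpace 𝓘(ℝ, E) : M → Type _)) x₀
  obtain ⟨Φ, hΦ, hΦe⟩ := exists_smooth_extChartAt (E := E) x₀
  let b := Module.finBasis ℝ E
  refine ⟨fun i => ⟨fun y => LinearMap.toContinuousLinearMap (b.coord i) (Φ y),
    (ContinuousLinearMap.contMDiff _).comp hΦ⟩, Z, ?_⟩
  filter_upwards [hχ, h2, hΦe, chart_source_mem_nhds E x₀] with y hy1 hy2 hy3 hy4 v
  have h3 := h1 y v
  rw [hy1, one_smul] at h3
  conv_lhs => rw [← h3]
  refine Finset.sum_congr rfl fun i _ => ?_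
  congr 1
  rw [hy2]
  -- The trivialization of the tangent bundle acts at y as the derivative of the chart, so the
  -- coframe consists of the differentials of the coordinates.
  have h5 : mfderiv 𝓘(ℝ, E) 𝓘(ℝ, E) Φ y = mfderiv 𝓘(ℝ, E) 𝓘(ℝ, E) (extChartAt 𝓘(ℝ, E) x₀) y :=
    hy3.mfderiv_eq
  have h6 : (trivializationAt E (TangentSpace 𝓘(ℝ, E)) x₀).continuousLinearMapAt ℝ y =
      mfderiv 𝓘(ℝ, E) 𝓘(ℝ, E) (extChartAt 𝓘(ℝ, E) x₀) y :=
    TangentBundle.continuousLinearMapAt_trivializationAt hy4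
  have h7 : HasMFDerivAt 𝓘(ℝ, E) 𝓘(ℝ, ℝ)
      (fun z => LinearMap.toContinuousLinearMap (b.coord i) (Φ z)) y
      ((LinearMap.toContinuousLinearMap (b.coord i)).comp (mfderiv 𝓘(ℝ, E) 𝓘(ℝ, E) Φ y)) :=
    (ContinuousLinearMap.hasMFDerivAt _).comp y (hΦ.mdifferentiable (by simp) y).hasMFDerivAt
  have h8 : tangentApply E v (fun z => LinearMap.toContinuousLinearMap (b.coord i) (Φ z)) =
      b.coord i (mfderiv 𝓘(ℝ, E) 𝓘(ℝ, E) Φ y v) := by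
    rw [tangentApply, h7.mfderiv]
    rfl
  refine Eq.trans ?_ h8.symm
  rw [h5, ← h6]
  rfl

theorem eq_of_forall_tangentApply {x : M} {v w : TangentSpace 𝓘(ℝ, E) x}
    (h : ∀ f : C^∞⟮𝓘(ℝ, E), M; ℝ⟯, tangentApply E v f = tangentApply E w f) : v = w := by
  obtain ⟨f, Z, hZ⟩ := exists_local_coordinates (E := E) x
  rw [hZ.self_of_nhds v, hZ.self_of_nhds w]
  simp [h]

theorem hasDerivWithinAt_comp_pathVelocity {γ : I → M} {t : I}
    (hγ : MDifferentiableWithinAt 𝓘(ℝ, ℝ) 𝓘(ℝ, E) (intervalExtend γ) (Icc 0 1) (t : ℝ))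
    {f : M → ℝ} (hf : MDifferentiableAt 𝓘(ℝ, E) 𝓘(ℝ, ℝ) f (γ t)) :
    HasDerivWithinAt (fun s => f (intervalExtend γ s)) (tangentApply E (pathVelocity γ t) f)
      (Icc 0 1) (t : ℝ) := by
  have ht : intervalExtend γ t = γ t := by simp [intervalExtend]
  have h1 : HasMFDerivAt 𝓘(ℝ, E) 𝓘(ℝ, ℝ) f (intervalExtend γ t)
      (mfderiv 𝓘(ℝ, E) 𝓘(ℝ, ℝ) f (intervalExtend γ t)) := by
    rw [ht]; exact hf.hasMFDerivAt
  have h2 := hasMFDerivWithinAt_iff_hasFDerivWithinAt.1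
    (h1.comp_hasMFDerivWithinAt (t : ℝ) hγ.hasMFDerivWithinAt)
  rw [ht] at h2
  let L₁ : E →L[ℝ] ℝ := mfderiv 𝓘(ℝ, E) 𝓘(ℝ, ℝ) f (γ t)
  let L₂ : ℝ →L[ℝ] E := mfderivWithin 𝓘(ℝ, ℝ) 𝓘(ℝ, E) (intervalExtend γ) (Icc 0 1) (t : ℝ)
  exact HasFDerivWithinAt.hasDerivWithinAt (f' := L₁.comp L₂) h2

end Tangent

/-! ### Tensoriality and sections through a given vector -/

section Sections

variable {E : Type*} [NormedAddCommGroup E] [NormedSpace ℝ E] [FiniteDimensional ℝ E]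
  {M : Type*} [TopologicalSpace M] [T2Space M] [ChartedSpace E M] [IsManifold 𝓘(ℝ, E) ∞ M]
  {F : Type*} [NormedAddCommGroup F] [NormedSpace ℝ F] [FiniteDimensional ℝ F]
  {V : M → Type*} [TopologicalSpace (TotalSpace F V)]
  [∀ x, AddCommGroup (V x)] [∀ x, Module ℝ (V x)] [∀ x, TopologicalSpace (V x)]
  [FiberBundle F V] [VectorBundle ℝ F V] [ContMDiffVectorBundle ∞ F V 𝓘(ℝ, E)]

/-- The differential of a function at a point, as a linear form. -/
def tangentApplyHom (f : M → ℝ) (x : M) : TangentSpace 𝓘(ℝ, E) x →ₗ[ℝ] ℝ where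
  toFun v := tangentApply E v f
  map_add' v w := tangentApply_add_left v w f
  map_smul' c v := tangentApply_smul_left c v f

variable (E) in
/-- A constant, as a smooth function. -/
def constSmooth (c : ℝ) : C^∞⟮𝓘(ℝ, E), M; ℝ⟯ := ⟨fun _ => c, contMDiff_const⟩

/-- The product of a smooth function and a smooth section. -/
def smulSection (f : C^∞⟮𝓘(ℝ, E), M; ℝ⟯) (Y : Cₛ^∞⟮𝓘(ℝ, E); F, V⟯) : Cₛ^∞⟮𝓘(ℝ, E); F, V⟯ :=
  ⟨fun y => f y • Y y, f.contMDiff.smul_section Y.contMDiff⟩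

theorem smulSection_apply (f : C^∞⟮𝓘(ℝ, E), M; ℝ⟯) (Y : Cₛ^∞⟮𝓘(ℝ, E); F, V⟯) (x : M) :
    smulSection f Y x = f x • Y x := rfl

/-- The smooth function obtained by pairing a one-form with a section. -/
def BundleOneForm.pair (ξ : BundleOneForm E F V) (Y : Cₛ^∞⟮𝓘(ℝ, E); F, V⟯) :
    C^∞⟮𝓘(ℝ, E), M; ℝ⟯ :=
  ⟨fun y => ξ.toFun y (Y y), ξ.smooth.comp Y.contMDiff⟩

theorem BundleOneForm.coe_pair (ξ : BundleOneForm E F V) (Y : Cₛ^∞⟮𝓘(ℝ, E); F, V⟯) :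
    ⇑(ξ.pair Y) = fun y => ξ.toFun y (Y y) := rfl

theorem BundleOneForm.pair_apply (ξ : BundleOneForm E F V) (Y : Cₛ^∞⟮𝓘(ℝ, E); F, V⟯) (x : M) :
    ξ.pair Y x = ξ.toFun x (Y x) := rfl

theorem ContMDiffSection.sum_apply {ι : Type*} (s : Finset ι) (Y : ι → Cₛ^∞⟮𝓘(ℝ, E); F, V⟯) (x : M) :
    (∑ k ∈ s, Y k) x = ∑ k ∈ s, Y k x := by
  classical
  induction s using Finset.induction_on with
  | empty => simp
  | insert a s ha ih =>
    simp only [Finset.sum_insert ha, ContMDiffSection.coe_add, Pi.add_apply, ih]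

/-- An additive functional on sections that is linear over functions at `x` is tensorial. -/
theorem eq_of_tensorial {x : M} (L : Cₛ^∞⟮𝓘(ℝ, E); F, V⟯ →+ ℝ)
    (hL : ∀ (f : C^∞⟮𝓘(ℝ, E), M; ℝ⟯) Y, L (smulSection f Y) = f x * L Y)
    {Y Y' : Cₛ^∞⟮𝓘(ℝ, E); F, V⟯} (h : Y x = Y' x) : L Y = L Y' := by
  obtain ⟨e, ε, χ, hχ, he, -⟩ := exists_local_frame (E := E) (F := F) (V := V) x
  have key : ∀ Y : Cₛ^∞⟮𝓘(ℝ, E); F, V⟯, L Y = ∑ k, (ε k).toFun x (Y x) * L (e k) := by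
    intro Y
    -- A global identity of sections, to which linearity over functions applies; at x it computes L
    -- Y itself because χ(x) = 1.
    have h1 : smulSection χ Y = ∑ k, smulSection ((ε k).pair Y) (e k) := by
      ext y
      rw [ContMDiffSection.sum_apply, smulSection_apply, ← he y (Y y)]
      rfl
    have h2 := congrArg L h1
    rw [hL, hχ.self_of_nhds, one_mul, map_sum] at h2
    rw [h2]
    exact Finset.sum_congr rfl fun k _ => hL _ _
  rw [key Y, key Y', h]

/-- A global section through a vector. -/
def sectionThrough (u : TotalSpace F V) : Cₛ^∞⟮𝓘(ℝ, E); F, V⟯ :=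
  (exists_section_eq (E := E) u.proj u.snd).choose

theorem sectionThrough_apply (u : TotalSpace F V) :
    (sectionThrough u : Cₛ^∞⟮𝓘(ℝ, E); F, V⟯) u.proj = u.snd :=
  (exists_section_eq (E := E) u.proj u.snd).choose_spec

theorem sectionThrough_mk_apply (x : M) (v : V x) :
    (sectionThrough ⟨x, v⟩ : Cₛ^∞⟮𝓘(ℝ, E); F, V⟯) x = v :=
  sectionThrough_apply (⟨x, v⟩ : TotalSpace F V)

end Sections

namespace LieAlgebroid

/-! ### The differential of a Lie algebroid on functions and one-forms -/

section Differential

variable {E : Type*} [NormedAddCommGroup E] [NormedSpace ℝ E] [FiniteDimensional ℝ E]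
  {M : Type*} [TopologicalSpace M] [T2Space M] [ChartedSpace E M] [IsManifold 𝓘(ℝ, E) ∞ M]
  {F : Type*} [NormedAddCommGroup F] [NormedSpace ℝ F] [FiniteDimensional ℝ F]
  {V : M → Type*} [TopologicalSpace (TotalSpace F V)]
  [∀ x, AddCommGroup (V x)] [∀ x, Module ℝ (V x)] [∀ x, TopologicalSpace (V x)]
  [FiberBundle F V] [VectorBundle ℝ F V] [ContMDiffVectorBundle ∞ F V 𝓘(ℝ, E)]
  (A : LieAlgebroid E F V)

/-- The differential of a function, as a one-form. -/
def dFunForm (f : C^∞⟮𝓘(ℝ, E), M; ℝ⟯) : BundleOneForm E F V where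
  toFun x := tangentApplyHom f x ∘ₗ A.anchor x
  smooth := by
    have h1 : ContMDiff 𝓘(ℝ, E).tangent 𝓘(ℝ, ℝ).tangent ∞ (tangentMap 𝓘(ℝ, E) 𝓘(ℝ, ℝ) f) :=
      f.contMDiff.contMDiff_tangentMap (by simp)
    exact (contMDiff_snd_tangentBundle_modelSpace ℝ 𝓘(ℝ, ℝ)).comp (h1.comp A.smooth_anchor)

theorem dFunForm_apply (f : C^∞⟮𝓘(ℝ, E), M; ℝ⟯) (x : M) (v : V x) :
    (A.dFunForm f).toFun x v = tangentApply E (A.anchor x v) f := rfl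

theorem bracket_antisymm (X Y : Cₛ^∞⟮𝓘(ℝ, E); F, V⟯) : A.bracket X Y = - A.bracket Y X := by
  have h := A.bracket_self (X + Y)
  simp only [map_add, LinearMap.add_apply, A.bracket_self, zero_add, add_zero] at h
  exact eq_neg_of_add_eq_zero_right h

theorem leibniz_smulSection (X Y : Cₛ^∞⟮𝓘(ℝ, E); F, V⟯) (f : C^∞⟮𝓘(ℝ, E), M; ℝ⟯) :
    A.bracket X (smulSection f Y) =
      smulSection f (A.bracket X Y) + smulSection ((A.dFunForm f).pair X) Y := by
  ext x
  exact A.leibniz X Y f x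

theorem bracket_bracket (X Y Z : Cₛ^∞⟮𝓘(ℝ, E); F, V⟯) :
    A.bracket (A.bracket X Y) Z = A.bracket X (A.bracket Y Z) - A.bracket Y (A.bracket X Z) := by
  have h := A.jacobi X Y Z
  rw [A.bracket_antisymm (A.bracket Y Z) X, A.bracket_antisymm (A.bracket Z X) Y,
    A.bracket_antisymm Z X, map_neg, neg_neg] at h
  rw [← sub_eq_zero, ← h]
  abel

/-- The anchor is compatible with brackets. -/
theorem anchor_bracket_smul (X Y Z : Cₛ^∞⟮𝓘(ℝ, E); F, V⟯) (f : C^∞⟮𝓘(ℝ, E), M; ℝ⟯) (x : M) :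
    (A.dFunForm f).toFun x (A.bracket X Y x) • Z x =
      ((A.dFunForm ((A.dFunForm f).pair Y)).toFun x (X x) -
        (A.dFunForm ((A.dFunForm f).pair X)).toFun x (Y x)) • Z x := by
  -- In the Jacobi identity for X, Y, fZ, expanded by the Leibniz rule, the terms with one
  -- derivative of f in front of a bracket cancel, and f times the identity for X, Y, Z removes
  -- those without derivatives. Only multiples of Z are left.
  have h := A.bracket_bracket X Y (smulSection f Z)
  simp only [leibniz_smulSection, map_add] at h
  have h1 := congrArg (fun S : Cₛ^∞⟮𝓘(ℝ, E); F, V⟯ => S x) h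
  have h2 := congrArg (fun S : Cₛ^∞⟮𝓘(ℝ, E); F, V⟯ => f x • S x) (A.bracket_bracket X Y Z)
  simp only [ContMDiffSection.coe_add, ContMDiffSection.coe_sub, Pi.add_apply, Pi.sub_apply,
    smulSection_apply, BundleOneForm.pair_apply] at h1 h2
  rw [h2] at h1
  have h3 := sub_eq_zero.2 h1
  rw [← sub_eq_zero, ← h3]
  module

theorem dOneForm_antisymm (ξ : BundleOneForm E F V) (X Y : Cₛ^∞⟮𝓘(ℝ, E); F, V⟯) (x : M) :
    A.dOneForm ξ X Y x = - A.dOneForm ξ Y X x := by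
  simp only [dOneForm, A.bracket_antisymm X Y, ContMDiffSection.coe_neg, Pi.neg_apply, map_neg]
  ring

/-- The map `Y ↦ (d_A ξ)(X, Y)` at a point. -/
def dOneFormHom (ξ : BundleOneForm E F V) (X : Cₛ^∞⟮𝓘(ℝ, E); F, V⟯) (x : M) :
    Cₛ^∞⟮𝓘(ℝ, E); F, V⟯ →+ ℝ :=
  AddMonoidHom.mk' (fun Y => A.dOneForm ξ X Y x) fun Y Y' => by
    have h := tangentApply_add (A.anchor x (X x)) (C_mdifferentiableAt (ξ.pair Y) x)
      (C_mdifferentiableAt (ξ.pair Y') x)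
    simp only [BundleOneForm.coe_pair] at h
    simp only [dOneForm, ContMDiffSection.coe_add, Pi.add_apply, map_add, tangentApply_add_left]
    rw [h]
    ring

/-- The term ♯X(f) ξ(Y) occurs once in ♯X(ξ(fY)) and once in ξ([X, fY]), and cancels. With
antisymmetry this makes d_A ξ tensorial in both arguments. -/
theorem dOneForm_smul_right (ξ : BundleOneForm E F V) (X Y : Cₛ^∞⟮𝓘(ℝ, E); F, V⟯)
    (f : C^∞⟮𝓘(ℝ, E), M; ℝ⟯) (x : M) :
    A.dOneForm ξ X (smulSection f Y) x = f x * A.dOneForm ξ X Y x := by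
  have h := tangentApply_mul (A.anchor x (X x)) (C_mdifferentiableAt f x)
      (C_mdifferentiableAt (ξ.pair Y) x)
  simp only [BundleOneForm.coe_pair] at h
  simp only [dOneForm, leibniz_smulSection, ContMDiffSection.coe_add, Pi.add_apply, map_add,
    smulSection_apply, map_smul, tangentApply_smul_left, smul_eq_mul, BundleOneForm.pair_apply,
    dFunForm_apply]
  rw [h]
  ring

theorem dOneForm_congr (ξ : BundleOneForm E F V) {X X' Y Y' : Cₛ^∞⟮𝓘(ℝ, E); F, V⟯} {x : M}
    (hX : X x = X' x) (hY : Y x = Y' x) : A.dOneForm ξ X Y x = A.dOneForm ξ X' Y' x := by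
  have key : ∀ (X : Cₛ^∞⟮𝓘(ℝ, E); F, V⟯) {Y Y' : Cₛ^∞⟮𝓘(ℝ, E); F, V⟯}, Y x = Y' x →
      A.dOneForm ξ X Y x = A.dOneForm ξ X Y' x := fun X Y Y' h =>
    eq_of_tensorial (A.dOneFormHom ξ X x) (fun f Y => A.dOneForm_smul_right ξ X Y f x) h
  rw [key X hY, A.dOneForm_antisymm, key Y' hX, ← A.dOneForm_antisymm]

/-- The value of `d_A ξ` on two vectors with the same base point. -/
def dOne (ξ : BundleOneForm E F V) (u v : TotalSpace F V) : ℝ :=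
  A.dOneForm ξ (sectionThrough u) (sectionThrough v) u.proj

theorem dOneForm_eq_dOne (ξ : BundleOneForm E F V) {u v : TotalSpace F V}
    (X Y : Cₛ^∞⟮𝓘(ℝ, E); F, V⟯) {x : M} (hX : TotalSpace.mk' F x (X x) = u)
    (hY : TotalSpace.mk' F x (Y x) = v) : A.dOneForm ξ X Y x = A.dOne ξ u v := by
  subst hX hY
  exact A.dOneForm_congr ξ (sectionThrough_mk_apply (E := E) x _).symm
    (sectionThrough_mk_apply (E := E) x _).symm

theorem dOne_antisymm (ξ : BundleOneForm E F V) {u v : TotalSpace F V} (h : v.proj = u.proj) :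
    A.dOne ξ u v = - A.dOne ξ v u := by
  rw [dOne, dOneForm_antisymm, dOne, h]

theorem dOne_smul_right (ξ : BundleOneForm E F V) {u v : TotalSpace F V} (h : v.proj = u.proj)
    (c : ℝ) : A.dOne ξ u (fiberSMul c v) = c * A.dOne ξ u v := by
  obtain ⟨x, u⟩ := u
  obtain ⟨y, v⟩ := v
  obtain rfl : y = x := h
  have h1 := A.dOneForm_smul_right ξ (sectionThrough ⟨y, u⟩) (sectionThrough ⟨y, v⟩)
    (constSmooth E c) y
  rw [← A.dOneForm_eq_dOne ξ (x := y) (sectionThrough ⟨y, u⟩)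
    (smulSection (constSmooth E c) (sectionThrough ⟨y, v⟩)), h1]
  · rfl
  · rw [sectionThrough_mk_apply]
  · rw [smulSection_apply, sectionThrough_mk_apply]
    rfl

theorem dOne_smul_left (ξ : BundleOneForm E F V) {u v : TotalSpace F V} (h : v.proj = u.proj)
    (c : ℝ) : A.dOne ξ (fiberSMul c u) v = c * A.dOne ξ u v := by
  rw [dOne_antisymm, dOne_smul_right, dOne_antisymm]
  · ring
  all_goals first | exact h | exact h.symm

theorem dOne_self (ξ : BundleOneForm E F V) (u : TotalSpace F V) : A.dOne ξ u u = 0 := by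
  have := A.dOne_antisymm ξ (rfl : u.proj = u.proj)
  linarith

/-- This is d_A² = 0 on functions, from the compatibility of the anchor with brackets. That
compatibility is known only after multiplication by a section Z, so Z is taken non-zero at x; where
the fibre is zero, tensoriality gives the result. -/
theorem dOneForm_dFunForm (f : C^∞⟮𝓘(ℝ, E), M; ℝ⟯) (X Y : Cₛ^∞⟮𝓘(ℝ, E); F, V⟯) (x : M) :
    A.dOneForm (A.dFunForm f) X Y x = 0 := by
  by_cases hx : ∃ z : V x, z ≠ 0
  · obtain ⟨z, hz⟩ := hx
    obtain ⟨Z, rfl⟩ := exists_section_eq (E := E) (F := F) x z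
    have h := smul_left_injective ℝ hz (A.anchor_bracket_smul X Y Z f x)
    simp only [dOneForm]
    rw [h]
    exact sub_self _
  · push Not at hx
    have h : X x = (0 : Cₛ^∞⟮𝓘(ℝ, E); F, V⟯) x := (hx _).trans (hx _).symm
    rw [A.dOneForm_antisymm, A.dOneForm_congr _ rfl h]
    have h0 : A.dOneForm (A.dFunForm f) Y 0 x = 0 := map_zero (A.dOneFormHom (A.dFunForm f) Y x)
    rw [h0, neg_zero]

end Differential

end LieAlgebroid

/-! ### Cut-off functions -/

section Cutoff

/-- The point t = 0 is included: the derivative is computed inside the half-line on which τ is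
constant. Vanishing speed at the junction is what makes concatenations smooth. -/
theorem IsCutoff.deriv_eq_zero_of_nonpos {τ : ℝ → ℝ} (h : IsCutoff τ) {t : ℝ} (ht : t ≤ 0) :
    deriv τ t = 0 := by
  have hd : HasDerivWithinAt τ (deriv τ t) (Iic t) t :=
    (h.smooth.differentiable (by simp) t).hasDerivAt.hasDerivWithinAt
  have hc : HasDerivWithinAt τ 0 (Iic t) t :=
    (hasDerivWithinAt_const t (Iic t) (0 : ℝ)).congr
      (fun s hs => h.eq_zero s (le_trans hs ht)) (h.eq_zero t ht)
  exact (uniqueDiffWithinAt_Iic t).eq_deriv _ hd hc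

theorem IsCutoff.deriv_eq_zero_of_one_le {τ : ℝ → ℝ} (h : IsCutoff τ) {t : ℝ} (ht : 1 ≤ t) :
    deriv τ t = 0 := by
  have hd : HasDerivWithinAt τ (deriv τ t) (Ici t) t :=
    (h.smooth.differentiable (by simp) t).hasDerivAt.hasDerivWithinAt
  have hc : HasDerivWithinAt τ 0 (Ici t) t :=
    (hasDerivWithinAt_const t (Ici t) (1 : ℝ)).congr
      (fun s hs => h.eq_one s (le_trans ht hs)) (h.eq_one t ht)
  exact (uniqueDiffWithinAt_Ici t).eq_deriv _ hd hc

theorem IsCutoff.mem_Icc {τ : ℝ → ℝ} (h : IsCutoff τ) (t : ℝ) : τ t ∈ Icc (0 : ℝ) 1 := by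
  have hm : Monotone τ := by
    refine monotone_of_deriv_nonneg (h.smooth.differentiable (by simp)) fun s => ?_
    rcases le_or_gt s 0 with hs | hs
    · rw [h.deriv_eq_zero_of_nonpos hs]
    rcases le_or_gt 1 s with hs' | hs'
    · rw [h.deriv_eq_zero_of_one_le hs']
    · exact (h.deriv_pos s ⟨hs, hs'⟩).le
  refine ⟨?_, ?_⟩
  · rw [← h.eq_zero (min t 0) (min_le_right _ _)]
    exact hm (min_le_left _ _)
  · rw [← h.eq_one (max t 1) (le_max_right _ _)]
    exact hm (le_max_left _ _)

theorem IsCutoff.hasDerivAt {τ : ℝ → ℝ} (h : IsCutoff τ) (t : ℝ) : HasDerivAt τ (deriv τ t) t :=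
  (h.smooth.differentiable (by simp) t).hasDerivAt

theorem IsCutoff.contDiff_deriv {τ : ℝ → ℝ} (h : IsCutoff τ) : ContDiff ℝ ∞ (deriv τ) :=
  h.smooth.iterate_deriv 1

theorem IsCutoff.hasDerivAt_two_mul {τ : ℝ → ℝ} (h : IsCutoff τ) (t : ℝ) :
    HasDerivAt (fun s => τ (2 * s)) (2 * deriv τ (2 * t)) t := by
  have := (h.hasDerivAt (2 * t)).comp t ((hasDerivAt_id t).const_mul 2)
  simpa [Function.comp_def, mul_comm] using this

theorem IsCutoff.hasDerivAt_two_mul_sub {τ : ℝ → ℝ} (h : IsCutoff τ) (t : ℝ) :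
    HasDerivAt (fun s => τ (2 * s - 1)) (2 * deriv τ (2 * t - 1)) t := by
  have := (h.hasDerivAt (2 * t - 1)).comp t (((hasDerivAt_id t).const_mul 2).sub_const 1)
  simpa [Function.comp_def, mul_comm] using this

theorem hasDerivAt_expNegInvGlue {x : ℝ} (hx : 0 < x) :
    HasDerivAt expNegInvGlue (Real.exp (-x⁻¹) * (x ^ 2)⁻¹) x := by
  have h1 : HasDerivAt (fun y : ℝ => Real.exp (-y⁻¹)) (Real.exp (-x⁻¹) * (x ^ 2)⁻¹) x := by
    have := ((hasDerivAt_inv hx.ne').neg).exp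
    simpa using! this
  refine h1.congr_of_eventuallyEq ?_
  filter_upwards [lt_mem_nhds hx] with y hy
  simp [expNegInvGlue, not_le.2 hy]

/-- One explicit cut-off is needed to prove transitivity of homotopy and to define the product of
two classes. -/
theorem isCutoff_smoothTransition : IsCutoff Real.smoothTransition where
  smooth := Real.smoothTransition.contDiff
  eq_zero _ ht := Real.smoothTransition.zero_of_nonpos ht
  eq_one _ ht := Real.smoothTransition.one_of_one_le ht
  deriv_pos t ht := by
    have h0 : 0 < t := ht.1
    have h1 : 0 < 1 - t := sub_pos.2 ht.2
    have hg := hasDerivAt_expNegInvGlue h0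
    have hg' := (hasDerivAt_expNegInvGlue h1).comp t ((hasDerivAt_id t).const_sub 1)
    have hpos := Real.smoothTransition.pos_denom t
    -- With g = `expNegInvGlue`, the transition is g(t)/(g(t) + g(1 − t)), and the numerator of its
    -- derivative is g′(t)g(1 − t) + g(t)g′(1 − t).
    have h := hg.div (hg.add hg') hpos.ne'
    have hd : deriv Real.smoothTransition t = _ := h.deriv
    rw [hd]
    refine div_pos ?_ (pow_pos hpos 2)
    have e0 := expNegInvGlue.pos_of_pos h0
    have e1 := expNegInvGlue.pos_of_pos h1
    have d0 : 0 < Real.exp (-t⁻¹) * (t ^ 2)⁻¹ := by positivity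
    have d1 : 0 < Real.exp (-(1 - t)⁻¹) * ((1 - t) ^ 2)⁻¹ := by positivity
    have := mul_pos d0 e1
    have := mul_pos d1 e0
    simp only [Pi.add_apply, Function.comp_apply]
    nlinarith

end Cutoff

/-! ### Functions of two variables on the closed square -/

section SquareCalculus

variable {G : ℝ → ℝ → ℝ}

theorem ContDiffOn.slice_fst
    (h : ContDiffOn ℝ ∞ (fun s : ℝ × ℝ => G s.1 s.2) (Icc 0 1 ×ˢ Icc 0 1)) {ε : ℝ}
    (hε : ε ∈ Icc (0 : ℝ) 1) : ContDiffOn ℝ ∞ (fun t => G t ε) (Icc 0 1) :=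
  h.comp (f := fun t : ℝ => (t, ε)) (contDiff_id.prodMk contDiff_const).contDiffOn
    fun _ ht => ⟨ht, hε⟩

theorem ContDiffOn.slice_snd
    (h : ContDiffOn ℝ ∞ (fun s : ℝ × ℝ => G s.1 s.2) (Icc 0 1 ×ˢ Icc 0 1)) {t : ℝ}
    (ht : t ∈ Icc (0 : ℝ) 1) : ContDiffOn ℝ ∞ (fun ε => G t ε) (Icc 0 1) :=
  h.comp (f := fun ε : ℝ => (t, ε)) (contDiff_const.prodMk contDiff_id).contDiffOn
    fun _ hε => ⟨ht, hε⟩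

theorem ContDiffOn.hasDerivWithinAt_unit {g : ℝ → ℝ} (h : ContDiffOn ℝ ∞ g (Icc 0 1)) {t : ℝ}
    (ht : t ∈ Icc (0 : ℝ) 1) : HasDerivWithinAt g (derivWithin g (Icc 0 1) t) (Icc 0 1) t :=
  (h.differentiableOn (by simp) t ht).hasDerivWithinAt

theorem HasDerivWithinAt.derivWithin_unit {g : ℝ → ℝ} {g' t : ℝ}
    (h : HasDerivWithinAt g g' (Icc 0 1) t) (ht : t ∈ Icc (0 : ℝ) 1) :
    _root_.derivWithin g (Icc 0 1) t = g' :=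
  h.derivWithin (uniqueDiffOn_Icc_zero_one t ht)

theorem ContDiffOn.swap_square
    (h : ContDiffOn ℝ ∞ (fun s : ℝ × ℝ => G s.1 s.2) (Icc 0 1 ×ˢ Icc 0 1)) :
    ContDiffOn ℝ ∞ (fun s : ℝ × ℝ => G s.2 s.1) (Icc 0 1 ×ˢ Icc 0 1) :=
  h.comp (f := fun s : ℝ × ℝ => (s.2, s.1)) (contDiff_snd.prodMk contDiff_fst).contDiffOn
    fun _ hs => ⟨hs.2, hs.1⟩

theorem ContDiffOn.comp_fst
    (h : ContDiffOn ℝ ∞ (fun s : ℝ × ℝ => G s.1 s.2) (Icc 0 1 ×ˢ Icc 0 1)) {φ : ℝ → ℝ}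
    (hφ : ContDiff ℝ ∞ φ) (hm : MapsTo φ (Icc 0 1) (Icc 0 1)) :
    ContDiffOn ℝ ∞ (fun s : ℝ × ℝ => G (φ s.1) s.2) (Icc 0 1 ×ˢ Icc 0 1) :=
  h.comp (f := fun s : ℝ × ℝ => (φ s.1, s.2))
    ((hφ.comp contDiff_fst).prodMk contDiff_snd).contDiffOn fun _ hs => ⟨hm hs.1, hs.2⟩

end SquareCalculus

@[simp]
theorem fiberSMul_proj {M F : Type*} {V : M → Type*} [NormedAddCommGroup F]
    [∀ x, AddCommGroup (V x)] [∀ x, Module ℝ (V x)] (c : ℝ) (v : TotalSpace F V) :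
    (fiberSMul c v).proj = v.proj := rfl

namespace LieAlgebroid

/-! ### Morphisms from the tangent bundle of the square, tested on functions and one-forms -/

section SquareMorphism

variable {E : Type*} [NormedAddCommGroup E] [NormedSpace ℝ E] [FiniteDimensional ℝ E]
  {M : Type*} [TopologicalSpace M] [T2Space M] [ChartedSpace E M] [IsManifold 𝓘(ℝ, E) ∞ M]
  {F : Type*} [NormedAddCommGroup F] [NormedSpace ℝ F] [FiniteDimensional ℝ F]
  {V : M → Type*} [TopologicalSpace (TotalSpace F V)]
  [∀ x, AddCommGroup (V x)] [∀ x, Module ℝ (V x)] [∀ x, TopologicalSpace (V x)]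
  [FiberBundle F V] [VectorBundle ℝ F V] [ContMDiffVectorBundle ∞ F V 𝓘(ℝ, E)]
  (A : LieAlgebroid E F V)

theorem _root_.BundleOneForm.eval_fiberSMul (ξ : BundleOneForm E F V) (c : ℝ) (v : TotalSpace F V) :
    ξ.eval (fiberSMul c v) = c * ξ.eval v :=
  (ξ.toFun v.proj).map_smul c v.snd

theorem dFun_fiberSMul (f : M → ℝ) (c : ℝ) (v : TotalSpace F V) :
    A.dFun f (fiberSMul c v) = c * A.dFun f v := by
  have h : A.anchor v.proj (c • v.snd) = c • A.anchor v.proj v.snd := LinearMap.map_smul _ _ _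
  exact (congrArg (fun w => tangentApply E w f) h).trans (tangentApply_smul_left _ _ _)

theorem dFun_eq_zero {f : M → ℝ} {v : TotalSpace F V} (h : v.snd = 0) : A.dFun f v = 0 := by
  rw [dFun, h, LinearMap.map_zero]
  exact tangentApply_zero_left f

/-- `α` is, on `[0, 1]`, a smooth path in `A` whose anchor is the velocity of its base path. -/
structure IsPath (α : ℝ → TotalSpace F V) : Prop where
  smooth_base : ∀ f : C^∞⟮𝓘(ℝ, E), M; ℝ⟯, ContDiffOn ℝ ∞ (fun t => f (α t).proj) (Icc 0 1)
  smooth_form : ∀ ξ : BundleOneForm E F V, ContDiffOn ℝ ∞ (fun t => ξ.eval (α t)) (Icc 0 1)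
  deriv_base : ∀ (f : C^∞⟮𝓘(ℝ, E), M; ℝ⟯), ∀ t ∈ Icc (0 : ℝ) 1,
    HasDerivWithinAt (fun s => f (α s).proj) (A.dFun f (α t)) (Icc 0 1) t

/-- `p dt + q dε` is a Lie algebroid morphism from the tangent bundle of the unit square,
expressed by means of functions and one-forms. -/
structure IsSquareMorphism (p q : ℝ → ℝ → TotalSpace F V) : Prop where
  proj_eq : ∀ t ∈ Icc (0 : ℝ) 1, ∀ ε ∈ Icc (0 : ℝ) 1, (q t ε).proj = (p t ε).proj
  smooth_base : ∀ f : C^∞⟮𝓘(ℝ, E), M; ℝ⟯,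
    ContDiffOn ℝ ∞ (fun s : ℝ × ℝ => f (p s.1 s.2).proj) (Icc 0 1 ×ˢ Icc 0 1)
  smooth_fst : ∀ ξ : BundleOneForm E F V,
    ContDiffOn ℝ ∞ (fun s : ℝ × ℝ => ξ.eval (p s.1 s.2)) (Icc 0 1 ×ˢ Icc 0 1)
  smooth_snd : ∀ ξ : BundleOneForm E F V,
    ContDiffOn ℝ ∞ (fun s : ℝ × ℝ => ξ.eval (q s.1 s.2)) (Icc 0 1 ×ˢ Icc 0 1)
  deriv_fst : ∀ f : C^∞⟮𝓘(ℝ, E), M; ℝ⟯, ∀ t ∈ Icc (0 : ℝ) 1, ∀ ε ∈ Icc (0 : ℝ) 1,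
    HasDerivWithinAt (fun s => f (p s ε).proj) (A.dFun f (p t ε)) (Icc 0 1) t
  deriv_snd : ∀ f : C^∞⟮𝓘(ℝ, E), M; ℝ⟯, ∀ t ∈ Icc (0 : ℝ) 1, ∀ ε ∈ Icc (0 : ℝ) 1,
    HasDerivWithinAt (fun s => f (p t s).proj) (A.dFun f (q t ε)) (Icc 0 1) ε
  deriv_form : ∀ ξ : BundleOneForm E F V, ∀ t ∈ Icc (0 : ℝ) 1, ∀ ε ∈ Icc (0 : ℝ) 1,
    derivWithin (fun s => ξ.eval (q s ε)) (Icc 0 1) t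
      - derivWithin (fun s => ξ.eval (p t s)) (Icc 0 1) ε = A.dOne ξ (p t ε) (q t ε)

variable {A}

namespace IsSquareMorphism

variable {p q p' q' : ℝ → ℝ → TotalSpace F V}

theorem slice (h : A.IsSquareMorphism p q) {ε : ℝ} (hε : ε ∈ Icc (0 : ℝ) 1) :
    A.IsPath (fun t => p t ε) where
  smooth_base f := (h.smooth_base f).slice_fst (G := fun t ε => f (p t ε).proj) hε
  smooth_form ξ := (h.smooth_fst ξ).slice_fst (G := fun t ε => ξ.eval (p t ε)) hε
  deriv_base f t ht := h.deriv_fst f t ht ε hε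

/-- The variables play symmetric roles, d_A ξ being antisymmetric. Constructions in t, such as
gluing and reparametrization, thereby become available in ε. -/
theorem swap (h : A.IsSquareMorphism p q) :
    A.IsSquareMorphism (fun t ε => q ε t) (fun t ε => p ε t) where
  proj_eq t ht ε hε := (h.proj_eq ε hε t ht).symm
  smooth_base f := ((h.smooth_base f).swap_square (G := fun t ε => f (p t ε).proj)).congr
    fun s hs => by simp only [h.proj_eq _ hs.2 _ hs.1]
  smooth_fst ξ := (h.smooth_snd ξ).swap_square (G := fun t ε => ξ.eval (q t ε))
  smooth_snd ξ := (h.smooth_fst ξ).swap_square (G := fun t ε => ξ.eval (p t ε))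
  deriv_fst f t ht ε hε := (h.deriv_snd f ε hε t ht).congr
    (fun s hs => by simp only [h.proj_eq _ hε _ hs]) (by simp only [h.proj_eq _ hε _ ht])
  deriv_snd f t ht ε hε := (h.deriv_fst f ε hε t ht).congr
    (fun s hs => by simp only [h.proj_eq _ hs _ ht]) (by simp only [h.proj_eq _ hε _ ht])
  deriv_form ξ t ht ε hε := by
    rw [A.dOne_antisymm ξ (h.proj_eq ε hε t ht).symm, ← h.deriv_form ξ ε hε t ht]
    ring

theorem reparam_fst (h : A.IsSquareMorphism p q) {φ : ℝ → ℝ} (hφ : ContDiff ℝ ∞ φ)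
    (hm : MapsTo φ (Icc 0 1) (Icc 0 1)) :
    A.IsSquareMorphism (fun t ε => fiberSMul (deriv φ t) (p (φ t) ε)) (fun t ε => q (φ t) ε) where
  proj_eq t ht ε hε := h.proj_eq _ (hm ht) ε hε
  smooth_base f := (h.smooth_base f).comp_fst (G := fun t ε => f (p t ε).proj) hφ hm
  smooth_fst ξ := by
    simp only [BundleOneForm.eval_fiberSMul]
    exact ContDiffOn.mul (((hφ.iterate_deriv 1).comp contDiff_fst).contDiffOn)
      ((h.smooth_fst ξ).comp_fst (G := fun t ε => ξ.eval (p t ε)) hφ hm)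
  smooth_snd ξ := (h.smooth_snd ξ).comp_fst (G := fun t ε => ξ.eval (q t ε)) hφ hm
  deriv_fst f t ht ε hε := by
    rw [dFun_fiberSMul, mul_comm]
    exact (h.deriv_fst f _ (hm ht) ε hε).comp t
      (hφ.differentiable (by simp) t).hasDerivAt.hasDerivWithinAt hm
  deriv_snd f t ht ε hε := h.deriv_snd f _ (hm ht) ε hε
  deriv_form ξ t ht ε hε := by
    rw [A.dOne_smul_left ξ (h.proj_eq _ (hm ht) ε hε), ← h.deriv_form ξ _ (hm ht) ε hε]
    have h1 := (((h.smooth_snd ξ).slice_fst (G := fun t ε => ξ.eval (q t ε)) hε).hasDerivWithinAt_unit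
      (hm ht)).comp t (hφ.differentiable (by simp) t).hasDerivAt.hasDerivWithinAt hm
    have h2 := (((h.smooth_fst ξ).slice_snd (G := fun t ε => ξ.eval (p t ε))
      (hm ht)).hasDerivWithinAt_unit hε).const_mul (deriv φ t)
    simp only [BundleOneForm.eval_fiberSMul]
    rw [h2.derivWithin_unit hε]
    refine (congrArg (· - _) (HasDerivWithinAt.derivWithin_unit h1 ht)).trans ?_
    ring

end IsSquareMorphism

/-- The pull-back under (t, ε) ↦ t. The zero vector is written as 0 · α(t) so that it lies over the
right point. -/
theorem IsPath.const {α : ℝ → TotalSpace F V} (h : A.IsPath α) :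
    A.IsSquareMorphism (fun t _ => α t) (fun t _ => fiberSMul 0 (α t)) where
  proj_eq _ _ _ _ := rfl
  smooth_base f := (h.smooth_base f).comp contDiff_fst.contDiffOn fun _ hs => hs.1
  smooth_fst ξ := (h.smooth_form ξ).comp contDiff_fst.contDiffOn fun _ hs => hs.1
  smooth_snd ξ := by
    simp only [BundleOneForm.eval_fiberSMul, zero_mul]
    exact contDiffOn_const
  deriv_fst f t ht _ _ := h.deriv_base f t ht
  deriv_snd f t ht _ _ := by
    rw [dFun_fiberSMul, zero_mul]
    exact hasDerivWithinAt_const _ _ _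
  deriv_form ξ t ht ε hε := by
    rw [A.dOne_smul_right ξ (u := α t) (v := α t) rfl]
    simp [BundleOneForm.eval_fiberSMul]

/-- The pull-back of a path by the linear interpolation between two reparametrizations. -/
theorem IsPath.pullback {α : ℝ → TotalSpace F V} (h : A.IsPath α) {φ₀ φ₁ : ℝ → ℝ}
    (h₀ : ContDiff ℝ ∞ φ₀) (h₁ : ContDiff ℝ ∞ φ₁) (m₀ : MapsTo φ₀ (Icc 0 1) (Icc 0 1))
    (m₁ : MapsTo φ₁ (Icc 0 1) (Icc 0 1)) :
    A.IsSquareMorphism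
      (fun t ε => fiberSMul ((1 - ε) * deriv φ₀ t + ε * deriv φ₁ t)
        (α ((1 - ε) * φ₀ t + ε * φ₁ t)))
      (fun t ε => fiberSMul (φ₁ t - φ₀ t) (α ((1 - ε) * φ₀ t + ε * φ₁ t))) := by
  have hd₀ : ContDiff ℝ ∞ (deriv φ₀) := h₀.iterate_deriv 1
  have hd₁ : ContDiff ℝ ∞ (deriv φ₁) := h₁.iterate_deriv 1
  have hm : ∀ t ∈ Icc (0 : ℝ) 1, ∀ ε ∈ Icc (0 : ℝ) 1, (1 - ε) * φ₀ t + ε * φ₁ t ∈ Icc (0 : ℝ) 1 :=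
    fun t ht ε hε => convex_Icc (0 : ℝ) 1 (m₀ ht) (m₁ ht) (sub_nonneg.2 hε.2) hε.1 (by ring)
  have hφ : ContDiff ℝ ∞ (fun s : ℝ × ℝ => (1 - s.2) * φ₀ s.1 + s.2 * φ₁ s.1) := by fun_prop
  have hφt : ∀ t ε, HasDerivWithinAt (fun s => (1 - ε) * φ₀ s + ε * φ₁ s)
      ((1 - ε) * deriv φ₀ t + ε * deriv φ₁ t) (Icc 0 1) t := fun t ε =>
    (((h₀.differentiable (by simp) t).hasDerivAt.const_mul _).add
      ((h₁.differentiable (by simp) t).hasDerivAt.const_mul _)).hasDerivWithinAt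
  have hlin : ∀ a b ε, HasDerivWithinAt (fun s : ℝ => (1 - s) * a + s * b) (b - a) (Icc 0 1) ε := by
    intro a b ε
    have := ((((hasDerivAt_id ε).const_sub 1).mul_const a).add ((hasDerivAt_id ε).mul_const b))
    refine (this.hasDerivWithinAt (s := Icc 0 1)).congr_deriv ?_
    ring
  refine ⟨fun _ _ _ _ => rfl, fun f => ?_, fun ξ => ?_, fun ξ => ?_, fun f t ht ε hε => ?_,
    fun f t ht ε hε => ?_, fun ξ t ht ε hε => ?_⟩
  · exact (h.smooth_base f).comp hφ.contDiffOn fun s hs => hm _ hs.1 _ hs.2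
  · simp only [BundleOneForm.eval_fiberSMul]
    refine ContDiffOn.mul (ContDiff.contDiffOn (by fun_prop)) ?_
    exact (h.smooth_form ξ).comp hφ.contDiffOn fun s hs => hm _ hs.1 _ hs.2
  · simp only [BundleOneForm.eval_fiberSMul]
    refine ContDiffOn.mul (ContDiff.contDiffOn (by fun_prop)) ?_
    exact (h.smooth_form ξ).comp hφ.contDiffOn fun s hs => hm _ hs.1 _ hs.2
  · rw [dFun_fiberSMul, mul_comm]
    exact (h.deriv_base f _ (hm t ht ε hε)).comp t (hφt t ε) fun s hs => hm s hs ε hε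
  · rw [dFun_fiberSMul, mul_comm]
    exact (h.deriv_base f _ (hm t ht ε hε)).comp ε (hlin _ _ ε) fun s hs => hm t ht s hs
  -- Both components are multiples of the same vector, so d_A ξ contributes nothing. With g = ξ(α)
  -- and φ the interpolated parameter, the claim is that g(φ) dφ is closed.
  · have h0 : ∀ (a b : ℝ) (v : TotalSpace F V), A.dOne ξ (fiberSMul a v) (fiberSMul b v) = 0 := by
      intro a b v
      rw [A.dOne_smul_right ξ (u := fiberSMul a v) (v := v) rfl,
        A.dOne_smul_left ξ (u := v) (v := v) rfl, A.dOne_self, mul_zero, mul_zero]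
    rw [h0, sub_eq_zero]
    simp only [BundleOneForm.eval_fiberSMul]
    have hg := (h.smooth_form ξ).hasDerivWithinAt_unit (hm t ht ε hε)
    have h1 := HasDerivWithinAt.mul (((h₁.differentiable (by simp) t).hasDerivAt.sub
      (h₀.differentiable (by simp) t).hasDerivAt).hasDerivWithinAt (s := Icc 0 1))
      (hg.comp t (hφt t ε) fun s hs => hm s hs ε hε)
    have h2 := HasDerivWithinAt.mul (hlin (deriv φ₀ t) (deriv φ₁ t) ε)
      (hg.comp ε (hlin _ _ ε) fun s hs => hm t ht s hs)
    refine (h1.derivWithin_unit ht).trans (Eq.trans ?_ (h2.derivWithin_unit hε).symm)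
    simp only [Function.comp_apply, Pi.sub_apply]
    ring

end SquareMorphism

end LieAlgebroid

namespace LieAlgebroid

/-! ### Gluing two squares along a side -/

section Glue

variable {E : Type*} [NormedAddCommGroup E] [NormedSpace ℝ E] [FiniteDimensional ℝ E]
  {M : Type*} [TopologicalSpace M] [T2Space M] [ChartedSpace E M] [IsManifold 𝓘(ℝ, E) ∞ M]
  {F : Type*} [NormedAddCommGroup F] [NormedSpace ℝ F] [FiniteDimensional ℝ F]
  {V : M → Type*} [TopologicalSpace (TotalSpace F V)]
  [∀ x, AddCommGroup (V x)] [∀ x, Module ℝ (V x)] [∀ x, TopologicalSpace (V x)]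
  [FiberBundle F V] [VectorBundle ℝ F V] [ContMDiffVectorBundle ∞ F V 𝓘(ℝ, E)]
  {A : LieAlgebroid E F V} {p₀ q₀ p₁ q₁ : ℝ → ℝ → TotalSpace F V} {τ : ℝ → ℝ}

/-- The concatenation in the first variable of two families of vectors, on the components that are
not multiplied by the speed. -/
def joinNormal (τ : ℝ → ℝ) (q₁ q₀ : ℝ → ℝ → TotalSpace F V) (t ε : ℝ) : TotalSpace F V :=
  if t ≤ 1 / 2 then q₀ (τ (2 * t)) ε else q₁ (τ (2 * t - 1)) ε

/-- The concatenation of two paths with cut-off `τ`. -/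
def join (τ : ℝ → ℝ) (α₁ α₀ : ℝ → TotalSpace F V) (t : ℝ) : TotalSpace F V :=
  if t ≤ 1 / 2 then fiberSMul (2 * deriv τ (2 * t)) (α₀ (τ (2 * t)))
    else fiberSMul (2 * deriv τ (2 * t - 1)) (α₁ (τ (2 * t - 1)))

/-- On each half of the interval the parameter of the other piece is constant. A function of the
glued map is therefore everywhere the sum of its values on the two pieces minus the value at the
junction, a formula without cases that can be differentiated term by term. The p-components need no
matching, since their speeds vanish at the junction; the q-components must agree there. -/
theorem IsSquareMorphism.glue (h₀ : A.IsSquareMorphism p₀ q₀) (h₁ : A.IsSquareMorphism p₁ q₁)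
    (hτ : IsCutoff τ) (hq : ∀ ε ∈ Icc (0 : ℝ) 1, q₀ 1 ε = q₁ 0 ε) :
    A.IsSquareMorphism (fun t ε => join τ (fun s => p₁ s ε) (fun s => p₀ s ε) t)
      (joinNormal τ q₁ q₀) := by
  have z0 : (0 : ℝ) ∈ Icc (0 : ℝ) 1 := ⟨le_rfl, zero_le_one⟩
  have z1 : (1 : ℝ) ∈ Icc (0 : ℝ) 1 := ⟨zero_le_one, le_rfl⟩
  have left : ∀ {t : ℝ}, t ≤ 1 / 2 → τ (2 * t - 1) = 0 ∧ deriv τ (2 * t - 1) = 0 := fun ht =>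
    ⟨hτ.eq_zero _ (by linarith), hτ.deriv_eq_zero_of_nonpos (by linarith)⟩
  have right : ∀ {t : ℝ}, ¬ t ≤ 1 / 2 → τ (2 * t) = 1 ∧ deriv τ (2 * t) = 0 := fun ht =>
    ⟨hτ.eq_one _ (by linarith), hτ.deriv_eq_zero_of_one_le (by linarith)⟩
  have hproj : ∀ ε ∈ Icc (0 : ℝ) 1, (p₀ 1 ε).proj = (p₁ 0 ε).proj := fun ε hε => by
    rw [← h₀.proj_eq 1 z1 ε hε, ← h₁.proj_eq 0 z0 ε hε, hq ε hε]
  have cτ : ContDiff ℝ ∞ (fun t => τ (2 * t)) := hτ.smooth.comp (by fun_prop)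
  have cτ' : ContDiff ℝ ∞ (fun t => τ (2 * t - 1)) := hτ.smooth.comp (by fun_prop)
  have cd : ContDiff ℝ ∞ (fun t => 2 * deriv τ (2 * t)) :=
    contDiff_const.mul (hτ.contDiff_deriv.comp (by fun_prop))
  have cd' : ContDiff ℝ ∞ (fun t => 2 * deriv τ (2 * t - 1)) :=
    contDiff_const.mul (hτ.contDiff_deriv.comp (by fun_prop))
  have mτ : MapsTo (fun t => τ (2 * t)) (Icc 0 1) (Icc 0 1) := fun t _ => hτ.mem_Icc _
  have mτ' : MapsTo (fun t => τ (2 * t - 1)) (Icc 0 1) (Icc 0 1) := fun t _ => hτ.mem_Icc _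
  have dτ : ∀ t, HasDerivWithinAt (fun t => τ (2 * t)) (2 * deriv τ (2 * t)) (Icc 0 1) t :=
    fun t => (hτ.hasDerivAt_two_mul t).hasDerivWithinAt
  have dτ' : ∀ t, HasDerivWithinAt (fun t => τ (2 * t - 1)) (2 * deriv τ (2 * t - 1)) (Icc 0 1) t :=
    fun t => (hτ.hasDerivAt_two_mul_sub t).hasDerivWithinAt
  have eb : ∀ f : C^∞⟮𝓘(ℝ, E), M; ℝ⟯, ∀ t, ∀ ε ∈ Icc (0 : ℝ) 1,
      f (join τ (fun s => p₁ s ε) (fun s => p₀ s ε) t).proj =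
        f (p₀ (τ (2 * t)) ε).proj + f (p₁ (τ (2 * t - 1)) ε).proj - f (p₁ 0 ε).proj := by
    intro f t ε hε
    simp only [join]
    split_ifs with ht
    · simp [(left ht).1]
    · simp [(right ht).1, hproj ε hε]
  have e₁ : ∀ ξ : BundleOneForm E F V, ∀ t ε,
      ξ.eval (join τ (fun s => p₁ s ε) (fun s => p₀ s ε) t) =
        2 * deriv τ (2 * t) * ξ.eval (p₀ (τ (2 * t)) ε) +
          2 * deriv τ (2 * t - 1) * ξ.eval (p₁ (τ (2 * t - 1)) ε) := by
    intro ξ t ε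
    simp only [join]
    split_ifs with ht
    · simp [(left ht).2, BundleOneForm.eval_fiberSMul]
    · simp [(right ht).2, BundleOneForm.eval_fiberSMul]
  have e₂ : ∀ ξ : BundleOneForm E F V, ∀ t, ∀ ε ∈ Icc (0 : ℝ) 1,
      ξ.eval (joinNormal τ q₁ q₀ t ε) =
        ξ.eval (q₀ (τ (2 * t)) ε) + ξ.eval (q₁ (τ (2 * t - 1)) ε) - ξ.eval (q₁ 0 ε) := by
    intro ξ t ε hε
    simp only [joinNormal]
    split_ifs with ht
    · simp [(left ht).1]
    · simp [(right ht).1, hq ε hε]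
  refine ⟨fun t ht ε hε => ?_, fun f => ?_, fun ξ => ?_, fun ξ => ?_, fun f t ht ε hε => ?_,
    fun f t ht ε hε => ?_, fun ξ t ht ε hε => ?_⟩
  · simp only [joinNormal, join]
    split_ifs
    · exact h₀.proj_eq _ (mτ ht) ε hε
    · exact h₁.proj_eq _ (mτ' ht) ε hε
  · refine ContDiffOn.congr (ContDiffOn.sub (ContDiffOn.add
      ((h₀.smooth_base f).comp_fst (G := fun t ε => f (p₀ t ε).proj) cτ mτ)
      ((h₁.smooth_base f).comp_fst (G := fun t ε => f (p₁ t ε).proj) cτ' mτ'))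
      ((h₁.smooth_base f).comp_fst (G := fun t ε => f (p₁ t ε).proj) (contDiff_const (c := (0 : ℝ)))
        fun _ _ => z0)) fun s hs => ?_
    exact eb f s.1 s.2 hs.2
  · refine ContDiffOn.congr (ContDiffOn.add
      ((cd.comp contDiff_fst).contDiffOn.mul
        ((h₀.smooth_fst ξ).comp_fst (G := fun t ε => ξ.eval (p₀ t ε)) cτ mτ))
      ((cd'.comp contDiff_fst).contDiffOn.mul
        ((h₁.smooth_fst ξ).comp_fst (G := fun t ε => ξ.eval (p₁ t ε)) cτ' mτ'))) fun s hs => ?_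
    exact e₁ ξ s.1 s.2
  · refine ContDiffOn.congr (ContDiffOn.sub (ContDiffOn.add
      ((h₀.smooth_snd ξ).comp_fst (G := fun t ε => ξ.eval (q₀ t ε)) cτ mτ)
      ((h₁.smooth_snd ξ).comp_fst (G := fun t ε => ξ.eval (q₁ t ε)) cτ' mτ'))
      ((h₁.smooth_snd ξ).comp_fst (G := fun t ε => ξ.eval (q₁ t ε)) (contDiff_const (c := (0 : ℝ)))
        fun _ _ => z0)) fun s hs => ?_
    exact e₂ ξ s.1 s.2 hs.2
  · have hd := (((h₀.deriv_fst f _ (mτ ht) ε hε).comp t (dτ t) mτ).add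
      ((h₁.deriv_fst f _ (mτ' ht) ε hε).comp t (dτ' t) mτ')).sub_const (f (p₁ 0 ε).proj)
    refine (hd.congr_deriv ?_).congr (fun s _ => eb f s ε hε) (eb f t ε hε)
    simp only [join]
    split_ifs with ht'
    · rw [dFun_fiberSMul, (left ht').2]; ring
    · rw [dFun_fiberSMul, (right ht').2]; ring
  · have hd := ((h₀.deriv_snd f _ (mτ ht) ε hε).add (h₁.deriv_snd f _ (mτ' ht) ε hε)).sub
      (h₁.deriv_snd f 0 z0 ε hε)
    refine (hd.congr_deriv ?_).congr (fun s hs => eb f t s hs) (eb f t ε hε)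
    simp only [joinNormal]
    split_ifs with ht'
    · simp [(left ht').1]
    · simp [(right ht').1, hq ε hε]
  · have g₀ := ((h₀.smooth_snd ξ).slice_fst (G := fun t ε => ξ.eval (q₀ t ε)) hε).hasDerivWithinAt_unit
      (mτ ht)
    have g₁ := ((h₁.smooth_snd ξ).slice_fst (G := fun t ε => ξ.eval (q₁ t ε)) hε).hasDerivWithinAt_unit
      (mτ' ht)
    have k₀ := ((h₀.smooth_fst ξ).slice_snd (G := fun t ε => ξ.eval (p₀ t ε))
      (mτ ht)).hasDerivWithinAt_unit hε
    have k₁ := ((h₁.smooth_fst ξ).slice_snd (G := fun t ε => ξ.eval (p₁ t ε))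
      (mτ' ht)).hasDerivWithinAt_unit hε
    have d₂ := (((g₀.comp t (dτ t) mτ).add (g₁.comp t (dτ' t) mτ')).sub_const
      (ξ.eval (q₁ 0 ε))).congr (fun s _ => e₂ ξ s ε hε) (e₂ ξ t ε hε)
    have d₁ := ((k₀.const_mul (2 * deriv τ (2 * t))).add
      (k₁.const_mul (2 * deriv τ (2 * t - 1)))).congr (fun s _ => e₁ ξ t s) (e₁ ξ t ε)
    have f₀ := h₀.deriv_form ξ _ (mτ ht) ε hε
    have f₁ := h₁.deriv_form ξ _ (mτ' ht) ε hε
    have key : derivWithin (fun s => ξ.eval (joinNormal τ q₁ q₀ s ε)) (Icc 0 1) t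
      - derivWithin (fun s => ξ.eval (join τ (fun r => p₁ r s) (fun r => p₀ r s) t)) (Icc 0 1) ε =
        2 * deriv τ (2 * t) * A.dOne ξ (p₀ (τ (2 * t)) ε) (q₀ (τ (2 * t)) ε) +
        2 * deriv τ (2 * t - 1) * A.dOne ξ (p₁ (τ (2 * t - 1)) ε) (q₁ (τ (2 * t - 1)) ε) := by
      rw [HasDerivWithinAt.derivWithin_unit d₁ hε, HasDerivWithinAt.derivWithin_unit d₂ ht, ← f₀, ← f₁]
      ring
    rw [key]
    simp only [join, joinNormal]
    split_ifs with ht'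
    · rw [A.dOne_smul_left ξ (h₀.proj_eq _ (mτ ht) ε hε), (left ht').2]; ring
    · rw [A.dOne_smul_left ξ (h₁.proj_eq _ (mτ' ht) ε hε), (right ht').2]; ring

end Glue

end LieAlgebroid

theorem eq_of_forall_smooth {E : Type*} [NormedAddCommGroup E] [NormedSpace ℝ E]
    [FiniteDimensional ℝ E] {M : Type*} [TopologicalSpace M] [T2Space M] [ChartedSpace E M]
    [IsManifold 𝓘(ℝ, E) ∞ M] {x y : M} (h : ∀ f : C^∞⟮𝓘(ℝ, E), M; ℝ⟯, f x = f y) : x = y := by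
  by_contra hne
  obtain ⟨ψ, hψ, hs⟩ := exists_smooth_bump (E := E) x (isOpen_compl_singleton.mem_nhds hne)
  have h1 : ψ y = 0 := image_eq_zero_of_notMem_tsupport fun hy => hs hy rfl
  rw [← h, hψ.self_of_nhds] at h1
  exact one_ne_zero h1

theorem TotalSpace.eq_of_snd_eq_zero {M F : Type*} {V : M → Type*} [∀ x, AddCommGroup (V x)]
    {u v : TotalSpace F V} (h : u.proj = v.proj) (hu : u.snd = 0) (hv : v.snd = 0) : u = v := by
  obtain ⟨x, u⟩ := u
  obtain ⟨y, v⟩ := v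
  obtain rfl : x = y := h
  simp only at hu hv
  rw [hu, hv]

section FiberSMul

variable {M F : Type*} {V : M → Type*} [NormedAddCommGroup F] [∀ x, AddCommGroup (V x)]
  [∀ x, Module ℝ (V x)]

theorem fiberSMul_snd (c : ℝ) (v : TotalSpace F V) : (fiberSMul c v).snd = c • v.snd := rfl

theorem fiberSMul_one (v : TotalSpace F V) : fiberSMul 1 v = v := by
  simp [fiberSMul]

theorem fiberSMul_fiberSMul (c d : ℝ) (v : TotalSpace F V) :
    fiberSMul c (fiberSMul d v) = fiberSMul (c * d) v :=
  congrArg (TotalSpace.mk' F v.proj) (mul_smul c d v.snd).symm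

theorem fiberSMul_snd_eq_zero (c : ℝ) {v : TotalSpace F V} (h : v.snd = 0) :
    (fiberSMul c v).snd = 0 := by
  rw [fiberSMul_snd, h, smul_zero]
  rfl

theorem fiberSMul_zero_snd (v : TotalSpace F V) : (fiberSMul 0 v).snd = 0 := zero_smul _ _

theorem fiberSMul_eq_of_zero {u v : TotalSpace F V} (h : u.proj = v.proj) :
    fiberSMul 0 u = fiberSMul 0 v :=
  TotalSpace.eq_of_snd_eq_zero (by exact h) (fiberSMul_zero_snd u) (fiberSMul_zero_snd v)

end FiberSMul

theorem intervalExtend_coe {N : Type*} (p : I → N) (t : I) : intervalExtend p t = p t := by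
  simp [intervalExtend]

theorem intervalExtend_of_mem {N : Type*} (p : I → N) {t : ℝ} (ht : t ∈ Icc (0 : ℝ) 1) :
    intervalExtend p t = p ⟨t, ht⟩ := by
  simp [intervalExtend, projIcc_of_mem zero_le_one ht]

namespace LieAlgebroid

/-! ### Homotopy of A-paths through squares, and concatenation -/

section Paths

variable {E : Type*} [NormedAddCommGroup E] [NormedSpace ℝ E] [FiniteDimensional ℝ E]
  {M : Type*} [TopologicalSpace M] [T2Space M] [ChartedSpace E M] [IsManifold 𝓘(ℝ, E) ∞ M]
  {F : Type*} [NormedAddCommGroup F] [NormedSpace ℝ F] [FiniteDimensional ℝ F]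
  {V : M → Type*} [TopologicalSpace (TotalSpace F V)]
  [∀ x, AddCommGroup (V x)] [∀ x, Module ℝ (V x)] [∀ x, TopologicalSpace (V x)]
  [FiberBundle F V] [VectorBundle ℝ F V] [ContMDiffVectorBundle ∞ F V 𝓘(ℝ, E)]
  {A : LieAlgebroid E F V}

theorem _root_.eq_pathVelocity {γ : I → M}
    (hγ : ContMDiffOn 𝓘(ℝ, ℝ) 𝓘(ℝ, E) ∞ (intervalExtend γ) (Icc 0 1)) {t : I}
    {v : TangentSpace 𝓘(ℝ, E) (γ t)}
    (h : ∀ f : C^∞⟮𝓘(ℝ, E), M; ℝ⟯,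
      HasDerivWithinAt (fun s => f (intervalExtend γ s)) (tangentApply E v f) (Icc 0 1) (t : ℝ)) :
    v = pathVelocity γ t := by
  refine eq_of_forall_tangentApply (E := E) fun f => ?_
  have h1 := hasDerivWithinAt_comp_pathVelocity
    ((hγ t t.2).mdifferentiableWithinAt (by simp)) (C_mdifferentiableAt f (γ t))
  exact (uniqueDiffOn_Icc_zero_one t t.2).eq_deriv _ (h f) h1

theorem _root_.BundleOneForm.contMDiff_eval (ξ : BundleOneForm E F V) :
    ContMDiff (𝓘(ℝ, E).prod 𝓘(ℝ, F)) 𝓘(ℝ, ℝ) ∞ ξ.eval := ξ.smooth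

theorem _root_.contMDiff_comp_proj (f : C^∞⟮𝓘(ℝ, E), M; ℝ⟯) :
    ContMDiff (𝓘(ℝ, E).prod 𝓘(ℝ, F)) 𝓘(ℝ, ℝ) ∞ (fun v : TotalSpace F V => f v.proj) :=
  f.contMDiff.comp (contMDiff_proj V)

theorem APath.isPath (a : A.APath) : A.IsPath (intervalExtend a.toFun) where
  smooth_base f := contMDiffOn_iff_contDiffOn.1 ((contMDiff_comp_proj f).comp_contMDiffOn a.smooth)
  smooth_form ξ := contMDiffOn_iff_contDiffOn.1 (ξ.contMDiff_eval.comp_contMDiffOn a.smooth)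
  deriv_base f t ht := by
    have hb : ContMDiffOn 𝓘(ℝ, ℝ) 𝓘(ℝ, E) ∞ (intervalExtend fun s => (a.toFun s).proj) (Icc 0 1) :=
      (contMDiff_proj V).comp_contMDiffOn a.smooth
    have h1 := hasDerivWithinAt_comp_pathVelocity (γ := fun s => (a.toFun s).proj) (t := ⟨t, ht⟩)
      ((hb t ht).mdifferentiableWithinAt (by simp)) (C_mdifferentiableAt f _)
    rw [← a.anchor_eq] at h1
    rw [intervalExtend_of_mem a.toFun ht]
    exact h1

/-- The `A`-path given by a smooth path whose anchor is the velocity of its base path. -/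
def APath.ofIsPath {α : ℝ → TotalSpace F V} (h : A.IsPath α) : A.APath where
  toFun t := α t
  smooth := (contMDiffOn_totalSpace_of_forall h.smooth_base h.smooth_form).congr fun t ht => by
    rw [intervalExtend_of_mem _ ht]
  anchor_eq t := by
    refine eq_pathVelocity ?_ fun f => ?_
    · exact (contMDiffOn_of_forall_smooth h.smooth_base).congr fun t ht => by
        rw [intervalExtend_of_mem _ ht]
    · exact (h.deriv_base f t t.2).congr (fun s hs => by rw [intervalExtend_of_mem _ hs])
        (by rw [intervalExtend_coe])

variable (A) in
/-- Homotopy of `A`-paths, by means of morphisms from the tangent bundle of the square. -/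
def SquareHomotopic (a₀ a₁ : A.APath) : Prop :=
  ∃ p q, A.IsSquareMorphism p q ∧ (∀ t : I, p t 0 = a₀.toFun t) ∧ (∀ t : I, p t 1 = a₁.toFun t) ∧
    ∀ ε ∈ Icc (0 : ℝ) 1, (q 0 ε).snd = 0 ∧ (q 1 ε).snd = 0

theorem _root_.zero_mem_unit : (0 : ℝ) ∈ Icc (0 : ℝ) 1 := ⟨le_rfl, zero_le_one⟩

theorem _root_.one_mem_unit : (1 : ℝ) ∈ Icc (0 : ℝ) 1 := ⟨zero_le_one, le_rfl⟩

/-- The ε-velocity of the base map is ♯q = 0, so every smooth function is constant along this side,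
and smooth functions separate points. -/
theorem IsSquareMorphism.proj_const {p q : ℝ → ℝ → TotalSpace F V} (h : A.IsSquareMorphism p q)
    {t : ℝ} (ht : t ∈ Icc (0 : ℝ) 1) (h0 : ∀ ε ∈ Icc (0 : ℝ) 1, (q t ε).snd = 0)
    {ε : ℝ} (hε : ε ∈ Icc (0 : ℝ) 1) : (p t ε).proj = (p t 0).proj := by
  refine eq_of_forall_smooth (E := E) fun f => ?_
  have hd : ∀ s ∈ Icc (0 : ℝ) 1, HasDerivWithinAt (fun s => f (p t s).proj) 0 (Icc 0 1) s := by
    intro s hs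
    have := h.deriv_snd f t ht s hs
    rwa [A.dFun_eq_zero (h0 s hs)] at this
  exact constant_of_derivWithin_zero (fun s hs => (hd s hs).differentiableWithinAt)
    (fun s hs => (hd s ⟨hs.1, hs.2.le⟩).derivWithin_unit ⟨hs.1, hs.2.le⟩) ε hε

theorem join_snd_eq_zero {τ : ℝ → ℝ} (hτ : IsCutoff τ) {α₁ α₀ : ℝ → TotalSpace F V}
    (h₁ : ∀ s ∈ Icc (0 : ℝ) 1, (α₁ s).snd = 0) (h₀ : ∀ s ∈ Icc (0 : ℝ) 1, (α₀ s).snd = 0) (t : ℝ) :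
    (join τ α₁ α₀ t).snd = 0 := by
  by_cases ht : t ≤ 1 / 2
  · rw [join, if_pos ht]
    exact fiberSMul_snd_eq_zero _ (h₀ _ (hτ.mem_Icc _))
  · rw [join, if_neg ht]
    exact fiberSMul_snd_eq_zero _ (h₁ _ (hτ.mem_Icc _))

namespace SquareHomotopic

theorem refl (a : A.APath) : A.SquareHomotopic a a :=
  ⟨_, _, a.isPath.const, fun t => intervalExtend_coe _ t, fun t => intervalExtend_coe _ t,
    fun _ _ => ⟨fiberSMul_zero_snd _, fiberSMul_zero_snd _⟩⟩

theorem symm {a b : A.APath} (h : A.SquareHomotopic a b) : A.SquareHomotopic b a := by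
  obtain ⟨p, q, h, h0, h1, hq⟩ := h
  have hm : MapsTo (fun t : ℝ => 1 - t) (Icc 0 1) (Icc 0 1) :=
    fun t ht => ⟨by linarith [ht.2], by linarith [ht.1]⟩
  -- Pull-back of the square under ε ↦ 1 − ε.
  refine ⟨_, _, (h.swap.reparam_fst (φ := fun t => 1 - t) (by fun_prop) hm).swap, ?_, ?_, ?_⟩
  · intro t
    simp [h1]
  · intro t
    simp [h0]
  · intro ε hε
    exact ⟨fiberSMul_snd_eq_zero _ (hq _ (hm hε)).1, fiberSMul_snd_eq_zero _ (hq _ (hm hε)).2⟩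

theorem trans {a b c : A.APath} (h : A.SquareHomotopic a b) (h' : A.SquareHomotopic b c) :
    A.SquareHomotopic a c := by
  obtain ⟨p, q, h, h0, h1, hq⟩ := h
  obtain ⟨p', q', h', h0', h1', hq'⟩ := h'
  have hτ := isCutoff_smoothTransition
  -- Gluing in the direction of ε. After the swap it is the p-components that have to agree at the
  -- junction, and there both are the path b.
  refine ⟨_, _, (h.swap.glue h'.swap hτ fun ε hε => ?_).swap, ?_, ?_, ?_⟩
  · exact (h1 ⟨ε, hε⟩).trans (h0' ⟨ε, hε⟩).symm
  · intro t
    simp [joinNormal, h0]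
  · intro t
    have : ¬ (1 : ℝ) ≤ 1 / 2 := by norm_num
    simp only [joinNormal, this, if_false]
    norm_num [h1']
  · intro ε hε
    exact ⟨join_snd_eq_zero hτ (fun s hs => (hq' s hs).1) (fun s hs => (hq s hs).1) ε,
      join_snd_eq_zero hτ (fun s hs => (hq' s hs).2) (fun s hs => (hq s hs).2) ε⟩

theorem equivalence : Equivalence (A.SquareHomotopic) := ⟨refl, symm, trans⟩

theorem source_eq {a b : A.APath} (h : A.SquareHomotopic a b) :
    (a.toFun 0).proj = (b.toFun 0).proj := by
  obtain ⟨p, q, h, h0, h1, hq⟩ := h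
  rw [← h0, ← h1]
  exact (h.proj_const zero_mem_unit (fun ε hε => (hq ε hε).1) one_mem_unit).symm

theorem target_eq {a b : A.APath} (h : A.SquareHomotopic a b) :
    (a.toFun 1).proj = (b.toFun 1).proj := by
  obtain ⟨p, q, h, h0, h1, hq⟩ := h
  rw [← h0, ← h1]
  exact (h.proj_const one_mem_unit (fun ε hε => (hq ε hε).2) one_mem_unit).symm

end SquareHomotopic

namespace APath

variable {τ τ' : ℝ → ℝ}

theorem _root_.LieAlgebroid.joinNormal_zero (hτ : IsCutoff τ) (q₁ q₀ : ℝ → ℝ → TotalSpace F V)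
    (ε : ℝ) : joinNormal τ q₁ q₀ 0 ε = q₀ 0 ε := by
  simp [joinNormal, hτ.eq_zero]

theorem _root_.LieAlgebroid.joinNormal_one (hτ : IsCutoff τ) (q₁ q₀ : ℝ → ℝ → TotalSpace F V)
    (ε : ℝ) : joinNormal τ q₁ q₀ 1 ε = q₁ 1 ε := by
  have h2 : ¬ (1 : ℝ) ≤ 1 / 2 := by norm_num
  rw [joinNormal, if_neg h2, hτ.eq_one _ (by norm_num)]

/-- A path is a slice of a constant square, so gluing squares contains gluing paths. The zero
q-components agree at the junction as soon as the base points do. -/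
theorem isPath_join (hτ : IsCutoff τ) (a₁ a₀ : A.APath)
    (h : (a₁.toFun 0).proj = (a₀.toFun 1).proj) :
    A.IsPath (join τ (intervalExtend a₁.toFun) (intervalExtend a₀.toFun)) := by
  have := (a₀.isPath.const.glue a₁.isPath.const hτ fun ε _ => ?_).slice zero_mem_unit
  · exact this
  · refine fiberSMul_eq_of_zero ?_
    rw [intervalExtend_of_mem _ zero_mem_unit, intervalExtend_of_mem _ one_mem_unit]
    exact h.symm

/-- The concatenation of two `A`-paths with a cut-off. -/
def concat (hτ : IsCutoff τ) (a₁ a₀ : A.APath) (h : (a₁.toFun 0).proj = (a₀.toFun 1).proj) :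
    A.APath :=
  ofIsPath (isPath_join hτ a₁ a₀ h)

theorem concat_toFun (hτ : IsCutoff τ) (a₁ a₀ : A.APath)
    (h : (a₁.toFun 0).proj = (a₀.toFun 1).proj) (t : I) :
    (concat hτ a₁ a₀ h).toFun t =
      join τ (intervalExtend a₁.toFun) (intervalExtend a₀.toFun) t := rfl

theorem concat_source (hτ : IsCutoff τ) (a₁ a₀ : A.APath)
    (h : (a₁.toFun 0).proj = (a₀.toFun 1).proj) :
    ((concat hτ a₁ a₀ h).toFun 0).proj = (a₀.toFun 0).proj := by
  simp [concat_toFun, join, hτ.eq_zero, intervalExtend_of_mem _ zero_mem_unit]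

theorem concat_target (hτ : IsCutoff τ) (a₁ a₀ : A.APath)
    (h : (a₁.toFun 0).proj = (a₀.toFun 1).proj) :
    ((concat hτ a₁ a₀ h).toFun 1).proj = (a₁.toFun 1).proj := by
  have h2 : ¬ (1 : ℝ) ≤ 1 / 2 := by norm_num
  have h3 : τ (2 * 1 - 1) = 1 := hτ.eq_one _ (by norm_num)
  simp only [concat_toFun, join, Icc.coe_one, h2, if_false, fiberSMul_proj, h3]
  rw [intervalExtend_of_mem _ one_mem_unit]
  rfl

theorem concat_homotopic (hτ : IsCutoff τ) {a₁ a₀ b₁ b₀ : A.APath} (h₁ : A.SquareHomotopic a₁ b₁)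
    (h₀ : A.SquareHomotopic a₀ b₀) (h : (a₁.toFun 0).proj = (a₀.toFun 1).proj)
    (h' : (b₁.toFun 0).proj = (b₀.toFun 1).proj) :
    A.SquareHomotopic (concat hτ a₁ a₀ h) (concat hτ b₁ b₀ h') := by
  obtain ⟨p₁, q₁, h₁, h₁0, h₁1, hq₁⟩ := h₁
  obtain ⟨p₀, q₀, h₀, h₀0, h₀1, hq₀⟩ := h₀
  refine ⟨_, _, h₀.glue h₁ hτ fun ε hε => ?_, fun t => ?_, fun t => ?_, fun ε hε => ?_⟩
  -- At the junction both q-components are zero vectors. They lie over the same point because the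
  -- end points do not move with ε.
  · refine TotalSpace.eq_of_snd_eq_zero ?_ (hq₀ ε hε).2 (hq₁ ε hε).1
    rw [h₀.proj_eq 1 one_mem_unit ε hε, h₁.proj_eq 0 zero_mem_unit ε hε,
      h₀.proj_const one_mem_unit (fun ε hε => (hq₀ ε hε).2) hε,
      h₁.proj_const zero_mem_unit (fun ε hε => (hq₁ ε hε).1) hε]
    exact ((congrArg _ (h₀0 1)).trans h.symm).trans (congrArg _ (h₁0 0)).symm
  · rw [concat_toFun, join, join, intervalExtend_of_mem _ (hτ.mem_Icc _),
      intervalExtend_of_mem _ (hτ.mem_Icc _), ← h₁0, ← h₀0]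
  · rw [concat_toFun, join, join, intervalExtend_of_mem _ (hτ.mem_Icc _),
      intervalExtend_of_mem _ (hτ.mem_Icc _), ← h₁1, ← h₀1]
  · rw [joinNormal_zero hτ, joinNormal_one hτ]
    exact ⟨(hq₀ ε hε).1, (hq₁ ε hε).2⟩

theorem isPath_pull (a : A.APath) {φ : ℝ → ℝ} (hφ : ContDiff ℝ ∞ φ)
    (hm : MapsTo φ (Icc 0 1) (Icc 0 1)) :
    A.IsPath (fun t => fiberSMul (deriv φ t) (intervalExtend a.toFun (φ t))) := by
  simpa using (a.isPath.pullback hφ hφ hm hm).slice zero_mem_unit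

/-- The pull-back `φ'(t) a(φ(t))` of an `A`-path. -/
def pull (a : A.APath) {φ : ℝ → ℝ} (hφ : ContDiff ℝ ∞ φ) (hm : MapsTo φ (Icc 0 1) (Icc 0 1)) :
    A.APath :=
  ofIsPath (a.isPath_pull hφ hm)

theorem pull_toFun (a : A.APath) {φ : ℝ → ℝ} (hφ : ContDiff ℝ ∞ φ)
    (hm : MapsTo φ (Icc 0 1) (Icc 0 1)) (t : I) :
    (a.pull hφ hm).toFun t = fiberSMul (deriv φ t) (intervalExtend a.toFun (φ t)) := rfl

/-- Linear interpolation of the parameters: the q-component is a multiple of a by φ₁ − φ₀, which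
vanishes at both ends. Neither monotonicity nor surjectivity is required, so constant and
backtracking parameters are allowed. -/
theorem pull_homotopic (a : A.APath) {φ₀ φ₁ : ℝ → ℝ} (h₀ : ContDiff ℝ ∞ φ₀) (h₁ : ContDiff ℝ ∞ φ₁)
    (m₀ : MapsTo φ₀ (Icc 0 1) (Icc 0 1)) (m₁ : MapsTo φ₁ (Icc 0 1) (Icc 0 1))
    (e₀ : φ₀ 0 = φ₁ 0) (e₁ : φ₀ 1 = φ₁ 1) :
    A.SquareHomotopic (a.pull h₀ m₀) (a.pull h₁ m₁) := by
  refine ⟨_, _, a.isPath.pullback h₀ h₁ m₀ m₁, fun t => ?_, fun t => ?_, fun ε hε => ?_⟩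
  · simp [pull_toFun]
  · simp [pull_toFun]
  · rw [e₀, e₁, sub_self, sub_self]
    exact ⟨fiberSMul_zero_snd _, fiberSMul_zero_snd _⟩

theorem pull_pull (a : A.APath) {φ ψ : ℝ → ℝ} (hφ : ContDiff ℝ ∞ φ) (hψ : ContDiff ℝ ∞ ψ)
    (mφ : MapsTo φ (Icc 0 1) (Icc 0 1)) (mψ : MapsTo ψ (Icc 0 1) (Icc 0 1)) :
    (a.pull hψ mψ).pull hφ mφ = a.pull (hψ.comp hφ) (mψ.comp mφ) := by
  ext1
  funext t
  have hd : deriv (ψ ∘ φ) t = deriv ψ (φ t) * deriv φ t :=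
    deriv_comp _ (hψ.differentiable (by simp) _) (hφ.differentiable (by simp) _)
  rw [pull_toFun, pull_toFun, intervalExtend_of_mem _ (mφ t.2), pull_toFun, fiberSMul_fiberSMul, hd,
    mul_comm]
  rfl

end APath

end Paths

end LieAlgebroid

namespace LieAlgebroid

/-! ### Segments of a path and the groupoid laws up to homotopy -/

section Segments

variable {E : Type*} [NormedAddCommGroup E] [NormedSpace ℝ E] [FiniteDimensional ℝ E]
  {M : Type*} [TopologicalSpace M] [T2Space M] [ChartedSpace E M] [IsManifold 𝓘(ℝ, E) ∞ M]
  {F : Type*} [NormedAddCommGroup F] [NormedSpace ℝ F] [FiniteDimensional ℝ F]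
  {V : M → Type*} [TopologicalSpace (TotalSpace F V)]
  [∀ x, AddCommGroup (V x)] [∀ x, Module ℝ (V x)] [∀ x, TopologicalSpace (V x)]
  [FiberBundle F V] [VectorBundle ℝ F V] [ContMDiffVectorBundle ∞ F V 𝓘(ℝ, E)]
  {A : LieAlgebroid E F V} {τ τ' : ℝ → ℝ}

/-- The affine map from `[0, 1]` to the segment from `s` to `t`. -/
def affineSegment (s t x : ℝ) : ℝ := s + (t - s) * x

theorem contDiff_affineSegment (s t : ℝ) : ContDiff ℝ ∞ (affineSegment s t) := by
  unfold affineSegment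
  fun_prop

theorem mapsTo_affineSegment {s t : ℝ} (hs : s ∈ Icc (0 : ℝ) 1) (ht : t ∈ Icc (0 : ℝ) 1) :
    MapsTo (affineSegment s t) (Icc 0 1) (Icc 0 1) := fun x hx => by
  have := convex_Icc (0 : ℝ) 1 hs ht (sub_nonneg.2 hx.2) hx.1 (by ring)
  simp only [smul_eq_mul] at this
  rw [affineSegment]
  convert this using 1
  ring

theorem affineSegment_zero (s t : ℝ) : affineSegment s t 0 = s := by simp [affineSegment]

theorem affineSegment_one (s t : ℝ) : affineSegment s t 1 = t := by simp [affineSegment]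

theorem deriv_affineSegment (s t x : ℝ) : deriv (affineSegment s t) x = t - s := by
  have h := ((hasDerivAt_id x).const_mul (t - s)).const_add s
  rw [mul_one] at h
  exact h.deriv

namespace APath

/-- The part of an `A`-path between the times `s` and `t`, with affine parametrization. -/
def seg (c : A.APath) {s t : ℝ} (hs : s ∈ Icc (0 : ℝ) 1) (ht : t ∈ Icc (0 : ℝ) 1) : A.APath :=
  c.pull (contDiff_affineSegment s t) (mapsTo_affineSegment hs ht)

theorem pull_source (a : A.APath) {φ : ℝ → ℝ} (hφ : ContDiff ℝ ∞ φ)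
    (hm : MapsTo φ (Icc 0 1) (Icc 0 1)) :
    ((a.pull hφ hm).toFun 0).proj = (intervalExtend a.toFun (φ 0)).proj := rfl

theorem pull_target (a : A.APath) {φ : ℝ → ℝ} (hφ : ContDiff ℝ ∞ φ)
    (hm : MapsTo φ (Icc 0 1) (Icc 0 1)) :
    ((a.pull hφ hm).toFun 1).proj = (intervalExtend a.toFun (φ 1)).proj := rfl

theorem seg_source (c : A.APath) {s t : ℝ} (hs : s ∈ Icc (0 : ℝ) 1) (ht : t ∈ Icc (0 : ℝ) 1) :
    ((c.seg hs ht).toFun 0).proj = (intervalExtend c.toFun s).proj := by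
  rw [seg, pull_source, affineSegment_zero]

theorem seg_target (c : A.APath) {s t : ℝ} (hs : s ∈ Icc (0 : ℝ) 1) (ht : t ∈ Icc (0 : ℝ) 1) :
    ((c.seg hs ht).toFun 1).proj = (intervalExtend c.toFun t).proj := by
  rw [seg, pull_target, affineSegment_one]

theorem pull_homotopic_seg (a : A.APath) {φ : ℝ → ℝ} (hφ : ContDiff ℝ ∞ φ)
    (hm : MapsTo φ (Icc 0 1) (Icc 0 1)) {s t : ℝ} (hs : s ∈ Icc (0 : ℝ) 1) (ht : t ∈ Icc (0 : ℝ) 1)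
    (h0 : φ 0 = s) (h1 : φ 1 = t) : A.SquareHomotopic (a.pull hφ hm) (a.seg hs ht) :=
  a.pull_homotopic hφ _ hm _ (by rw [h0, affineSegment_zero]) (by rw [h1, affineSegment_one])

theorem seg_zero_one (c : A.APath) : c.seg zero_mem_unit one_mem_unit = c := by
  ext1
  funext t
  rw [seg, pull_toFun, deriv_affineSegment, sub_zero, fiberSMul_one]
  simp [affineSegment, intervalExtend_coe]

/-- The restriction of a segment to a subsegment. -/
theorem seg_pull_homotopic (c : A.APath) {φ : ℝ → ℝ} (hφ : ContDiff ℝ ∞ φ)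
    (hm : MapsTo φ (Icc 0 1) (Icc 0 1)) {s t : ℝ} (hs : s ∈ Icc (0 : ℝ) 1)
    (ht : t ∈ Icc (0 : ℝ) 1) :
    A.SquareHomotopic ((c.pull hφ hm).seg hs ht) (c.seg (hm hs) (hm ht)) := by
  rw [seg, pull_pull]
  refine pull_homotopic_seg _ _ _ _ _ ?_ ?_
  · rw [Function.comp_apply, affineSegment_zero]
  · rw [Function.comp_apply, affineSegment_one]

/-- Concatenating two pull-backs of c amounts to concatenating their parameters: φ(t) = φ₀(τ(2t)) +
φ₁(τ(2t − 1)) − φ₁(0), where on each half one of the variable terms is constant. -/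
theorem concat_pull_eq (hτ : IsCutoff τ) (c : A.APath) {φ₀ φ₁ : ℝ → ℝ} (h₀ : ContDiff ℝ ∞ φ₀)
    (h₁ : ContDiff ℝ ∞ φ₁) (m₀ : MapsTo φ₀ (Icc 0 1) (Icc 0 1)) (m₁ : MapsTo φ₁ (Icc 0 1) (Icc 0 1))
    (e : φ₀ 1 = φ₁ 0) (h) :
    ∃ (φ : ℝ → ℝ) (hφ : ContDiff ℝ ∞ φ) (hm : MapsTo φ (Icc 0 1) (Icc 0 1)),
      φ 0 = φ₀ 0 ∧ φ 1 = φ₁ 1 ∧ concat hτ (c.pull h₁ m₁) (c.pull h₀ m₀) h = c.pull hφ hm := by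
  have hl : ∀ {t : ℝ}, t ≤ 1 / 2 → τ (2 * t - 1) = 0 ∧ deriv τ (2 * t - 1) = 0 := fun ht =>
    ⟨hτ.eq_zero _ (by linarith), hτ.deriv_eq_zero_of_nonpos (by linarith)⟩
  have hr : ∀ {t : ℝ}, ¬ t ≤ 1 / 2 → τ (2 * t) = 1 ∧ deriv τ (2 * t) = 0 := fun ht =>
    ⟨hτ.eq_one _ (by linarith), hτ.deriv_eq_zero_of_one_le (by linarith)⟩
  have hval : ∀ t, φ₀ (τ (2 * t)) + φ₁ (τ (2 * t - 1)) - φ₁ 0 =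
      if t ≤ 1 / 2 then φ₀ (τ (2 * t)) else φ₁ (τ (2 * t - 1)) := by
    intro t
    split_ifs with ht
    · rw [(hl ht).1]; ring
    · rw [(hr ht).1, e]; ring
  have c₀ : ContDiff ℝ ∞ (fun t => φ₀ (τ (2 * t))) := h₀.comp (hτ.smooth.comp (by fun_prop))
  have c₁ : ContDiff ℝ ∞ (fun t => φ₁ (τ (2 * t - 1))) := h₁.comp (hτ.smooth.comp (by fun_prop))
  have hφ : ContDiff ℝ ∞ (fun t => φ₀ (τ (2 * t)) + φ₁ (τ (2 * t - 1)) - φ₁ 0) :=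
    (c₀.add c₁).sub contDiff_const
  have hm : MapsTo (fun t => φ₀ (τ (2 * t)) + φ₁ (τ (2 * t - 1)) - φ₁ 0) (Icc 0 1) (Icc 0 1) := by
    intro t _
    simp only [hval]
    split_ifs
    · exact m₀ (hτ.mem_Icc _)
    · exact m₁ (hτ.mem_Icc _)
  refine ⟨_, hφ, hm, ?_, ?_, ?_⟩
  · simp [hτ.eq_zero]
  · have : ¬ (1 : ℝ) ≤ 1 / 2 := by norm_num
    rw [hval, if_neg this, hτ.eq_one _ (by norm_num)]
  · ext1
    funext t
    have hd : deriv (fun t => φ₀ (τ (2 * t)) + φ₁ (τ (2 * t - 1)) - φ₁ 0) t =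
        deriv φ₀ (τ (2 * t)) * (2 * deriv τ (2 * t)) +
          deriv φ₁ (τ (2 * t - 1)) * (2 * deriv τ (2 * t - 1)) := by
      have d₀ := (h₀.differentiable (by simp) (τ (2 * t))).hasDerivAt.comp (t : ℝ)
        (hτ.hasDerivAt_two_mul t)
      have d₁ := (h₁.differentiable (by simp) (τ (2 * t - 1))).hasDerivAt.comp (t : ℝ)
        (hτ.hasDerivAt_two_mul_sub t)
      exact ((d₀.add d₁).sub_const _).deriv
    rw [pull_toFun, hd, hval, concat_toFun, join]
    split_ifs with ht
    · rw [intervalExtend_of_mem _ (hτ.mem_Icc _), pull_toFun, fiberSMul_fiberSMul, (hl ht).2]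
      simp [mul_comm]
    · rw [intervalExtend_of_mem _ (hτ.mem_Icc _), pull_toFun, fiberSMul_fiberSMul, (hr ht).2]
      simp [mul_comm]

/-- The concatenation is a pull-back of c, and up to homotopy only the end points of the parameter
count. The times s, t, u need not be ordered or distinct: s = t or t = u gives the units, s = u the
inverses. -/
theorem concat_seg_homotopic (hτ : IsCutoff τ) (c : A.APath) {s t u : ℝ} (hs : s ∈ Icc (0 : ℝ) 1)
    (ht : t ∈ Icc (0 : ℝ) 1) (hu : u ∈ Icc (0 : ℝ) 1) (h) :
    A.SquareHomotopic (concat hτ (c.seg ht hu) (c.seg hs ht) h) (c.seg hs hu) := by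
  obtain ⟨φ, hφ, hm, h0, h1, e⟩ := concat_pull_eq hτ c (contDiff_affineSegment s t)
    (contDiff_affineSegment t u) (mapsTo_affineSegment hs ht) (mapsTo_affineSegment ht hu)
    (by rw [affineSegment_zero, affineSegment_one]) h
  refine e ▸ pull_homotopic_seg _ _ _ _ _ (h0.trans (affineSegment_zero _ _))
    (h1.trans (affineSegment_one _ _))

theorem _root_.half_mem_unit : (1 / 2 : ℝ) ∈ Icc (0 : ℝ) 1 := by norm_num

theorem _root_.IsCutoff.mapsTo (hτ : IsCutoff τ) : MapsTo τ (Icc 0 1) (Icc 0 1) :=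
  fun _ _ => hτ.mem_Icc _

theorem seg_concat_left (hτ : IsCutoff τ) (a₁ a₀ : A.APath) (h) :
    (concat hτ a₁ a₀ h).seg zero_mem_unit half_mem_unit = a₀.pull hτ.smooth hτ.mapsTo := by
  ext1
  funext t
  have ht : affineSegment 0 (1 / 2) t ≤ 1 / 2 := by
    have := t.2.2
    simp only [affineSegment]
    linarith
  have h2 : 2 * affineSegment 0 (1 / 2) t = t := by simp only [affineSegment]; ring
  rw [seg, pull_toFun, intervalExtend_of_mem _ (mapsTo_affineSegment zero_mem_unit half_mem_unit t.2),
    concat_toFun, join]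
  simp only [ht, if_true, h2]
  rw [fiberSMul_fiberSMul, deriv_affineSegment, pull_toFun]
  congr 1
  ring

theorem seg_concat_right (hτ : IsCutoff τ) (a₁ a₀ : A.APath) (h) :
    (concat hτ a₁ a₀ h).seg half_mem_unit one_mem_unit = a₁.pull hτ.smooth hτ.mapsTo := by
  ext1
  funext t
  have h2 : 2 * affineSegment (1 / 2) 1 t - 1 = t := by simp only [affineSegment]; ring
  rw [seg, pull_toFun, intervalExtend_of_mem _ (mapsTo_affineSegment half_mem_unit one_mem_unit t.2),
    concat_toFun, join]
  simp only
  -- At t = 0 the time is exactly 1/2, which `join` assigns to the first factor. Both formulas have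
  -- speed zero there, so the values agree.
  by_cases ht : affineSegment (1 / 2) 1 t ≤ 1 / 2
  · have ht0 : (t : ℝ) = 0 := by
      have := t.2.1
      simp only [affineSegment] at ht
      linarith
    have h3 : 2 * affineSegment (1 / 2) 1 t = 1 := by linarith
    rw [if_pos ht, h3, hτ.deriv_eq_zero_of_one_le le_rfl, mul_zero, fiberSMul_fiberSMul, mul_zero,
      pull_toFun, ht0, hτ.deriv_eq_zero_of_nonpos le_rfl]
    refine fiberSMul_eq_of_zero ?_
    rw [hτ.eq_zero 0 le_rfl, hτ.eq_one 1 le_rfl, intervalExtend_of_mem _ zero_mem_unit,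
      intervalExtend_of_mem _ one_mem_unit]
    exact h.symm
  · rw [if_neg ht, h2, fiberSMul_fiberSMul, deriv_affineSegment, pull_toFun]
    congr 1
    ring

theorem homotopic_pull_cutoff (hτ : IsCutoff τ) (a : A.APath) :
    A.SquareHomotopic a (a.pull hτ.smooth hτ.mapsTo) := by
  have := a.pull_homotopic_seg hτ.smooth hτ.mapsTo zero_mem_unit one_mem_unit
    (hτ.eq_zero 0 le_rfl) (hτ.eq_one 1 le_rfl)
  rw [seg_zero_one] at this
  exact this.symm

/-- Exhibiting the factors of a concatenation as segments of it reduces statements about composable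
paths to statements about a single path. -/
theorem homotopic_seg_left (hτ : IsCutoff τ) (a₁ a₀ : A.APath) (h) :
    A.SquareHomotopic a₀ ((concat hτ a₁ a₀ h).seg zero_mem_unit half_mem_unit) := by
  rw [seg_concat_left]
  exact homotopic_pull_cutoff hτ a₀

theorem homotopic_seg_right (hτ : IsCutoff τ) (a₁ a₀ : A.APath) (h) :
    A.SquareHomotopic a₁ ((concat hτ a₁ a₀ h).seg half_mem_unit one_mem_unit) := by
  rw [seg_concat_right]
  exact homotopic_pull_cutoff hτ a₁

/-- The class of a concatenation does not depend on the cut-off. -/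
theorem concat_homotopic_concat (hτ : IsCutoff τ) (hτ' : IsCutoff τ') (a₁ a₀ : A.APath) (h) (h') :
    A.SquareHomotopic (concat hτ a₁ a₀ h) (concat hτ' a₁ a₀ h') := by
  -- The factors are replaced by the two halves of the τ'-concatenation; recombined with τ, these
  -- give the whole of it.
  have e := concat_homotopic hτ (homotopic_seg_right hτ' a₁ a₀ h') (homotopic_seg_left hτ' a₁ a₀ h')
    h (by rw [seg_source, seg_target])
  have := concat_seg_homotopic hτ (concat hτ' a₁ a₀ h') zero_mem_unit half_mem_unit one_mem_unit
    (by rw [seg_source, seg_target])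
  rw [seg_zero_one] at this
  exact e.trans this

/-- The three paths are homotopic to consecutive segments of c, the left-hand side. The right-hand
side is then a concatenation of segments of c and is homotopic to c. -/
theorem concat_assoc_homotopic (hτ : IsCutoff τ) (a₂ a₁ a₀ : A.APath) (h₁) (h₂) (h₃) (h₄) :
    A.SquareHomotopic (concat hτ (concat hτ a₂ a₁ h₁) a₀ h₂)
      (concat hτ a₂ (concat hτ a₁ a₀ h₃) h₄) := by
  set b := concat hτ a₂ a₁ h₁ with hb
  set c := concat hτ b a₀ h₂ with hc
  -- The second half of c is b with parameter τ, so b changes from a₁ to a₂ where τ = 1/2. The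
  -- corresponding time of c is the r below.
  obtain ⟨θ, hθ, hτθ⟩ : ∃ θ ∈ Icc (0 : ℝ) 1, τ θ = 1 / 2 := by
    have := intermediate_value_Icc (zero_le_one (α := ℝ)) hτ.smooth.continuous.continuousOn
    rw [hτ.eq_zero 0 le_rfl, hτ.eq_one 1 le_rfl] at this
    exact this half_mem_unit
  -- The piece of b from τ(s) to τ(t) corresponds to a piece of the second half of c.
  have hsub : ∀ {s t : ℝ} (hs : s ∈ Icc (0 : ℝ) 1) (ht : t ∈ Icc (0 : ℝ) 1),
      A.SquareHomotopic (b.seg (hτ.mapsTo hs) (hτ.mapsTo ht))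
        (c.seg (mapsTo_affineSegment half_mem_unit one_mem_unit hs)
          (mapsTo_affineSegment half_mem_unit one_mem_unit ht)) := by
    intro s t hs ht
    have e1 := seg_pull_homotopic b hτ.smooth hτ.mapsTo hs ht
    have e2 := seg_pull_homotopic c (contDiff_affineSegment (1 / 2) 1)
      (mapsTo_affineSegment half_mem_unit one_mem_unit) hs ht
    have e3 := seg_concat_right hτ b a₀ h₂
    rw [seg] at e3
    rw [e3] at e2
    exact e1.symm.trans e2
  set r := affineSegment (1 / 2) 1 θ with hr
  have hr' : r ∈ Icc (0 : ℝ) 1 := mapsTo_affineSegment half_mem_unit one_mem_unit hθ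
  have e₀ : A.SquareHomotopic a₀ (c.seg zero_mem_unit half_mem_unit) := homotopic_seg_left hτ b a₀ h₂
  have e₁ : A.SquareHomotopic a₁ (c.seg half_mem_unit hr') := by
    have h1 := homotopic_seg_left hτ a₂ a₁ h₁
    have h2 := hsub zero_mem_unit hθ
    simp only [hτθ, hτ.eq_zero 0 le_rfl, affineSegment_zero] at h2
    exact h1.trans h2
  have e₂ : A.SquareHomotopic a₂ (c.seg hr' one_mem_unit) := by
    have h1 := homotopic_seg_right hτ a₂ a₁ h₁
    have h2 := hsub hθ one_mem_unit
    simp only [hτθ, hτ.eq_one 1 le_rfl, affineSegment_one] at h2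
    exact h1.trans h2
  have k₁ := (concat_homotopic hτ e₁ e₀ h₃ (by rw [seg_source, seg_target])).trans
    (concat_seg_homotopic hτ c zero_mem_unit half_mem_unit hr' _)
  have k₂ := (concat_homotopic hτ e₂ k₁ h₄ (by rw [seg_source, seg_target])).trans
    (concat_seg_homotopic hτ c zero_mem_unit hr' one_mem_unit _)
  rw [seg_zero_one] at k₂
  exact k₂.symm

theorem isPath_zero (x : M) : A.IsPath (fun _ => TotalSpace.mk' F x (0 : V x)) where
  smooth_base f := contDiffOn_const
  smooth_form ξ := contDiffOn_const
  deriv_base f t _ := by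
    rw [A.dFun_eq_zero rfl]
    exact hasDerivWithinAt_const _ _ _

/-- The constant path at a point. -/
def zero (A : LieAlgebroid E F V) (x : M) : A.APath := ofIsPath (isPath_zero x)

theorem zero_toFun (x : M) (t : I) : (zero A x).toFun t = TotalSpace.mk' F x (0 : V x) := rfl

theorem seg_self (c : A.APath) {s : ℝ} (hs : s ∈ Icc (0 : ℝ) 1) {x : M}
    (hx : (intervalExtend c.toFun s).proj = x) : c.seg hs hs = zero A x := by
  ext1
  funext t
  rw [seg, pull_toFun, deriv_affineSegment, sub_self, zero_toFun]
  refine TotalSpace.eq_of_snd_eq_zero ?_ (fiberSMul_zero_snd _) rfl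
  simp [affineSegment, hx]

/-- The inverse path `t ↦ -a(1 - t)`. -/
def inv (a : A.APath) : A.APath := a.seg one_mem_unit zero_mem_unit

theorem inv_toFun (a : A.APath) (t : I) :
    a.inv.toFun t = fiberSMul (-1) (a.toFun (unitInterval.symm t)) := by
  rw [inv, seg, pull_toFun, deriv_affineSegment, zero_sub]
  have : affineSegment 1 0 t = (unitInterval.symm t : I) := by
    simp [affineSegment, unitInterval.coe_symm_eq]
    ring
  rw [this, intervalExtend_coe]

/-- The zero path is the degenerate segment of a from 0 to 0. -/
theorem concat_zero_homotopic (hτ : IsCutoff τ) (a : A.APath) {x : M} (h) :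
    A.SquareHomotopic (concat hτ a (zero A x) h) a := by
  have hx : (intervalExtend a.toFun 0).proj = x := by
    rw [intervalExtend_of_mem _ zero_mem_unit]
    exact h
  have := concat_seg_homotopic hτ a zero_mem_unit zero_mem_unit one_mem_unit
    (by rw [seg_source, seg_target])
  simp only [seg_self a zero_mem_unit hx, seg_zero_one] at this
  exact this

theorem zero_concat_homotopic (hτ : IsCutoff τ) (a : A.APath) {x : M} (h) :
    A.SquareHomotopic (concat hτ (zero A x) a h) a := by
  have hx : (intervalExtend a.toFun 1).proj = x := by
    rw [intervalExtend_of_mem _ one_mem_unit]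
    exact h.symm
  have := concat_seg_homotopic hτ a zero_mem_unit one_mem_unit one_mem_unit
    (by rw [seg_source, seg_target])
  simp only [seg_self a one_mem_unit hx, seg_zero_one] at this
  exact this

/-- The segments of a from 1 to 0 and from 0 to 1 compose to the degenerate segment at 1. -/
theorem concat_inv_homotopic (hτ : IsCutoff τ) (a : A.APath) {x : M} (hx : (a.toFun 1).proj = x)
    (h) : A.SquareHomotopic (concat hτ a a.inv h) (zero A x) := by
  have hx : (intervalExtend a.toFun 1).proj = x := by
    rw [intervalExtend_of_mem _ one_mem_unit]
    exact hx
  have := concat_seg_homotopic hτ a one_mem_unit zero_mem_unit one_mem_unit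
    (by rw [seg_source, seg_target])
  simp only [seg_self a one_mem_unit hx, seg_zero_one] at this
  exact this

theorem inv_concat_homotopic (hτ : IsCutoff τ) (a : A.APath) {x : M} (hx : (a.toFun 0).proj = x)
    (h) : A.SquareHomotopic (concat hτ a.inv a h) (zero A x) := by
  have hx : (intervalExtend a.toFun 0).proj = x := by
    rw [intervalExtend_of_mem _ zero_mem_unit]
    exact hx
  have := concat_seg_homotopic hτ a zero_mem_unit one_mem_unit zero_mem_unit
    (by rw [seg_source, seg_target])
  simp only [seg_self a zero_mem_unit hx, seg_zero_one] at this
  exact this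

theorem inv_source (a : A.APath) : (a.inv.toFun 0).proj = (a.toFun 1).proj := by
  rw [inv, seg_source, intervalExtend_of_mem _ one_mem_unit]
  rfl

theorem inv_target (a : A.APath) : (a.inv.toFun 1).proj = (a.toFun 0).proj := by
  rw [inv, seg_target, intervalExtend_of_mem _ zero_mem_unit]
  rfl

/-- Uniqueness of inverses, by bracketing a⁻¹ b b⁻¹ in two ways; no homotopy of inverses has to be
built by hand. -/
theorem inv_homotopic {a b : A.APath} (h : A.SquareHomotopic a b) :
    A.SquareHomotopic a.inv b.inv := by
  have hτ := isCutoff_smoothTransition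
  have h1 : (a.inv.toFun 0).proj = (b.toFun 1).proj := (inv_source a).trans h.target_eq
  have h2 : (b.toFun 0).proj = (b.inv.toFun 1).proj := (inv_target b).symm
  have e1 := concat_assoc_homotopic hτ a.inv b b.inv h1 (by rw [concat_source, h2])
    h2 (by rw [concat_target, h1])
  have e2 : A.SquareHomotopic (concat hτ a.inv b h1) (zero A (b.toFun 0).proj) :=
    (concat_homotopic hτ (SquareHomotopic.refl a.inv) h.symm h1 (inv_source a)).trans
      (inv_concat_homotopic hτ a h.source_eq _)
  have e3 := concat_inv_homotopic hτ b rfl h2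
  have k1 := (concat_homotopic hτ e2 (SquareHomotopic.refl b.inv) (by rw [concat_source, h2])
    h2).trans (zero_concat_homotopic hτ b.inv _)
  have k2 := (concat_homotopic hτ (SquareHomotopic.refl a.inv) e3 (by rw [concat_target, h1])
    h1).trans (concat_zero_homotopic hτ a.inv _)
  exact k2.symm.trans (e1.symm.trans k1)

end APath

end Segments

end LieAlgebroid

/-- The groupoid structure transported along a bijection of the sets of arrows. -/
def ArrowGroupoid.transport {G G' M : Type*} (𝒢 : ArrowGroupoid G M) (Φ : G' ≃ G) :
    ArrowGroupoid G' M where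
  source g := 𝒢.source (Φ g)
  target g := 𝒢.target (Φ g)
  unit x := Φ.symm (𝒢.unit x)
  inv g := Φ.symm (𝒢.inv (Φ g))
  mul g h p := Φ.symm (𝒢.mul (Φ g) (Φ h) p)
  source_unit x := by rw [Φ.apply_symm_apply, 𝒢.source_unit]
  target_unit x := by rw [Φ.apply_symm_apply, 𝒢.target_unit]
  source_inv g := by rw [Φ.apply_symm_apply, 𝒢.source_inv]
  target_inv g := by rw [Φ.apply_symm_apply, 𝒢.target_inv]
  source_mul g h p := by rw [Φ.apply_symm_apply, 𝒢.source_mul]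
  target_mul g h p := by rw [Φ.apply_symm_apply, 𝒢.target_mul]
  mul_assoc g h k p q p' q' := by
    simp only [Φ.apply_symm_apply] at p' q' ⊢
    rw [𝒢.mul_assoc]
  mul_unit g p := by
    simp only [Φ.apply_symm_apply] at p ⊢
    rw [𝒢.mul_unit, Φ.symm_apply_apply]
  unit_mul g p := by
    simp only [Φ.apply_symm_apply] at p ⊢
    rw [𝒢.unit_mul, Φ.symm_apply_apply]
  mul_inv g p := by
    simp only [Φ.apply_symm_apply] at p ⊢
    rw [𝒢.mul_inv]
  inv_mul g p := by
    simp only [Φ.apply_symm_apply] at p ⊢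
    rw [𝒢.inv_mul]

theorem ArrowGroupoid.transport_isIso {G G' M : Type*} (𝒢 : ArrowGroupoid G M) (Φ : G' ≃ G) :
    (𝒢.transport Φ).IsIso 𝒢 Φ where
  source_map _ := rfl
  target_map _ := rfl
  map_unit _ := Φ.apply_symm_apply _
  map_inv _ := Φ.apply_symm_apply _
  map_mul _ _ _ _ := Φ.apply_symm_apply _

namespace LieAlgebroid

/-! ### The groupoid of homotopy classes of A-paths -/

section Groupoid

variable {E : Type*} [NormedAddCommGroup E] [NormedSpace ℝ E] [FiniteDimensional ℝ E]
  {M : Type*} [TopologicalSpace M] [T2Space M] [ChartedSpace E M] [IsManifold 𝓘(ℝ, E) ∞ M]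
  {F : Type*} [NormedAddCommGroup F] [NormedSpace ℝ F] [FiniteDimensional ℝ F]
  {V : M → Type*} [TopologicalSpace (TotalSpace F V)]
  [∀ x, AddCommGroup (V x)] [∀ x, Module ℝ (V x)] [∀ x, TopologicalSpace (V x)]
  [FiberBundle F V] [VectorBundle ℝ F V] [ContMDiffVectorBundle ∞ F V 𝓘(ℝ, E)]
  {A : LieAlgebroid E F V} {r : A.APath → A.APath → Prop}

/-- The relation r is kept abstract, so that the groupoid can be built directly on the quotient by
A-homotopy. -/
theorem quot_mk_eq_iff (hr : ∀ a b, r a b ↔ A.SquareHomotopic a b) {a b : A.APath} :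
    Quot.mk r a = Quot.mk r b ↔ A.SquareHomotopic a b := by
  have e : r = A.SquareHomotopic := by
    funext a b
    exact propext (hr a b)
  subst e
  exact SquareHomotopic.equivalence.quot_mk_eq_iff a b

theorem out_homotopic (hr : ∀ a b, r a b ↔ A.SquareHomotopic a b) (a : A.APath) :
    A.SquareHomotopic (Quot.mk r a).out a :=
  (quot_mk_eq_iff hr).1 (Quot.out_eq _)

/-- The groupoid of homotopy classes of `A`-paths. -/
def pathGroupoid (hr : ∀ a b, r a b ↔ A.SquareHomotopic a b) : ArrowGroupoid (Quot r) M where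
  source g := (g.out.toFun 0).proj
  target g := (g.out.toFun 1).proj
  unit x := Quot.mk r (APath.zero A x)
  inv g := Quot.mk r g.out.inv
  -- Source and target being read on chosen representatives, p is literally the condition for
  -- concatenating these. Independence of the choice is `out_homotopic`.
  mul g h p := Quot.mk r (APath.concat isCutoff_smoothTransition g.out h.out p)
  source_unit x := (out_homotopic hr _).source_eq
  target_unit x := (out_homotopic hr _).target_eq
  source_inv g := (out_homotopic hr _).source_eq.trans (APath.inv_source _)
  target_inv g := (out_homotopic hr _).target_eq.trans (APath.inv_target _)
  source_mul g h p := (out_homotopic hr _).source_eq.trans (APath.concat_source _ _ _ _)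
  target_mul g h p := (out_homotopic hr _).target_eq.trans (APath.concat_target _ _ _ _)
  mul_assoc g h k p q p' q' := by
    rw [quot_mk_eq_iff hr]
    refine (APath.concat_homotopic _ (out_homotopic hr _) (SquareHomotopic.refl _) _
      (by rw [APath.concat_source]; exact q)).trans
      ((APath.concat_assoc_homotopic isCutoff_smoothTransition _ _ _ p _ q
        (by rw [APath.concat_target]; exact p)).trans
      (APath.concat_homotopic _ (SquareHomotopic.refl _) (out_homotopic hr _).symm _ _))
  mul_unit g p := by
    conv_rhs => rw [← Quot.out_eq g]
    rw [quot_mk_eq_iff hr]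
    exact (APath.concat_homotopic _ (SquareHomotopic.refl _) (out_homotopic hr _) _ rfl).trans
      (APath.concat_zero_homotopic _ _ _)
  unit_mul g p := by
    conv_rhs => rw [← Quot.out_eq g]
    rw [quot_mk_eq_iff hr]
    exact (APath.concat_homotopic _ (out_homotopic hr _) (SquareHomotopic.refl _) _ rfl).trans
      (APath.zero_concat_homotopic _ _ _)
  mul_inv g p := by
    rw [quot_mk_eq_iff hr]
    exact (APath.concat_homotopic _ (SquareHomotopic.refl _) (out_homotopic hr _) _
      (APath.inv_target _).symm).trans (APath.concat_inv_homotopic _ _ rfl _)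
  inv_mul g p := by
    rw [quot_mk_eq_iff hr]
    exact (APath.concat_homotopic _ (out_homotopic hr _) (SquareHomotopic.refl _) _
      (APath.inv_source _)).trans (APath.inv_concat_homotopic _ _ rfl _)

variable (hr : ∀ a b, r a b ↔ A.SquareHomotopic a b)

theorem pathGroupoid_source (a : A.APath) :
    (pathGroupoid hr).source (Quot.mk r a) = (a.toFun 0).proj := (out_homotopic hr a).source_eq

theorem pathGroupoid_target (a : A.APath) :
    (pathGroupoid hr).target (Quot.mk r a) = (a.toFun 1).proj := (out_homotopic hr a).target_eq

theorem pathGroupoid_inv (a : A.APath) :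
    (pathGroupoid hr).inv (Quot.mk r a) = Quot.mk r a.inv :=
  (quot_mk_eq_iff hr).2 (APath.inv_homotopic (out_homotopic hr a))

theorem pathGroupoid_mul {τ : ℝ → ℝ} (hτ : IsCutoff τ) (a₁ a₀ : A.APath) (p)
    (h : (a₁.toFun 0).proj = (a₀.toFun 1).proj) :
    (pathGroupoid hr).mul (Quot.mk r a₁) (Quot.mk r a₀) p = Quot.mk r (APath.concat hτ a₁ a₀ h) :=
  (quot_mk_eq_iff hr).2 ((APath.concat_homotopic _ (out_homotopic hr a₁) (out_homotopic hr a₀) _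
    h).trans (APath.concat_homotopic_concat _ hτ _ _ _ _))

end Groupoid

/-! ### One-spheres and A-paths -/

section Spheres

variable {E : Type*} [NormedAddCommGroup E] [NormedSpace ℝ E] [FiniteDimensional ℝ E]
  {M : Type*} [TopologicalSpace M] [T2Space M] [ChartedSpace E M] [IsManifold 𝓘(ℝ, E) ∞ M]
  {F : Type*} [NormedAddCommGroup F] [NormedSpace ℝ F] [FiniteDimensional ℝ F]
  {V : M → Type*} [TopologicalSpace (TotalSpace F V)]
  [∀ x, AddCommGroup (V x)] [∀ x, Module ℝ (V x)] [∀ x, TopologicalSpace (V x)]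
  [FiberBundle F V] [VectorBundle ℝ F V] [ContMDiffVectorBundle ∞ F V 𝓘(ℝ, E)]
  {A : LieAlgebroid E F V}

theorem _root_.cubePartialDeriv_eq {n : ℕ} (i : Fin n) (g : (Fin n → I) → ℝ) (t : Fin n → I)
    {h : ℝ → ℝ} (e : ∀ s : I, g (Function.update t i s) = h s) :
    cubePartialDeriv i g t = derivWithin h (Icc 0 1) (t i) := by
  have e' : EqOn (intervalExtend fun s => g (Function.update t i s)) h (Icc 0 1) := fun s hs => by
    rw [intervalExtend_of_mem _ hs, e]
  exact derivWithin_congr e' (e' (t i).2)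

theorem _root_.cubeExtend_coe {n : ℕ} {N : Type*} (p : (Fin n → I) → N) (t : Fin n → I) :
    cubeExtend p (fun i => (t i : ℝ)) = p t := by
  simp [cubeExtend]

theorem CubeMorphism.isPath (a : A.CubeMorphism 1) :
    A.IsPath (fun t => cubeExtend (a.comp 0) (fun _ => t)) := by
  have hc : ContDiff ℝ ∞ (fun t : ℝ => (fun _ : Fin 1 => t)) := by fun_prop
  have hm : MapsTo (fun t : ℝ => (fun _ : Fin 1 => t)) (Icc 0 1) (Icc 0 1) :=
    fun t ht => ⟨fun _ => ht.1, fun _ => ht.2⟩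
  have hs := (a.smooth_comp 0).comp hc.contMDiff.contMDiffOn hm
  have hb : ∀ f : C^∞⟮𝓘(ℝ, E), M; ℝ⟯, ContDiffOn ℝ ∞
      (fun t : ℝ => f (cubeExtend (a.comp 0) (fun _ => t)).proj) (Icc 0 1) := fun f =>
    contMDiffOn_iff_contDiffOn.1 ((contMDiff_comp_proj f).comp_contMDiffOn hs)
  refine ⟨hb, fun ξ => ?_, fun f t ht => ?_⟩
  · exact contMDiffOn_iff_contDiffOn.1 (ξ.contMDiff_eval.comp_contMDiffOn hs)
  · have h1 := a.pullback_d_zero f 0 (fun _ => ⟨t, ht⟩)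
    rw [cubePartialDeriv_eq (h := fun t : ℝ => f (cubeExtend (a.comp 0) (fun _ => t)).proj)] at h1
    · have h2 : cubeExtend (a.comp 0) (fun _ => t) = a.comp 0 (fun _ => ⟨t, ht⟩) :=
        cubeExtend_coe (a.comp 0) (fun _ => ⟨t, ht⟩)
      rw [h2, ← h1]
      exact (hb f).hasDerivWithinAt_unit ht
    · intro s
      have h2 : cubeExtend (a.comp 0) (fun _ => (s : ℝ)) = a.comp 0 (fun _ => s) :=
        cubeExtend_coe (a.comp 0) (fun _ => s)
      rw [h2, a.proj_comp]
      congr 2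
      funext i
      rw [Subsingleton.elim i 0]
      simp

/-- The `A`-path of a `1`-sphere. -/
def sphereToPath (a : A.Sphere 1) : A.APath := APath.ofIsPath a.1.isPath

theorem sphereToPath_toFun (a : A.Sphere 1) (t : I) :
    (sphereToPath a).toFun t = a.1.comp 0 (fun _ => t) :=
  cubeExtend_coe (a.1.comp 0) (fun _ => t)

/-- The morphism `a dt` of an `A`-path. -/
def APath.toCube (a : A.APath) : A.CubeMorphism 1 where
  base t := (a.toFun (t 0)).proj
  comp _ t := a.toFun (t 0)
  proj_comp _ _ := rfl
  smooth_base := contMDiffOn_of_forall_smooth fun f =>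
    (a.isPath.smooth_base f).comp (f := fun s : Fin 1 → ℝ => s 0) (by fun_prop)
      fun s hs => ⟨hs.1 0, hs.2 0⟩
  smooth_comp _ := a.smooth.comp (f := fun s : Fin 1 → ℝ => s 0)
    (ContDiff.contMDiff (by fun_prop)).contMDiffOn fun s hs => ⟨hs.1 0, hs.2 0⟩
  pullback_d_zero f k t := by
    rw [cubePartialDeriv_eq (h := fun s => f (intervalExtend a.toFun s).proj)]
    · rw [(a.isPath.deriv_base f _ (t k).2).derivWithin_unit (t k).2, intervalExtend_coe,
        Subsingleton.elim k 0]
    · intro s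
      rw [intervalExtend_coe, Subsingleton.elim k 0, Function.update_self]
  -- There is a single index, so both sides vanish; in dimension one only the condition on functions
  -- has content.
  pullback_d_one ξ i j t X Y hX hY := by
    rw [Subsingleton.elim i j, sub_self, A.dOneForm_eq_dOne ξ X Y hX hY, A.dOne_self]

/-- The `1`-sphere of an `A`-path. -/
def pathToSphere (a : A.APath) : A.Sphere 1 :=
  ⟨a.toCube, fun k t h => by
    obtain ⟨j, hj, -⟩ := h
    exact (hj (Subsingleton.elim _ _)).elim⟩

variable (A) in
/-- The bijection `a₁ dt₁ ↦ a₁` from `1`-spheres to `A`-paths. -/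
def sphereEquivPath : A.Sphere 1 ≃ A.APath where
  toFun := sphereToPath
  invFun := pathToSphere
  left_inv a := by
    have e : ∀ (k : Fin 1) (t : Fin 1 → I),
        (sphereToPath a).toFun (t 0) = a.1.comp k t := by
      intro k t
      rw [sphereToPath_toFun, Subsingleton.elim k 0]
      congr 1
      funext i
      rw [Subsingleton.elim i 0]
    refine Subtype.ext (CubeMorphism.ext ?_ ?_)
    · funext t
      exact (congrArg TotalSpace.proj (e 0 t)).trans (a.1.proj_comp 0 t)
    · funext k t
      exact e k t
  right_inv a := by
    ext1
    funext t
    exact sphereToPath_toFun _ t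

theorem sphereEquivPath_toFun (a : A.Sphere 1) (t : I) :
    (sphereEquivPath A a).toFun t = a.1.comp 0 (fun _ => t) := sphereToPath_toFun a t

end Spheres

end LieAlgebroid

namespace LieAlgebroid

/-! ### Homotopies of one-spheres as square morphisms -/

section SphereHomotopy

variable {E : Type*} [NormedAddCommGroup E] [NormedSpace ℝ E] [FiniteDimensional ℝ E]
  {M : Type*} [TopologicalSpace M] [T2Space M] [ChartedSpace E M] [IsManifold 𝓘(ℝ, E) ∞ M]
  {F : Type*} [NormedAddCommGroup F] [NormedSpace ℝ F] [FiniteDimensional ℝ F]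
  {V : M → Type*} [TopologicalSpace (TotalSpace F V)]
  [∀ x, AddCommGroup (V x)] [∀ x, Module ℝ (V x)] [∀ x, TopologicalSpace (V x)]
  [FiberBundle F V] [VectorBundle ℝ F V] [ContMDiffVectorBundle ∞ F V 𝓘(ℝ, E)]
  {A : LieAlgebroid E F V}

/-- The point `(t, ε)` of the unit square. -/
def squarePoint (t ε : I) : Fin 2 → I := ![t, ε]

theorem cubeSnoc_eq_squarePoint (t : Fin 1 → I) (ε : I) : cubeSnoc t ε = squarePoint (t 0) ε := by
  funext i
  fin_cases i <;> rfl

theorem eq_squarePoint (s : Fin 2 → I) : s = squarePoint (s 0) (s 1) := by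
  funext i
  fin_cases i <;> rfl

theorem update_squarePoint_zero (t ε s : I) :
    Function.update (squarePoint t ε) 0 s = squarePoint s ε := by
  funext i
  fin_cases i <;> rfl

theorem update_squarePoint_one (t ε s : I) :
    Function.update (squarePoint t ε) 1 s = squarePoint t s := by
  funext i
  fin_cases i <;> rfl

/-- The extension of a map on the square to the plane, as a function of two variables. -/
def planeExtend {N : Type*} (g : (Fin 2 → I) → N) (t ε : ℝ) : N := cubeExtend g ![t, ε]

theorem planeExtend_coe {N : Type*} (g : (Fin 2 → I) → N) (t ε : I) :
    planeExtend g t ε = g (squarePoint t ε) := by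
  rw [planeExtend, ← cubeExtend_coe g (squarePoint t ε)]
  congr 1
  funext i
  fin_cases i <;> rfl

theorem CubeMorphism.isSquareMorphism (h : A.CubeMorphism 2) :
    A.IsSquareMorphism (planeExtend (h.comp 0)) (planeExtend (h.comp 1)) := by
  have hc : ContDiff ℝ ∞ (fun s : ℝ × ℝ => (![s.1, s.2] : Fin 2 → ℝ)) := by
    refine contDiff_pi.2 fun i => ?_
    fin_cases i
    · exact contDiff_fst
    · exact contDiff_snd
  have hm : MapsTo (fun s : ℝ × ℝ => (![s.1, s.2] : Fin 2 → ℝ)) (Icc 0 1 ×ˢ Icc 0 1) (Icc 0 1) :=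
    fun s hs => ⟨fun i => by fin_cases i; exacts [hs.1.1, hs.2.1],
      fun i => by fin_cases i; exacts [hs.1.2, hs.2.2]⟩
  have hs : ∀ k, ContMDiffOn 𝓘(ℝ, ℝ × ℝ) (𝓘(ℝ, E).prod 𝓘(ℝ, F)) ∞
      (fun s : ℝ × ℝ => planeExtend (h.comp k) s.1 s.2) (Icc 0 1 ×ˢ Icc 0 1) := fun k =>
    (h.smooth_comp k).comp hc.contMDiff.contMDiffOn hm
  have hb : ∀ (k) (f : C^∞⟮𝓘(ℝ, E), M; ℝ⟯), ContDiffOn ℝ ∞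
      (fun s : ℝ × ℝ => f (planeExtend (h.comp k) s.1 s.2).proj) (Icc 0 1 ×ˢ Icc 0 1) :=
    fun k f => contMDiffOn_iff_contDiffOn.1 ((contMDiff_comp_proj f).comp_contMDiffOn (hs k))
  have hf : ∀ (k) (ξ : BundleOneForm E F V), ContDiffOn ℝ ∞
      (fun s : ℝ × ℝ => ξ.eval (planeExtend (h.comp k) s.1 s.2)) (Icc 0 1 ×ˢ Icc 0 1) :=
    fun k ξ => contMDiffOn_iff_contDiffOn.1 (ξ.contMDiff_eval.comp_contMDiffOn (hs k))
  have hp : ∀ k (t ε : I), (planeExtend (h.comp k) t ε).proj = h.base (squarePoint t ε) :=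
    fun k t ε => by rw [planeExtend_coe, h.proj_comp]
  refine ⟨fun t ht ε hε => ?_, hb 0, hf 0, hf 1, fun f t ht ε hε => ?_, fun f t ht ε hε => ?_,
    fun ξ t ht ε hε => ?_⟩
  · exact (hp 1 ⟨t, ht⟩ ⟨ε, hε⟩).trans (hp 0 ⟨t, ht⟩ ⟨ε, hε⟩).symm
  · have h1 := h.pullback_d_zero f 0 (squarePoint ⟨t, ht⟩ ⟨ε, hε⟩)
    rw [cubePartialDeriv_eq (h := fun s => f (planeExtend (h.comp 0) s ε).proj),
      ← planeExtend_coe (h.comp 0) ⟨t, ht⟩ ⟨ε, hε⟩] at h1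
    · rw [← h1]
      exact ((hb 0 f).slice_fst (G := fun t ε => f (planeExtend (h.comp 0) t ε).proj)
        hε).hasDerivWithinAt_unit ht
    · intro s
      rw [update_squarePoint_zero]
      exact congrArg f (hp 0 s ⟨ε, hε⟩).symm
  · have h1 := h.pullback_d_zero f 1 (squarePoint ⟨t, ht⟩ ⟨ε, hε⟩)
    rw [cubePartialDeriv_eq (h := fun s => f (planeExtend (h.comp 0) t s).proj),
      ← planeExtend_coe (h.comp 1) ⟨t, ht⟩ ⟨ε, hε⟩] at h1
    · rw [← h1]
      exact ((hb 0 f).slice_snd (G := fun t ε => f (planeExtend (h.comp 0) t ε).proj)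
        ht).hasDerivWithinAt_unit hε
    · intro s
      rw [update_squarePoint_one]
      exact congrArg f (hp 0 ⟨t, ht⟩ s).symm
  -- The hypothesis is about arbitrary sections through the two components, while `dOne` uses chosen
  -- ones; tensoriality identifies the values.
  · set x := squarePoint ⟨t, ht⟩ ⟨ε, hε⟩ with hx
    have hsec : ∀ k, TotalSpace.mk' F (h.base x)
        ((sectionThrough (h.comp k x) : Cₛ^∞⟮𝓘(ℝ, E); F, V⟯) (h.base x)) = h.comp k x := by
      intro k
      rw [← h.proj_comp k x, sectionThrough_apply]
    have h1 := h.pullback_d_one ξ 0 1 x _ _ (hsec 0) (hsec 1)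
    rw [A.dOneForm_eq_dOne ξ _ _ (hsec 0) (hsec 1),
      cubePartialDeriv_eq (h := fun s => ξ.eval (planeExtend (h.comp 1) s ε)),
      cubePartialDeriv_eq (h := fun s => ξ.eval (planeExtend (h.comp 0) t s)), hx,
      ← planeExtend_coe (h.comp 0) ⟨t, ht⟩ ⟨ε, hε⟩,
      ← planeExtend_coe (h.comp 1) ⟨t, ht⟩ ⟨ε, hε⟩] at h1
    · exact h1
    · intro s
      rw [update_squarePoint_one]
      exact congrArg ξ.eval (planeExtend_coe (h.comp 0) ⟨t, ht⟩ s).symm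
    · intro s
      rw [update_squarePoint_zero]
      exact congrArg ξ.eval (planeExtend_coe (h.comp 1) s ⟨ε, hε⟩).symm

/-- The morphism `p dt + q dε` on the square. -/
def IsSquareMorphism.toCube {p q : ℝ → ℝ → TotalSpace F V} (h : A.IsSquareMorphism p q) :
    A.CubeMorphism 2 where
  base s := (p (s 0) (s 1)).proj
  comp k s := if k = 0 then p (s 0) (s 1) else q (s 0) (s 1)
  proj_comp k t := by
    split_ifs
    · rfl
    · exact h.proj_eq _ (t 0).2 _ (t 1).2
  smooth_base := by
    refine contMDiffOn_of_forall_smooth fun f => ?_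
    refine ((h.smooth_base f).comp (f := fun s : Fin 2 → ℝ => (s 0, s 1)) (s := Icc 0 1)
      (ContDiff.contDiffOn (by fun_prop)) fun s hs => ⟨⟨hs.1 0, hs.2 0⟩, ⟨hs.1 1, hs.2 1⟩⟩).congr
      fun s hs => ?_
    simp [cubeExtend, projIcc_of_mem zero_le_one (⟨hs.1 0, hs.2 0⟩ : s 0 ∈ Icc (0 : ℝ) 1),
      projIcc_of_mem zero_le_one (⟨hs.1 1, hs.2 1⟩ : s 1 ∈ Icc (0 : ℝ) 1)]
  smooth_comp k := by
    have hc : ∀ {g : ℝ → ℝ → TotalSpace F V},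
        ContMDiffOn 𝓘(ℝ, ℝ × ℝ) (𝓘(ℝ, E).prod 𝓘(ℝ, F)) ∞ (fun s : ℝ × ℝ => g s.1 s.2)
          (Icc 0 1 ×ˢ Icc 0 1) → ContMDiffOn 𝓘(ℝ, Fin 2 → ℝ) (𝓘(ℝ, E).prod 𝓘(ℝ, F)) ∞
          (cubeExtend fun s : Fin 2 → I => g (s 0) (s 1)) (Icc 0 1) := by
      intro g hg
      refine (hg.comp (f := fun s : Fin 2 → ℝ => (s 0, s 1)) (s := Icc 0 1)
        (ContDiff.contMDiff (by fun_prop)).contMDiffOn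
        fun s hs => ⟨⟨hs.1 0, hs.2 0⟩, ⟨hs.1 1, hs.2 1⟩⟩).congr fun s hs => ?_
      simp [cubeExtend, projIcc_of_mem zero_le_one (⟨hs.1 0, hs.2 0⟩ : s 0 ∈ Icc (0 : ℝ) 1),
        projIcc_of_mem zero_le_one (⟨hs.1 1, hs.2 1⟩ : s 1 ∈ Icc (0 : ℝ) 1)]
    have hq : ∀ f : C^∞⟮𝓘(ℝ, E), M; ℝ⟯,
        ContDiffOn ℝ ∞ (fun s : ℝ × ℝ => f (q s.1 s.2).proj) (Icc 0 1 ×ˢ Icc 0 1) := fun f =>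
      (h.smooth_base f).congr fun s hs => by rw [h.proj_eq _ hs.1 _ hs.2]
    split_ifs
    · exact hc (contMDiffOn_totalSpace_of_forall h.smooth_base h.smooth_fst)
    · exact hc (contMDiffOn_totalSpace_of_forall hq h.smooth_snd)
  pullback_d_zero f k t := by
    rw [eq_squarePoint t]
    generalize t 0 = t₀
    generalize t 1 = ε
    revert k
    refine Fin.forall_fin_two.2 ⟨?_, ?_⟩
    · rw [cubePartialDeriv_eq (h := fun s => f (p s ε).proj)]
      · exact HasDerivWithinAt.derivWithin_unit (h.deriv_fst f t₀ t₀.2 ε ε.2) t₀.2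
      · intro s
        rw [update_squarePoint_zero]; rfl
    · rw [cubePartialDeriv_eq (h := fun s => f (p t₀ s).proj)]
      · exact HasDerivWithinAt.derivWithin_unit (h.deriv_snd f t₀ t₀.2 ε ε.2) ε.2
      · intro s
        rw [update_squarePoint_one]; rfl
  pullback_d_one ξ i j t X Y hX hY := by
    rw [A.dOneForm_eq_dOne ξ X Y hX hY]
    clear hX hY
    rw [eq_squarePoint t]
    generalize t 0 = t₀
    generalize t 1 = ε
    -- The pair of indices (0, 1) carries all the information: (1, 0) follows by antisymmetry and
    -- the diagonal pairs are trivial.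
    have hd : cubePartialDeriv 0 (fun s => ξ.eval (q (s 0) (s 1))) (squarePoint t₀ ε) -
        cubePartialDeriv 1 (fun s => ξ.eval (p (s 0) (s 1))) (squarePoint t₀ ε) =
        A.dOne ξ (p t₀ ε) (q t₀ ε) := by
      rw [← h.deriv_form ξ t₀ t₀.2 ε ε.2,
        cubePartialDeriv_eq (h := fun s => ξ.eval (q s ε)),
        cubePartialDeriv_eq (h := fun s => ξ.eval (p t₀ s))]
      · rfl
      · intro s
        rw [update_squarePoint_one]; rfl
      · intro s
        rw [update_squarePoint_zero]; rfl
    fin_cases i <;> fin_cases j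
    · exact (sub_self _).trans (A.dOne_self ξ _).symm
    · exact hd
    · refine Eq.trans ?_ (A.dOne_antisymm ξ (h.proj_eq _ t₀.2 _ ε.2).symm).symm
      rw [← hd, neg_sub]
      rfl
    · exact (sub_self _).trans (A.dOne_self ξ _).symm

theorem sphereHomotopic_iff (a₀ a₁ : A.Sphere 1) :
    A.SphereHomotopic a₀ a₁ ↔ A.SquareHomotopic (sphereEquivPath A a₀) (sphereEquivPath A a₁) := by
  constructor
  · rintro ⟨h, h0, h1, h2⟩
    refine ⟨_, _, CubeMorphism.isSquareMorphism h, fun t => ?_, fun t => ?_, fun ε hε => ?_⟩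
    · rw [sphereEquivPath_toFun, ← h0.2 0]
      exact (planeExtend_coe (h.comp 0) t 0).trans
        (congrArg (h.comp 0) (cubeSnoc_eq_squarePoint (fun _ => t) 0).symm)
    · rw [sphereEquivPath_toFun, ← h1.2 0]
      exact (planeExtend_coe (h.comp 0) t 1).trans
        (congrArg (h.comp 0) (cubeSnoc_eq_squarePoint (fun _ => t) 1).symm)
    · have k0 := h2 (fun _ => 0) ⟨ε, hε⟩ ⟨0, Or.inl rfl⟩
      have k1 := h2 (fun _ => 1) ⟨ε, hε⟩ ⟨0, Or.inr rfl⟩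
      rw [cubeSnoc_eq_squarePoint] at k0 k1
      have e0 := planeExtend_coe (h.comp 1) 0 ⟨ε, hε⟩
      have e1 := planeExtend_coe (h.comp 1) 1 ⟨ε, hε⟩
      simp only [Icc.coe_zero, Icc.coe_one] at e0 e1
      rw [e0, e1]
      exact ⟨k0, k1⟩
  · rintro ⟨p, q, h, h0, h1, h2⟩
    have hface : ∀ (ε : I) (a : A.Sphere 1),
        (∀ t : I, p t ε = (sphereEquivPath A a).toFun t) → A.IsLastFace h.toCube ε a.1 := by
      intro ε a ha
      have hk : ∀ (k : Fin 1) (t : Fin 1 → I), p (t 0) ε = a.1.comp k t := by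
        intro k t
        rw [ha, sphereEquivPath_toFun, Subsingleton.elim k 0]
        congr 1
        funext i
        rw [Subsingleton.elim i 0]
      refine ⟨fun t => ?_, fun k t => ?_⟩
      · rw [cubeSnoc_eq_squarePoint, ← a.1.proj_comp 0 t, ← hk]
        rfl
      · rw [cubeSnoc_eq_squarePoint, ← hk, Subsingleton.elim k 0]
        rfl
    refine ⟨h.toCube, hface 0 a₀ h0, hface 1 a₁ h1, ?_⟩
    rintro t ε ⟨j, hj⟩
    rw [cubeSnoc_eq_squarePoint]
    rw [Subsingleton.elim j 0] at hj
    have hq : h.toCube.comp (Fin.last 1) (squarePoint (t 0) ε) = q (t 0) ε := rfl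
    rw [hq]
    rcases hj with hj | hj
    · rw [hj]
      exact (h2 ε ε.2).1
    · rw [hj]
      exact (h2 ε ε.2).2

end SphereHomotopy

end LieAlgebroid

/-! ### The dual connection and the torsion -/

section Connection

variable {E : Type*} [NormedAddCommGroup E] [NormedSpace ℝ E] [FiniteDimensional ℝ E]
  {M : Type*} [TopologicalSpace M] [T2Space M] [ChartedSpace E M] [IsManifold 𝓘(ℝ, E) ∞ M]
  {F : Type*} [NormedAddCommGroup F] [NormedSpace ℝ F] [FiniteDimensional ℝ F]
  {V : M → Type*} [TopologicalSpace (TotalSpace F V)]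
  [∀ x, AddCommGroup (V x)] [∀ x, Module ℝ (V x)] [∀ x, TopologicalSpace (V x)]
  [∀ x, IsTopologicalAddGroup (V x)] [∀ x, ContinuousSMul ℝ (V x)]
  [FiberBundle F V] [VectorBundle ℝ F V] [ContMDiffVectorBundle ∞ F V 𝓘(ℝ, E)]

/-- The pairing `⟨∇^*_v ξ, Y⟩ = v(ξ(Y)) - ξ(∇_v Y)`. -/
def dualCov (nabla : CovariantDerivative 𝓘(ℝ, E) F V) (ξ : BundleOneForm E F V)
    (Y : Cₛ^∞⟮𝓘(ℝ, E); F, V⟯) {x : M} (v : TangentSpace 𝓘(ℝ, E) x) : ℝ :=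
  tangentApply E v (fun y => ξ.toFun y (Y y)) - ξ.toFun x (nabla (fun y => Y y) x v)

variable (nabla : CovariantDerivative 𝓘(ℝ, E) F V) (ξ : BundleOneForm E F V)

theorem ContMDiffSection.mdifferentiableAt_totalSpace (Y : Cₛ^∞⟮𝓘(ℝ, E); F, V⟯) (x : M) :
    MDifferentiableAt 𝓘(ℝ, E) (𝓘(ℝ, E).prod 𝓘(ℝ, F)) (fun y => TotalSpace.mk' F y (Y y)) x :=
  Y.contMDiff.mdifferentiable (by simp) x

theorem CovariantDerivative.apply_add (Y Y' : Cₛ^∞⟮𝓘(ℝ, E); F, V⟯) {x : M}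
    (v : TangentSpace 𝓘(ℝ, E) x) :
    nabla (fun y => (Y + Y') y) x v = nabla (fun y => Y y) x v + nabla (fun y => Y' y) x v :=
  congrArg (fun L => L v) (nabla.isCovariantDerivativeOnUniv.add
    (Y.mdifferentiableAt_totalSpace x) (Y'.mdifferentiableAt_totalSpace x))

theorem CovariantDerivative.apply_smulSection (f : C^∞⟮𝓘(ℝ, E), M; ℝ⟯)
    (Y : Cₛ^∞⟮𝓘(ℝ, E); F, V⟯) {x : M} (v : TangentSpace 𝓘(ℝ, E) x) :
    nabla (fun y => smulSection f Y y) x v =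
      f x • nabla (fun y => Y y) x v + tangentApply E v f • Y x :=
  congrArg (fun L => L v) (nabla.isCovariantDerivativeOnUniv.leibniz
    (Y.mdifferentiableAt_totalSpace x) (C_mdifferentiableAt f x))

theorem dualCov_add_right (Y Y' : Cₛ^∞⟮𝓘(ℝ, E); F, V⟯) {x : M} (v : TangentSpace 𝓘(ℝ, E) x) :
    dualCov nabla ξ (Y + Y') v = dualCov nabla ξ Y v + dualCov nabla ξ Y' v := by
  have h := tangentApply_add v (C_mdifferentiableAt (ξ.pair Y) x) (C_mdifferentiableAt (ξ.pair Y') x)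
  simp only [BundleOneForm.coe_pair] at h
  simp only [dualCov, nabla.apply_add]
  simp only [ContMDiffSection.coe_add, Pi.add_apply, map_add]
  rw [h]
  ring

/-- The two terms v(f) ξ(Y), one from the product rule and one from the Leibniz rule of ∇, cancel;
hence the pairing is tensorial in Y. -/
theorem dualCov_smulSection (f : C^∞⟮𝓘(ℝ, E), M; ℝ⟯) (Y : Cₛ^∞⟮𝓘(ℝ, E); F, V⟯) {x : M}
    (v : TangentSpace 𝓘(ℝ, E) x) :
    dualCov nabla ξ (smulSection f Y) v = f x * dualCov nabla ξ Y v := by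
  have h := tangentApply_mul v (C_mdifferentiableAt f x) (C_mdifferentiableAt (ξ.pair Y) x)
  simp only [BundleOneForm.coe_pair] at h
  simp only [dualCov, nabla.apply_smulSection]
  simp only [smulSection_apply, map_add, map_smul, smul_eq_mul]
  rw [h]
  ring

/-- The additive map `Y ↦ ⟨∇^*_v ξ, Y⟩`. -/
def dualCovHom {x : M} (v : TangentSpace 𝓘(ℝ, E) x) : Cₛ^∞⟮𝓘(ℝ, E); F, V⟯ →+ ℝ :=
  AddMonoidHom.mk' (fun Y => dualCov nabla ξ Y v) fun Y Y' => dualCov_add_right nabla ξ Y Y' v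

theorem dualCov_congr {Y Y' : Cₛ^∞⟮𝓘(ℝ, E); F, V⟯} {x : M} (v : TangentSpace 𝓘(ℝ, E) x)
    (h : Y x = Y' x) : dualCov nabla ξ Y v = dualCov nabla ξ Y' v :=
  eq_of_tensorial (dualCovHom nabla ξ v) (fun f Y => dualCov_smulSection nabla ξ f Y v) h

theorem dualCov_sum_frame {ι : Type*} [Fintype ι] {e : ι → Cₛ^∞⟮𝓘(ℝ, E); F, V⟯} {c : ι → ℝ}
    {Y : Cₛ^∞⟮𝓘(ℝ, E); F, V⟯} {x : M} (h : Y x = ∑ k, c k • e k x)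
    (v : TangentSpace 𝓘(ℝ, E) x) :
    dualCov nabla ξ Y v = ∑ k, c k * dualCov nabla ξ (e k) v := by
  rw [dualCov_congr nabla ξ v (Y' := ∑ k, smulSection (constSmooth E (c k)) (e k))]
  · refine (map_sum (dualCovHom nabla ξ v) _ _).trans (Finset.sum_congr rfl fun k _ => ?_)
    exact dualCov_smulSection nabla ξ _ _ v
  · rw [h, ContMDiffSection.sum_apply]
    rfl

/-- The linear map `v ↦ ⟨∇^*_v ξ, Y⟩`. -/
def dualCovLinear (Y : Cₛ^∞⟮𝓘(ℝ, E); F, V⟯) (x : M) : TangentSpace 𝓘(ℝ, E) x →ₗ[ℝ] ℝ :=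
  tangentApplyHom (fun y => ξ.toFun y (Y y)) x
    - ξ.toFun x ∘ₗ (nabla (fun y => Y y) x : TangentSpace 𝓘(ℝ, E) x →ₗ[ℝ] V x)

theorem dualCovLinear_apply (Y : Cₛ^∞⟮𝓘(ℝ, E); F, V⟯) {x : M} (v : TangentSpace 𝓘(ℝ, E) x) :
    dualCovLinear nabla ξ Y x v = dualCov nabla ξ Y v := rfl

/-- Each ξ(∇Y) is completed by the derivative of ξ(Y) to a value of ∇*ξ, and the derivatives so
introduced, with the bracket, make up d_A ξ. This links the equation of A-homotopy to that of
morphisms. -/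
theorem LieAlgebroid.toFun_torsionAt (A : LieAlgebroid E F V) (X Y : Cₛ^∞⟮𝓘(ℝ, E); F, V⟯) (x : M) :
    ξ.toFun x (A.torsionAt nabla X Y x) = A.dOneForm ξ X Y x
      - dualCov nabla ξ Y (A.anchor x (X x)) + dualCov nabla ξ X (A.anchor x (Y x)) := by
  simp only [LieAlgebroid.torsionAt, map_sub, LieAlgebroid.dOneForm, dualCov]
  ring

section Smooth

variable [CovariantDerivative.ContMDiffCovariantDerivative nabla ∞]
  (Z : Cₛ^∞⟮𝓘(ℝ, E); E, (TangentSpace 𝓘(ℝ, E) : M → Type _)⟯)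

theorem contMDiff_cov (Y : Cₛ^∞⟮𝓘(ℝ, E); F, V⟯) :
    ContMDiff 𝓘(ℝ, E) (𝓘(ℝ, E).prod 𝓘(ℝ, F)) ∞
      (fun x => TotalSpace.mk' F x (nabla (fun y => Y y) x (Z x))) := by
  -- A connection of class k acts on sections of class k + 1; here ∞ + 1 = ∞.
  have hY : ContMDiffOn 𝓘(ℝ, E) (𝓘(ℝ, E).prod 𝓘(ℝ, F)) (∞ + 1) (fun y => TotalSpace.mk' F y (Y y))
      univ := Y.contMDiff.contMDiffOn
  have h1 := (CovariantDerivative.ContMDiffCovariantDerivative.contMDiff (cov := nabla)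
    (k := ∞)).contMDiff hY
  rw [contMDiffOn_univ] at h1
  exact h1.clm_bundle_apply Z.contMDiff

theorem contMDiff_dualCov (Y : Cₛ^∞⟮𝓘(ℝ, E); F, V⟯) :
    ContMDiff 𝓘(ℝ, E) 𝓘(ℝ, ℝ) ∞ (fun x => dualCov nabla ξ Y (Z x)) := by
  refine ContMDiff.sub ?_ (ξ.smooth.comp (contMDiff_cov nabla Z Y))
  have h1 : ContMDiff 𝓘(ℝ, E).tangent 𝓘(ℝ, ℝ).tangent ∞ (tangentMap 𝓘(ℝ, E) 𝓘(ℝ, ℝ) (ξ.pair Y)) :=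
    (ξ.pair Y).contMDiff.contMDiff_tangentMap (by simp)
  exact (contMDiff_snd_tangentBundle_modelSpace ℝ 𝓘(ℝ, ℝ)).comp (h1.comp Z.contMDiff)

/-- The linear form `∇^*_Z ξ` at a point. -/
def dualCovFiber (x : M) : V x →ₗ[ℝ] ℝ where
  toFun u := dualCov nabla ξ (sectionThrough ⟨x, u⟩) (Z x)
  map_add' u v := by
    rw [← dualCov_add_right]
    refine dualCov_congr nabla ξ _ ?_
    simp only [ContMDiffSection.coe_add, Pi.add_apply, sectionThrough_mk_apply]
  map_smul' c u := by
    refine Eq.trans ?_ (dualCov_smulSection nabla ξ (constSmooth E c) _ (Z x))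
    refine dualCov_congr nabla ξ _ ?_
    simp only [smulSection_apply, sectionThrough_mk_apply]
    rfl

/-- The one-form `∇^*_Z ξ`. -/
def dualCovForm : BundleOneForm E F V where
  toFun := dualCovFiber nabla ξ Z
  smooth := by
    intro u
    obtain ⟨e, ε, χ, hχ, he, -⟩ := exists_local_frame (E := E) (F := F) (V := V) u.proj
    -- The expression of the form in a local frame, where the pointwise choice of sections has
    -- disappeared.
    have hs : ContMDiff (𝓘(ℝ, E).prod 𝓘(ℝ, F)) 𝓘(ℝ, ℝ) ∞ (fun v : TotalSpace F V =>
        ∑ k, (ε k).eval v * dualCov nabla ξ (e k) (Z v.proj)) :=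
      contMDiff_finsetSum fun k _ => ContMDiff.mul (ε k).smooth
        ((contMDiff_dualCov nabla ξ Z (e k)).comp (contMDiff_proj V))
    refine (hs u).congr_of_eventuallyEq ?_
    have hc : Filter.Tendsto (fun v : TotalSpace F V => v.proj) (𝓝 u) (𝓝 u.proj) :=
      (FiberBundle.continuous_proj F V).tendsto u
    filter_upwards [hc.eventually hχ] with v hv
    refine dualCov_sum_frame nabla ξ ?_ (Z v.proj)
    have h1 := he v.proj v.snd
    rw [hv, one_smul] at h1
    rw [sectionThrough_mk_apply, ← h1]
    rfl

theorem dualCovForm_eval (Y : Cₛ^∞⟮𝓘(ℝ, E); F, V⟯) {u : TotalSpace F V} (h : Y u.proj = u.snd) :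
    (dualCovForm nabla ξ Z).eval u = dualCov nabla ξ Y (Z u.proj) :=
  dualCov_congr nabla ξ _ ((sectionThrough_apply u).trans h.symm)

end Smooth

end Connection

/-- Mixed partial derivatives commute on the closed unit square. -/
theorem ContDiffOn.hasDerivWithinAt_derivWithin_square {G : ℝ → ℝ → ℝ}
    (h : ContDiffOn ℝ ∞ (fun s : ℝ × ℝ => G s.1 s.2) (Icc 0 1 ×ˢ Icc 0 1)) {t ε : ℝ}
    (ht : t ∈ Icc (0 : ℝ) 1) (hε : ε ∈ Icc (0 : ℝ) 1) :
    HasDerivWithinAt (fun t => derivWithin (fun s => G t s) (Icc 0 1) ε)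
      (derivWithin (fun s => derivWithin (fun t => G t s) (Icc 0 1) t) (Icc 0 1) ε) (Icc 0 1) t := by
  set S : Set (ℝ × ℝ) := Icc 0 1 ×ˢ Icc 0 1 with hS
  set g : ℝ × ℝ → ℝ := fun s => G s.1 s.2 with hg
  have hu : UniqueDiffOn ℝ S := uniqueDiffOn_Icc_zero_one.prod uniqueDiffOn_Icc_zero_one
  have hd : ∀ x ∈ S, HasFDerivWithinAt g (fderivWithin ℝ g S x) S x := fun x hx =>
    (h.differentiableOn (by simp) x hx).hasFDerivWithinAt
  have h1 : ∀ t ∈ Icc (0 : ℝ) 1, ∀ s ∈ Icc (0 : ℝ) 1,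
      HasDerivWithinAt (fun t => (t, s)) ((1, 0) : ℝ × ℝ) (Icc 0 1) t := fun t _ s _ =>
    (hasDerivWithinAt_id t _).prodMk (hasDerivWithinAt_const t _ s)
  have h2 : ∀ t ∈ Icc (0 : ℝ) 1, ∀ s ∈ Icc (0 : ℝ) 1,
      HasDerivWithinAt (fun s => (t, s)) ((0, 1) : ℝ × ℝ) (Icc 0 1) s := fun t _ s _ =>
    (hasDerivWithinAt_const s _ t).prodMk (hasDerivWithinAt_id s _)
  have e1 : ∀ t ∈ Icc (0 : ℝ) 1, ∀ s ∈ Icc (0 : ℝ) 1,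
      derivWithin (fun t => G t s) (Icc 0 1) t = fderivWithin ℝ g S (t, s) (1, 0) :=
    fun t ht s hs => HasDerivWithinAt.derivWithin_unit
      ((hd (t, s) ⟨ht, hs⟩).comp_hasDerivWithinAt (f := fun t => (t, s)) t (h1 t ht s hs)
        fun r hr => ⟨hr, hs⟩) ht
  have e2 : ∀ t ∈ Icc (0 : ℝ) 1, ∀ s ∈ Icc (0 : ℝ) 1,
      derivWithin (fun s => G t s) (Icc 0 1) s = fderivWithin ℝ g S (t, s) (0, 1) :=
    fun t ht s hs => HasDerivWithinAt.derivWithin_unit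
      ((hd (t, s) ⟨ht, hs⟩).comp_hasDerivWithinAt (f := fun s => (t, s)) s (h2 t ht s hs)
        fun r hr => ⟨ht, hr⟩) hs
  have hx : (t, ε) ∈ S := ⟨ht, hε⟩
  have hd2 : HasFDerivWithinAt (fderivWithin ℝ g S) (fderivWithin ℝ (fderivWithin ℝ g S) S (t, ε))
      S (t, ε) :=
    ((h.fderivWithin hu (m := ∞) (by simp)).differentiableOn (by simp) _ hx).hasFDerivWithinAt
  -- Symmetry of the second derivative also holds at boundary points, since the square is the
  -- closure of its interior.
  have hsym : IsSymmSndFDerivWithinAt ℝ g S (t, ε) := by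
    refine ContDiffWithinAt.isSymmSndFDerivWithinAt (h _ hx) ?_ hu ?_ hx
    · rw [minSmoothness_of_isRCLikeNormedField]
      exact WithTop.coe_le_coe.2 (le_top : (2 : ℕ∞) ≤ ⊤)
    · rw [hS, interior_prod_eq, closure_prod_eq, interior_Icc, closure_Ioo zero_ne_one]
      exact hx
  have hap : ∀ z : ℝ × ℝ, HasFDerivAt (fun L : ℝ × ℝ →L[ℝ] ℝ => L z)
      (ContinuousLinearMap.apply ℝ ℝ z) (fderivWithin ℝ g S (t, ε)) := fun z =>
    (ContinuousLinearMap.apply ℝ ℝ z).hasFDerivAt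
  have k1 : HasDerivWithinAt (fun r => fderivWithin ℝ g S (r, ε) (0, 1))
      (fderivWithin ℝ (fderivWithin ℝ g S) S (t, ε) (1, 0) (0, 1)) (Icc 0 1) t :=
    HasFDerivAt.comp_hasDerivWithinAt (l := fun L : ℝ × ℝ →L[ℝ] ℝ => L (0, 1))
      (l' := ContinuousLinearMap.apply ℝ ℝ ((0, 1) : ℝ × ℝ)) t (hap (0, 1))
      (hd2.comp_hasDerivWithinAt (f := fun t => (t, ε)) t (h1 t ht ε hε) fun r hr => ⟨hr, hε⟩)
  have k2 : HasDerivWithinAt (fun r => fderivWithin ℝ g S (t, r) (1, 0))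
      (fderivWithin ℝ (fderivWithin ℝ g S) S (t, ε) (0, 1) (1, 0)) (Icc 0 1) ε :=
    HasFDerivAt.comp_hasDerivWithinAt (l := fun L : ℝ × ℝ →L[ℝ] ℝ => L (1, 0))
      (l' := ContinuousLinearMap.apply ℝ ℝ ((1, 0) : ℝ × ℝ)) ε (hap (1, 0))
      (hd2.comp_hasDerivWithinAt (f := fun s => (t, s)) ε (h2 t ht ε hε) fun r hr => ⟨ht, hr⟩)
  have k3 : derivWithin (fun s => derivWithin (fun t => G t s) (Icc 0 1) t) (Icc 0 1) ε =
      fderivWithin ℝ (fderivWithin ℝ g S) S (t, ε) (1, 0) (0, 1) := by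
    rw [hsym.eq, ← HasDerivWithinAt.derivWithin_unit k2 hε]
    exact derivWithin_congr (fun s hs => e1 t ht s hs) (e1 t ht ε hε)
  rw [k3]
  exact k1.congr (fun r hr => e2 r hr ε hε) (e2 t ht ε hε)

/-! ### Covariant derivatives along paths and a linear equation -/

section CovDeriv

variable {E : Type*} [NormedAddCommGroup E] [NormedSpace ℝ E] [FiniteDimensional ℝ E]
  {M : Type*} [TopologicalSpace M] [T2Space M] [ChartedSpace E M] [IsManifold 𝓘(ℝ, E) ∞ M]
  {F : Type*} [NormedAddCommGroup F] [NormedSpace ℝ F] [FiniteDimensional ℝ F]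
  {V : M → Type*} [TopologicalSpace (TotalSpace F V)]
  [∀ x, AddCommGroup (V x)] [∀ x, Module ℝ (V x)] [∀ x, TopologicalSpace (V x)]
  [∀ x, IsTopologicalAddGroup (V x)] [∀ x, ContinuousSMul ℝ (V x)]
  [FiberBundle F V] [VectorBundle ℝ F V] [ContMDiffVectorBundle ∞ F V 𝓘(ℝ, E)]
  (nabla : CovariantDerivative 𝓘(ℝ, E) F V)

theorem isCovDerivAlong_iff {u : I → TotalSpace F V} {t : I} {w : V (u t).proj} :
    IsCovDerivAlong nabla u t w ↔
      ∀ (ξ : BundleOneForm E F V) (Y : Cₛ^∞⟮𝓘(ℝ, E); F, V⟯), Y (u t).proj = (u t).snd →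
        derivWithin (fun s => ξ.eval (intervalExtend u s)) (Icc 0 1) t =
          ξ.toFun _ w + dualCov nabla ξ Y (pathVelocity (fun s => (u s).proj) t) := Iff.rfl

/-- In a local frame u = Σ uₖ eₖ with uₖ = εₖ(u), and D_t u = Σ (uₖ′ eₖ + uₖ ∇_v eₖ). To verify it
against ξ, differentiate χ ξ(u) = Σ uₖ ξ(eₖ) along the path; χ is 1 near the point, so its
derivative drops out. -/
theorem exists_isCovDerivAlong {u : I → TotalSpace F V}
    (hu : ContMDiffOn 𝓘(ℝ, ℝ) (𝓘(ℝ, E).prod 𝓘(ℝ, F)) ∞ (intervalExtend u) (Icc 0 1)) (t : I) :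
    ∃ w : V (u t).proj, IsCovDerivAlong nabla u t w := by
  have hb : ContMDiffOn 𝓘(ℝ, ℝ) 𝓘(ℝ, E) ∞ (intervalExtend fun s => (u s).proj) (Icc 0 1) :=
    (contMDiff_proj V).comp_contMDiffOn hu
  have hf : ∀ ξ : BundleOneForm E F V, HasDerivWithinAt (fun s => ξ.eval (intervalExtend u s))
      (derivWithin (fun s => ξ.eval (intervalExtend u s)) (Icc 0 1) t) (Icc 0 1) (t : ℝ) := fun ξ =>
    (contMDiffOn_iff_contDiffOn.1 (ξ.contMDiff_eval.comp_contMDiffOn hu)).hasDerivWithinAt_unit t.2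
  set v : TangentSpace 𝓘(ℝ, E) (u t).proj := pathVelocity (fun s => (u s).proj) t with hv
  have hg : ∀ g : C^∞⟮𝓘(ℝ, E), M; ℝ⟯, HasDerivWithinAt (fun s => g (intervalExtend u s).proj)
      (tangentApply E v g) (Icc 0 1) (t : ℝ) := fun g =>
    hasDerivWithinAt_comp_pathVelocity ((hb t t.2).mdifferentiableWithinAt (by simp))
      (C_mdifferentiableAt g _)
  obtain ⟨e, ε, χ, hχ, he, -⟩ := exists_local_frame (E := E) (F := F) (V := V) (u t).proj
  refine ⟨∑ k, (derivWithin (fun s => (ε k).eval (intervalExtend u s)) (Icc 0 1) t •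
    e k (u t).proj + (ε k).eval (u t) • nabla (fun y => e k y) (u t).proj v), ?_⟩
  rw [isCovDerivAlong_iff]
  intro ξ Y hY
  have h1 : (u t).snd = ∑ k, (ε k).eval (u t) • e k (u t).proj := by
    have := he (u t).proj (u t).snd
    rw [hχ.self_of_nhds, one_smul] at this
    exact this.symm
  rw [dualCov_sum_frame nabla ξ (hY.trans h1)]
  have k1 := (hg χ).mul (hf ξ)
  have k2 := HasDerivWithinAt.fun_sum (u := Finset.univ) fun k _ => (hf (ε k)).mul (hg (ξ.pair (e k)))
  have k3 : (fun s => χ (intervalExtend u s).proj * ξ.eval (intervalExtend u s)) =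
      fun s => ∑ k, (ε k).eval (intervalExtend u s) * ξ.pair (e k) (intervalExtend u s).proj := by
    funext s
    have := congrArg (ξ.toFun _) (he (intervalExtend u s).proj (intervalExtend u s).snd)
    rw [map_sum, map_smul] at this
    simp only [map_smul] at this
    exact this.symm
  have k4 := (uniqueDiffOn_Icc_zero_one t t.2).eq_deriv _ (k1.congr_deriv rfl)
    ((k2.congr_of_eventuallyEq_of_mem (Filter.Eventually.of_forall fun s => congrFun k3 s) t.2))
  rw [tangentApply_eq_zero_of_eventually_one v hχ, intervalExtend_coe, hχ.self_of_nhds, zero_mul,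
    zero_add, one_mul] at k4
  rw [k4, map_sum, ← Finset.sum_add_distrib]
  refine Finset.sum_congr rfl fun k _ => ?_
  simp only [map_add, map_smul, smul_eq_mul, dualCov, BundleOneForm.pair_apply,
    BundleOneForm.coe_pair]
  ring

/-- A vector field along a path that satisfies a homogeneous linear equation vanishes if its
initial value does. -/
theorem eq_zero_of_linear_ode [CovariantDerivative.ContMDiffCovariantDerivative nabla ∞]
    {α : I → TotalSpace F V}
    (hα : ContMDiffOn 𝓘(ℝ, ℝ) (𝓘(ℝ, E).prod 𝓘(ℝ, F)) ∞ (intervalExtend α) (Icc 0 1))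
    {v : ∀ t, TangentSpace 𝓘(ℝ, E) (α t).proj}
    (ξ : C^∞⟮𝓘(ℝ, E), M; ℝ⟯ → BundleOneForm E F V)
    (h : ∀ (f : C^∞⟮𝓘(ℝ, E), M; ℝ⟯) (t : I), HasDerivWithinAt (intervalExtend fun t => tangentApply E (v t) f)
      (dualCov nabla (ξ f) (sectionThrough (α t)) (v t)) (Icc 0 1) (t : ℝ))
    (h0 : v 0 = 0) (t : I) : v t = 0 := by
  set W : C^∞⟮𝓘(ℝ, E), M; ℝ⟯ → ℝ → ℝ := fun f => intervalExtend fun t => tangentApply E (v t) f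
    with hW
  have hWc : ∀ f, ContinuousOn (W f) (Icc 0 1) := fun f t ht => (h f ⟨t, ht⟩).continuousWithinAt
  suffices hs : Icc (0 : ℝ) 1 ⊆ {t | ∀ f, W f t = 0} by
    refine eq_of_forall_tangentApply (E := E) fun f => ?_
    rw [tangentApply_zero_left]
    have := hs t.2 f
    simp only [hW] at this
    rwa [intervalExtend_coe] at this
  -- Coordinates exist only locally on M, so one argues by continuity: the set of times at which v
  -- vanishes is closed, contains 0 and extends to the right.
  refine IsClosed.Icc_subset_of_forall_mem_nhdsWithin ?_ ?_ ?_
  · have e : {t | ∀ f, W f t = 0} ∩ Icc 0 1 = ⋂ f, Icc 0 1 ∩ W f ⁻¹' {0} := by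
      ext t
      simp only [mem_inter_iff, mem_ofPred_eq, mem_iInter, mem_preimage, mem_singleton_iff]
      exact ⟨fun h f => ⟨h.2, h.1 f⟩, fun h => ⟨fun f => (h f).2, (h (constSmooth E 0)).1⟩⟩
    rw [e]
    exact isClosed_iInter fun f => (hWc f).preimage_isClosed_of_isClosed isClosed_Icc
      isClosed_singleton
  · intro f
    have : W f (0 : I) = 0 := by
      simp only [hW]
      rw [intervalExtend_coe, h0, tangentApply_zero_left]
    exact this
  · rintro t₀ ⟨ht₀, ht₀'⟩
    obtain ⟨f, Z, hZ⟩ := exists_local_coordinates (E := E) (intervalExtend α t₀).proj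
    have hn : Icc (0 : ℝ) 1 ∈ 𝓝[≥] t₀ := Icc_mem_nhdsGE_of_mem ht₀'
    have hc : ContinuousWithinAt (fun t => (intervalExtend α t).proj) (Ici t₀) t₀ :=
      (((contMDiff_proj V).comp_contMDiffOn hα).continuousOn t₀
        ⟨ht₀'.1, ht₀'.2.le⟩).mono_of_mem_nhdsWithin hn
    obtain ⟨c, hc0, hc1⟩ := mem_nhdsGE_iff_exists_Icc_subset.1
      (Filter.inter_mem hn (hc.eventually hZ))
    have hsub : Icc t₀ c ⊆ Icc 0 1 := fun s hs => (hc1 hs).1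
    have hsum : ∀ s (hs : s ∈ Icc t₀ c), v ⟨s, hsub hs⟩ = ∑ i, W (f i) s • Z i _ := by
      intro s hs
      have h1 := (hc1 hs).2
      simp only [mem_ofPred_eq] at h1
      rw [intervalExtend_of_mem α (hsub hs)] at h1
      refine (h1 (v ⟨s, hsub hs⟩)).trans (Finset.sum_congr rfl fun i _ => ?_)
      simp only [hW]
      rw [intervalExtend_of_mem _ (hsub hs)]
    -- In local coordinates the equation is W_i′ = Σ_j C_ij W_j. The coefficients are continuous
    -- because the smoothness of ∇ makes ∇*_Z ξ a smooth one-form.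
    let C : _ → _ → ℝ → ℝ := fun i j s => (dualCovForm nabla (ξ (f i)) (Z j)).eval (intervalExtend α s)
    have hC : ∀ i j, ContinuousOn (C i j) (Icc t₀ c) := fun i j =>
      (((dualCovForm nabla (ξ (f i)) (Z j)).contMDiff_eval.comp_contMDiffOn hα).continuousOn).mono
        hsub
    -- A bound for the sum of all |C_ij| bounds every row sum, hence the right-hand side in the sup
    -- norm, as Grönwall's inequality requires.
    obtain ⟨K, hK⟩ := isCompact_Icc.exists_bound_of_continuousOn
      (f := fun s => ∑ i, ∑ j, |C i j s|) (s := Icc t₀ c)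
      (continuousOn_finsetSum _ fun i _ => continuousOn_finsetSum _ fun j _ => (hC i j).abs)
    have hder : ∀ i, ∀ s (hs : s ∈ Icc t₀ c),
        HasDerivWithinAt (W (f i)) (∑ j, W (f j) s * C i j s) (Icc 0 1) s := by
      intro i s hs
      refine (h (f i) ⟨s, hsub hs⟩).congr_deriv ?_
      rw [hsum s hs, ← dualCovLinear_apply, map_sum]
      refine Finset.sum_congr rfl fun j _ => ?_
      rw [map_smul, smul_eq_mul, dualCovLinear_apply]
      congr 1
      simp only [C]
      rw [intervalExtend_of_mem α (hsub hs)]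
      exact (dualCovForm_eval nabla (ξ (f i)) (Z j) _ (sectionThrough_apply _)).symm
    have hz : ∀ s ∈ Icc t₀ c, (fun i => W (f i) s) = 0 := by
      refine eq_zero_of_abs_deriv_le_mul_abs_self_of_eq_zero_right
        (f := fun s i => W (f i) s) (f' := fun s i => ∑ j, W (f j) s * C i j s) (K := K) ?_ ?_ ?_ ?_
      · exact continuousOn_pi.2 fun i => (hWc _).mono hsub
      · intro s hs
        refine hasDerivWithinAt_pi.2 fun i => ?_
        exact (hder i s ⟨hs.1, hs.2.le⟩).mono_of_mem_nhdsWithin (Icc_mem_nhdsGE_of_mem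
          ⟨ht₀'.1.trans hs.1, hs.2.trans_le (hsub ⟨hc0.le, le_rfl⟩).2⟩)
      · funext i
        exact ht₀ (f i)
      · intro s hs
        have hKs := hK s ⟨hs.1, hs.2.le⟩
        rw [Real.norm_eq_abs] at hKs
        have hK0 := (le_abs_self _).trans hKs
        refine (pi_norm_le_iff_of_nonneg (mul_nonneg ((abs_nonneg _).trans hKs)
          (norm_nonneg _))).2 fun i => ?_
        calc ‖∑ j, W (f j) s * C i j s‖ ≤ ∑ j, |C i j s| * ‖fun i => W (f i) s‖ := by
              refine norm_sum_le_of_le _ fun j _ => ?_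
              rw [norm_mul, mul_comm]
              exact mul_le_mul_of_nonneg_left (norm_le_pi_norm (fun i => W (f i) s) j)
                (abs_nonneg _)
          _ = (∑ j, |C i j s|) * ‖fun i => W (f i) s‖ := (Finset.sum_mul _ _ _).symm
          _ ≤ K * ‖fun i => W (f i) s‖ := by
              refine mul_le_mul_of_nonneg_right (le_trans ?_ hK0) (norm_nonneg _)
              exact Finset.single_le_sum (f := fun i => ∑ j, |C i j s|)
                (fun i _ => Finset.sum_nonneg fun j _ => abs_nonneg _) (Finset.mem_univ i)
    refine Filter.mem_of_superset (Ioc_mem_nhdsGT hc0) fun s hs g => ?_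
    have hs' : s ∈ Icc t₀ c := ⟨hs.1.le, hs.2⟩
    have hv0 : v ⟨s, hsub hs'⟩ = 0 := by
      rw [hsum s hs']
      refine Finset.sum_eq_zero fun i _ => ?_
      rw [show W (f i) s = 0 from congrFun (hz s hs') i]
      exact zero_smul _ _
    simp only [hW]
    rw [intervalExtend_of_mem _ (hsub hs'), hv0, tangentApply_zero_left]

end CovDeriv

theorem squareExtend_of_mem {N : Type*} (p : I → I → N) {s : ℝ × ℝ}
    (hs : s ∈ Icc (0 : ℝ) 1 ×ˢ Icc (0 : ℝ) 1) :
    squareExtend p s = p ⟨s.1, hs.1⟩ ⟨s.2, hs.2⟩ := by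
  simp [squareExtend, projIcc_of_mem zero_le_one hs.1, projIcc_of_mem zero_le_one hs.2]

theorem squareExtend_coe {N : Type*} (p : I → I → N) (ε t : I) :
    squareExtend p ((ε : ℝ), (t : ℝ)) = p ε t := by
  simp [squareExtend]

namespace LieAlgebroid

/-! ### A-homotopy is homotopy through square morphisms -/

section Weinstein

variable {E : Type*} [NormedAddCommGroup E] [NormedSpace ℝ E] [FiniteDimensional ℝ E]
  {M : Type*} [TopologicalSpace M] [T2Space M] [ChartedSpace E M] [IsManifold 𝓘(ℝ, E) ∞ M]
  {F : Type*} [NormedAddCommGroup F] [NormedSpace ℝ F] [FiniteDimensional ℝ F]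
  {V : M → Type*} [TopologicalSpace (TotalSpace F V)]
  [∀ x, AddCommGroup (V x)] [∀ x, Module ℝ (V x)] [∀ x, TopologicalSpace (V x)]
  [∀ x, IsTopologicalAddGroup (V x)] [∀ x, ContinuousSMul ℝ (V x)]
  [FiberBundle F V] [VectorBundle ℝ F V] [ContMDiffVectorBundle ∞ F V 𝓘(ℝ, E)]
  {A : LieAlgebroid E F V} (nabla : CovariantDerivative 𝓘(ℝ, E) F V)

/-- Take a = p and b = q. Both anchors are velocities of the base map, so once the equation is
paired with ξ, the values of ∇*ξ from the covariant derivatives cancel those from the torsion,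
leaving the morphism equation. -/
theorem squareHomotopic_apathHomotopic {a₀ a₁ : A.APath} (H : A.SquareHomotopic a₀ a₁) :
    A.APathHomotopic nabla a₀ a₁ := by
  obtain ⟨p, q, h, h0, h1, hq⟩ := H
  have hsp : ContMDiffOn 𝓘(ℝ, ℝ × ℝ) (𝓘(ℝ, E).prod 𝓘(ℝ, F)) ∞ (fun s : ℝ × ℝ => p s.1 s.2)
      (Icc 0 1 ×ˢ Icc 0 1) := contMDiffOn_totalSpace_of_forall h.smooth_base h.smooth_fst
  have hsq : ContMDiffOn 𝓘(ℝ, ℝ × ℝ) (𝓘(ℝ, E).prod 𝓘(ℝ, F)) ∞ (fun s : ℝ × ℝ => q s.1 s.2)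
      (Icc 0 1 ×ˢ Icc 0 1) := contMDiffOn_totalSpace_of_forall
    (fun f => (h.smooth_base f).congr fun s hs => by rw [h.proj_eq _ hs.1 _ hs.2]) h.smooth_snd
  have hswap : ContMDiffOn 𝓘(ℝ, ℝ × ℝ) 𝓘(ℝ, ℝ × ℝ) ∞ (fun s : ℝ × ℝ => (s.2, s.1))
      (Icc 0 1 ×ˢ Icc 0 1) := (contDiff_snd.prodMk contDiff_fst).contMDiff.contMDiffOn
  have hmaps : MapsTo (fun s : ℝ × ℝ => (s.2, s.1)) (Icc (0 : ℝ) 1 ×ˢ Icc (0 : ℝ) 1)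
      (Icc (0 : ℝ) 1 ×ˢ Icc (0 : ℝ) 1) := fun s hs => ⟨hs.2, hs.1⟩
  let a : I → A.APath := fun ε => APath.ofIsPath (h.slice ε.2)
  have ha : ∀ ε t : I, (a ε).toFun t = p t ε := fun _ _ => rfl
  -- The vectors q and p lie over equal, but not definitionally equal, points; b is q moved to the
  -- fibre of p.
  have hb : ∀ ε t : I, ∃ b : V ((a ε).toFun t).proj,
      TotalSpace.mk' F ((a ε).toFun t).proj b = q t ε := fun ε t => by
    have e := h.proj_eq t t.2 ε ε.2
    rw [ha, ← e]
    exact ⟨(q t ε).snd, rfl⟩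
  choose b hb using hb
  have hb0 : ∀ {ε t : I}, (q t ε).snd = 0 → b ε t = 0 := fun {ε t} hz => by
    have e : TotalSpace.mk' F ((a ε).toFun t).proj (b ε t) = TotalSpace.mk' F _ 0 :=
      (hb ε t).trans (TotalSpace.eq_of_snd_eq_zero (h.proj_eq t t.2 ε ε.2) hz rfl)
    exact TotalSpace.mk_inj.1 e
  have hslice : ∀ ε : I, ContMDiffOn 𝓘(ℝ, ℝ) (𝓘(ℝ, E).prod 𝓘(ℝ, F)) ∞
      (intervalExtend fun s => TotalSpace.mk' F ((a ε).toFun s).proj (b ε s)) (Icc 0 1) := fun ε => by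
    refine (hsq.comp (f := fun t : ℝ => (t, (ε : ℝ))) (s := Icc 0 1)
      (contDiff_id.prodMk contDiff_const).contMDiff.contMDiffOn fun t ht => ⟨ht, ε.2⟩).congr
      fun t ht => ?_
    rw [intervalExtend_of_mem _ ht, hb]
    rfl
  have hslice' : ∀ t : I, ContMDiffOn 𝓘(ℝ, ℝ) (𝓘(ℝ, E).prod 𝓘(ℝ, F)) ∞
      (intervalExtend fun s => (a s).toFun t) (Icc 0 1) := fun t => by
    refine (hsp.comp (f := fun ε : ℝ => ((t : ℝ), ε)) (s := Icc 0 1)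
      (contDiff_const.prodMk contDiff_id).contMDiff.contMDiffOn fun ε hε => ⟨t.2, hε⟩).congr
      fun ε hε => ?_
    rw [intervalExtend_of_mem _ hε]
    rfl
  refine ⟨a, b, ?_, ?_, ?_, fun ε => ⟨?_, ?_⟩, ?_, fun ε t => ?_, fun ε => ?_, fun ε => ?_⟩
  · ext t : 2
    exact h0 t
  · ext t : 2
    exact h1 t
  · exact (hsp.comp hswap hmaps).congr fun s hs => squareExtend_of_mem _ hs
  · rw [← h0]
    exact h.proj_const zero_mem_unit (fun ε hε => (hq ε hε).1) ε.2
  · rw [← h0]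
    exact h.proj_const one_mem_unit (fun ε hε => (hq ε hε).2) ε.2
  · exact (hsq.comp hswap hmaps).congr fun s hs => (squareExtend_of_mem _ hs).trans (hb _ _)
  · obtain ⟨Db, hDb⟩ := exists_isCovDerivAlong nabla (hslice ε) t
    obtain ⟨Da, hDa⟩ := exists_isCovDerivAlong nabla (hslice' t) ε
    refine ⟨Db, Da, hDb, hDa, fun X Y hX hY => ?_⟩
    have hv : A.anchor _ (b ε t) = pathVelocity (fun s => ((a s).toFun t).proj) ε := by
      refine eq_pathVelocity ((contMDiff_proj V).comp_contMDiffOn (hslice' t)) fun f => ?_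
      have e : A.dFun f (q t ε) = tangentApply E (A.anchor _ (b ε t)) f := by
        rw [← hb]
        rfl
      rw [← e]
      refine (h.deriv_snd f t t.2 ε ε.2).congr (fun s hs => ?_) ?_
      · rw [intervalExtend_of_mem _ hs]
        rfl
      · rw [intervalExtend_coe]
        rfl
    refine eq_of_forall_oneForm (E := E) (F := F) fun ξ => ?_
    have k1 := (isCovDerivAlong_iff nabla).1 hDb ξ Y hY
    have k2 := (isCovDerivAlong_iff nabla).1 hDa ξ X hX
    have k3 := h.deriv_form ξ t t.2 ε ε.2
    rw [← hv] at k2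
    have hv' := (a ε).anchor_eq t
    have k1' : derivWithin (fun s => ξ.eval (q s ε)) (Icc 0 1) t =
        ξ.toFun _ Db + dualCov nabla ξ Y (A.anchor _ ((a ε).toFun t).snd) := by
      rw [hv']
      refine Eq.trans ?_ k1
      have : EqOn (fun s => ξ.eval (q s ε)) (fun s => ξ.eval (intervalExtend
          (fun s => TotalSpace.mk' F ((a ε).toFun s).proj (b ε s)) s)) (Icc 0 1) := fun s hs => by
        simp only
        rw [intervalExtend_of_mem _ hs, hb]
      exact derivWithin_congr this (this t.2)
    have k2' : derivWithin (fun s => ξ.eval (p t s)) (Icc 0 1) ε =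
        ξ.toFun _ Da + dualCov nabla ξ X (A.anchor _ (b ε t)) := by
      refine Eq.trans ?_ k2
      have : EqOn (fun s => ξ.eval (p t s)) (fun s => ξ.eval (intervalExtend
          (fun s => (a s).toFun t) s)) (Icc 0 1) := fun s hs => by
        simp only
        rw [intervalExtend_of_mem _ hs]
        rfl
      exact derivWithin_congr this (this ε.2)
    have k3' : A.dOneForm ξ X Y ((a ε).toFun t).proj = A.dOne ξ (p t ε) (q t ε) := by
      refine A.dOneForm_eq_dOne ξ X Y ?_ ?_
      · rw [hX]
        rfl
      · rw [hY]
        exact hb ε t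
    rw [k1', k2', ← k3'] at k3
    rw [toFun_torsionAt, hX, hY, ← k3, map_sub]
    ring
  · exact hb0 (hq ε ε.2).1
  · exact hb0 (hq ε ε.2).2

/-- The missing information is ♯b = ∂_ε γ. It follows from uniqueness for a linear equation in t
satisfied by the difference v; the morphism equation is then the A-homotopy equation paired with
one-forms. -/
theorem apathHomotopic_squareHomotopic [CovariantDerivative.ContMDiffCovariantDerivative nabla ∞]
    {a₀ a₁ : A.APath} (H : A.APathHomotopic nabla a₀ a₁) : A.SquareHomotopic a₀ a₁ := by
  obtain ⟨a, b, h0, h1, hsa, hend, hsb, hcov, hb0, hb1⟩ := H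
  set p : ℝ → ℝ → TotalSpace F V := fun t ε => squareExtend (fun ε t => (a ε).toFun t) (ε, t)
    with hp
  set q : ℝ → ℝ → TotalSpace F V := fun t ε =>
    squareExtend (fun ε t => TotalSpace.mk' F ((a ε).toFun t).proj (b ε t)) (ε, t) with hq
  have hpc : ∀ t ε : I, p t ε = (a ε).toFun t := fun t ε => squareExtend_coe _ ε t
  have hqc : ∀ t ε : I, q t ε = TotalSpace.mk' F ((a ε).toFun t).proj (b ε t) :=
    fun t ε => squareExtend_coe _ ε t
  have hswap : ContMDiffOn 𝓘(ℝ, ℝ × ℝ) 𝓘(ℝ, ℝ × ℝ) ∞ (fun s : ℝ × ℝ => (s.2, s.1))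
      (Icc 0 1 ×ˢ Icc 0 1) := (contDiff_snd.prodMk contDiff_fst).contMDiff.contMDiffOn
  have hmaps : MapsTo (fun s : ℝ × ℝ => (s.2, s.1)) (Icc (0 : ℝ) 1 ×ˢ Icc (0 : ℝ) 1)
      (Icc (0 : ℝ) 1 ×ˢ Icc (0 : ℝ) 1) := fun s hs => ⟨hs.2, hs.1⟩
  have hsp : ContMDiffOn 𝓘(ℝ, ℝ × ℝ) (𝓘(ℝ, E).prod 𝓘(ℝ, F)) ∞ (fun s : ℝ × ℝ => p s.1 s.2)
      (Icc 0 1 ×ˢ Icc 0 1) := hsa.comp hswap hmaps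
  have hsq : ContMDiffOn 𝓘(ℝ, ℝ × ℝ) (𝓘(ℝ, E).prod 𝓘(ℝ, F)) ∞ (fun s : ℝ × ℝ => q s.1 s.2)
      (Icc 0 1 ×ˢ Icc 0 1) := hsb.comp hswap hmaps
  have hbase : ∀ f : C^∞⟮𝓘(ℝ, E), M; ℝ⟯, ContDiffOn ℝ ∞ (fun s : ℝ × ℝ => f (p s.1 s.2).proj)
      (Icc 0 1 ×ˢ Icc 0 1) := fun f =>
    contMDiffOn_iff_contDiffOn.1 ((contMDiff_comp_proj f).comp_contMDiffOn hsp)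
  have hfst : ∀ ξ : BundleOneForm E F V, ContDiffOn ℝ ∞ (fun s : ℝ × ℝ => ξ.eval (p s.1 s.2))
      (Icc 0 1 ×ˢ Icc 0 1) := fun ξ =>
    contMDiffOn_iff_contDiffOn.1 (ξ.contMDiff_eval.comp_contMDiffOn hsp)
  have hsnd : ∀ ξ : BundleOneForm E F V, ContDiffOn ℝ ∞ (fun s : ℝ × ℝ => ξ.eval (q s.1 s.2))
      (Icc 0 1 ×ˢ Icc 0 1) := fun ξ =>
    contMDiffOn_iff_contDiffOn.1 (ξ.contMDiff_eval.comp_contMDiffOn hsq)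
  have hd1 : ∀ (f : C^∞⟮𝓘(ℝ, E), M; ℝ⟯), ∀ t ∈ Icc (0 : ℝ) 1, ∀ ε ∈ Icc (0 : ℝ) 1,
      HasDerivWithinAt (fun s => f (p s ε).proj) (A.dFun f (p t ε)) (Icc 0 1) t := by
    intro f t ht ε hε
    have e : ∀ s ∈ Icc (0 : ℝ) 1, p s ε = intervalExtend (a ⟨ε, hε⟩).toFun s := fun s hs => by
      rw [intervalExtend_of_mem _ hs]
      exact hpc ⟨s, hs⟩ ⟨ε, hε⟩
    rw [e t ht]
    exact ((a ⟨ε, hε⟩).isPath.deriv_base f t ht).congr (fun s hs => by rw [e s hs])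
      (by rw [e t ht])
  have hslice' : ∀ t : I, ContMDiffOn 𝓘(ℝ, ℝ) (𝓘(ℝ, E).prod 𝓘(ℝ, F)) ∞
      (intervalExtend fun s => (a s).toFun t) (Icc 0 1) := fun t => by
    refine (hsp.comp (f := fun ε : ℝ => ((t : ℝ), ε)) (s := Icc 0 1)
      (contDiff_const.prodMk contDiff_id).contMDiff.contMDiffOn fun ε hε => ⟨t.2, hε⟩).congr
      fun ε hε => ?_
    rw [intervalExtend_of_mem _ hε]
    exact (hpc t ⟨ε, hε⟩).symm
  -- The morphism equation with its error term: the torsion supplies ∇* along ♯b, the covariant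
  -- derivative of a supplies it along ∂_ε γ.
  have hdiff : ∀ (ξ : BundleOneForm E F V) (t ε : I) (X Y : Cₛ^∞⟮𝓘(ℝ, E); F, V⟯),
      X ((a ε).toFun t).proj = ((a ε).toFun t).snd → Y ((a ε).toFun t).proj = b ε t →
      derivWithin (fun s => ξ.eval (q s ε)) (Icc 0 1) t
        - derivWithin (fun s => ξ.eval (p t s)) (Icc 0 1) ε =
      A.dOneForm ξ X Y ((a ε).toFun t).proj - dualCov nabla ξ X
        (pathVelocity (fun s => ((a s).toFun t).proj) ε - A.anchor _ (b ε t)) := by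
    intro ξ t ε X Y hX hY
    obtain ⟨Db, Da, hDb, hDa, hT⟩ := hcov ε t
    have k1 := (isCovDerivAlong_iff nabla).1 hDb ξ Y hY
    have k2 := (isCovDerivAlong_iff nabla).1 hDa ξ X hX
    have k3 := congrArg (ξ.toFun _) (hT X Y hX hY)
    have hv' := (a ε).anchor_eq t
    have k1' : derivWithin (fun s => ξ.eval (q s ε)) (Icc 0 1) t =
        ξ.toFun _ Db + dualCov nabla ξ Y (A.anchor _ ((a ε).toFun t).snd) := by
      rw [hv']
      refine Eq.trans ?_ k1
      have : EqOn (fun s => ξ.eval (q s ε)) (fun s => ξ.eval (intervalExtend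
          (fun s => TotalSpace.mk' F ((a ε).toFun s).proj (b ε s)) s)) (Icc 0 1) := fun s hs => by
        simp only
        rw [intervalExtend_of_mem _ hs]
        exact congrArg ξ.eval (hqc ⟨s, hs⟩ ε)
      exact derivWithin_congr this (this t.2)
    have k2' : derivWithin (fun s => ξ.eval (p t s)) (Icc 0 1) ε =
        ξ.toFun _ Da + dualCov nabla ξ X (pathVelocity (fun s => ((a s).toFun t).proj) ε) := by
      refine Eq.trans ?_ k2
      have : EqOn (fun s => ξ.eval (p t s)) (fun s => ξ.eval (intervalExtend
          (fun s => (a s).toFun t) s)) (Icc 0 1) := fun s hs => by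
        simp only
        rw [intervalExtend_of_mem _ hs]
        exact congrArg ξ.eval (hpc t ⟨s, hs⟩)
      exact derivWithin_congr this (this ε.2)
    rw [toFun_torsionAt, hX, hY, map_sub] at k3
    rw [k1', k2', ← dualCovLinear_apply nabla ξ X (_ - _), map_sub, dualCovLinear_apply,
      dualCovLinear_apply]
    linarith
  have hder : ∀ (f : C^∞⟮𝓘(ℝ, E), M; ℝ⟯) (t ε : I),
      HasDerivWithinAt (fun s => f (p t s).proj)
        (tangentApply E (pathVelocity (fun s => ((a s).toFun t).proj) ε) f) (Icc 0 1) (ε : ℝ) := by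
    intro f t ε
    refine (hasDerivWithinAt_comp_pathVelocity
      ((((contMDiff_proj V).comp_contMDiffOn (hslice' t)) ε ε.2).mdifferentiableWithinAt (by simp))
      (C_mdifferentiableAt f _)).congr (fun s hs => ?_) ?_
    · rw [intervalExtend_of_mem _ hs]
      exact congrArg (fun v : TotalSpace F V => f v.proj) (hpc t ⟨s, hs⟩)
    · rw [intervalExtend_coe]
      exact congrArg (fun v : TotalSpace F V => f v.proj) (hpc t ε)
  have hvel : ∀ ε t : I, pathVelocity (fun s => ((a s).toFun t).proj) ε - A.anchor _ (b ε t) = 0 := by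
    intro ε
    refine eq_zero_of_linear_ode nabla (a ε).smooth (fun f => A.dFunForm f) (fun f t => ?_) ?_
    -- The t-derivative of v(f) is ∂_t ∂_ε f(γ) − ∂_t (d_A f)(b). Exchanging the partial derivatives
    -- turns the first term into ∂_ε (d_A f)(a); `hdiff` and d_A² f = 0 then leave only the term
    -- linear in v.
    · have hm := ContDiffOn.hasDerivWithinAt_derivWithin_square
        (G := fun t ε => f (p t ε).proj) (hbase f) t.2 ε.2
      have e1 : EqOn (fun s => derivWithin (fun t => f (p t s).proj) (Icc 0 1) t)
          (fun s => (A.dFunForm f).eval (p t s)) (Icc 0 1) := fun s hs =>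
        HasDerivWithinAt.derivWithin_unit (hd1 f t t.2 s hs) t.2
      rw [derivWithin_congr e1 (e1 ε.2)] at hm
      have hm2 := ContDiffOn.hasDerivWithinAt_unit
        ((hsnd (A.dFunForm f)).slice_fst (G := fun t ε => (A.dFunForm f).eval (q t ε)) ε.2) t.2
      refine ((hm.sub hm2).congr_deriv ?_).congr (fun s hs => ?_) ?_
      · have k := hdiff (A.dFunForm f) t ε (sectionThrough ((a ε).toFun t))
          (sectionThrough ⟨_, b ε t⟩) (sectionThrough_apply _) (sectionThrough_mk_apply _ _)
        rw [dOneForm_dFunForm] at k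
        linarith
      · rw [intervalExtend_of_mem _ hs, tangentApply_sub_left]
        refine congrArg₂ _ ?_ ?_
        · exact (HasDerivWithinAt.derivWithin_unit (hder f ⟨s, hs⟩ ε) ε.2).symm
        · exact (congrArg (A.dFunForm f).eval (hqc ⟨s, hs⟩ ε)).symm
      · rw [intervalExtend_coe, tangentApply_sub_left]
        refine congrArg₂ _ ?_ ?_
        · exact (HasDerivWithinAt.derivWithin_unit (hder f t ε) ε.2).symm
        · exact (congrArg (A.dFunForm f).eval (hqc t ε)).symm
    -- Initial value: b(ε, 0) = 0 and the starting points are fixed, so both parts of v vanish.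
    · rw [hb0, LinearMap.map_zero]
      refine eq_of_forall_tangentApply (E := E) fun f => ?_
      rw [sub_zero, tangentApply_zero_left]
      have k := hder f 0 ε
      refine (uniqueDiffOn_Icc_zero_one ε ε.2).eq_deriv _ k ?_
      refine (hasDerivWithinAt_const (ε : ℝ) _ (f (a₀.toFun 0).proj)).congr (fun s hs => ?_) ?_
      · rw [← (hend ⟨s, hs⟩).1]
        exact congrArg (fun v : TotalSpace F V => f v.proj) (hpc 0 ⟨s, hs⟩)
      · rw [← (hend ε).1]
        exact congrArg (fun v : TotalSpace F V => f v.proj) (hpc 0 ε)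
  refine ⟨p, q, ⟨fun t _ ε _ => rfl, hbase, hfst, hsnd, hd1, fun f t ht ε hε => ?_,
    fun ξ t ht ε hε => ?_⟩, fun t => ?_, fun t => ?_, fun ε hε => ⟨?_, ?_⟩⟩
  · refine (hder f ⟨t, ht⟩ ⟨ε, hε⟩).congr_deriv ?_
    rw [sub_eq_zero.1 (hvel ⟨ε, hε⟩ ⟨t, ht⟩)]
    exact (congrArg (A.dFunForm f).eval (hqc ⟨t, ht⟩ ⟨ε, hε⟩)).symm
  · have k := hdiff ξ ⟨t, ht⟩ ⟨ε, hε⟩ (sectionThrough ((a ⟨ε, hε⟩).toFun ⟨t, ht⟩))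
      (sectionThrough ⟨_, b ⟨ε, hε⟩ ⟨t, ht⟩⟩) (sectionThrough_apply _) (sectionThrough_mk_apply _ _)
    rw [hvel, ← dualCovLinear_apply, map_zero, sub_zero] at k
    refine k.trans (A.dOneForm_eq_dOne ξ _ _ ?_ ?_)
    · rw [sectionThrough_apply]
      exact (hpc ⟨t, ht⟩ ⟨ε, hε⟩).symm
    · rw [sectionThrough_mk_apply]
      exact (hqc ⟨t, ht⟩ ⟨ε, hε⟩).symm
  · rw [← h0]
    exact hpc t 0
  · rw [← h1]
    exact hpc t 1
  · have e := hqc 0 ⟨ε, hε⟩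
    rw [hb0] at e
    have e' : q 0 ε = _ := e
    rw [e']
  · have e := hqc 1 ⟨ε, hε⟩
    rw [hb1] at e
    have e' : q 1 ε = _ := e
    rw [e']

theorem apathHomotopic_iff [CovariantDerivative.ContMDiffCovariantDerivative nabla ∞]
    (a₀ a₁ : A.APath) : A.APathHomotopic nabla a₀ a₁ ↔ A.SquareHomotopic a₀ a₁ :=
  ⟨apathHomotopic_squareHomotopic nabla, squareHomotopic_apathHomotopic nabla⟩

end Weinstein

end LieAlgebroid

/-! ### Comparison of the C^r topologies -/

theorem preimage_funUnique_Icc :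
    ContinuousLinearEquiv.funUnique (Fin 1) ℝ ℝ ⁻¹' Icc 0 1 = Icc (0 : Fin 1 → ℝ) 1 := by
  ext s
  exact ⟨fun h => ⟨fun i => by rw [Subsingleton.elim i 0]; exact h.1,
    fun i => by rw [Subsingleton.elim i 0]; exact h.2⟩, fun h => ⟨h.1 0, h.2 0⟩⟩

/-- The unit interval as a one-dimensional cube. -/
def cubeEquivInterval : Icc (0 : Fin 1 → ℝ) 1 ≃ Icc (0 : ℝ) 1 where
  toFun s := ⟨s.1 0, s.2.1 0, s.2.2 0⟩
  invFun t := ⟨fun _ => t, fun _ => t.2.1, fun _ => t.2.2⟩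
  left_inv s := Subtype.ext (funext fun i => by rw [Subsingleton.elim i 0])
  right_inv _ := rfl

theorem iteratedFDerivWithin_comp_apply_zero (g : ℝ → ℝ) (j : ℕ) (s : Icc (0 : Fin 1 → ℝ) 1) :
    iteratedFDerivWithin ℝ j (fun w : Fin 1 → ℝ => g (w 0)) (Icc 0 1) s =
      ContinuousLinearEquiv.continuousMultilinearMapCongrLeft ℝ
        (fun _ : Fin j => ContinuousLinearEquiv.funUnique (Fin 1) ℝ ℝ)
        (iteratedFDerivWithin ℝ j g (Icc 0 1) (cubeEquivInterval s)) := by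
  refine Eq.trans ?_ ((ContinuousLinearEquiv.funUnique (Fin 1) ℝ ℝ).iteratedFDerivWithin_comp_right g
    uniqueDiffOn_Icc_zero_one (cubeEquivInterval s).2 j)
  rw [preimage_funUnique_Icc]
  rfl

/-- The j-th derivatives on the one-dimensional cube and on the interval correspond under a fixed
linear isomorphism and a bijection of the domains, which together form an isomorphism of the spaces
of uniform convergence. -/
theorem induced_iteratedFDerivWithin_comp_apply_zero {P : Type*} (g : P → ℝ → ℝ) (j : ℕ) :
    TopologicalSpace.induced (fun p => UniformFun.ofFun fun s : Icc (0 : Fin 1 → ℝ) 1 =>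
      iteratedFDerivWithin ℝ j (fun w : Fin 1 → ℝ => g p (w 0)) (Icc 0 1) s) inferInstance =
    TopologicalSpace.induced (fun p => UniformFun.ofFun fun s : Icc (0 : ℝ) 1 =>
      iteratedFDerivWithin ℝ j (g p) (Icc 0 1) s) inferInstance := by
  let L := ContinuousLinearEquiv.continuousMultilinearMapCongrLeft ℝ
    (fun _ : Fin j => ContinuousLinearEquiv.funUnique (Fin 1) ℝ ℝ)
  let T : (ℝ [×j]→L[ℝ] ℝ) ≃ᵤ ((Fin 1 → ℝ) [×j]→L[ℝ] ℝ) :=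
    ⟨L.toEquiv, (L : (ℝ [×j]→L[ℝ] ℝ) →L[ℝ] ((Fin 1 → ℝ) [×j]→L[ℝ] ℝ)).uniformContinuous,
      (L.symm : ((Fin 1 → ℝ) [×j]→L[ℝ] ℝ) →L[ℝ] (ℝ [×j]→L[ℝ] ℝ)).uniformContinuous⟩
  let H := (UniformFun.congrLeft cubeEquivInterval.symm).trans
    (UniformFun.congrRight (α := Icc (0 : Fin 1 → ℝ) 1) T)
  have e : (fun p => UniformFun.ofFun fun s : Icc (0 : Fin 1 → ℝ) 1 =>
      iteratedFDerivWithin ℝ j (fun w : Fin 1 → ℝ => g p (w 0)) (Icc 0 1) s) =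
      H ∘ fun p => UniformFun.ofFun fun s : Icc (0 : ℝ) 1 =>
        iteratedFDerivWithin ℝ j (g p) (Icc 0 1) s := by
    funext p
    exact congrArg UniformFun.ofFun (funext fun s => iteratedFDerivWithin_comp_apply_zero (g p) j s)
  rw [e, ← induced_compose]
  exact congrArg (TopologicalSpace.induced _) H.toHomeomorph.isInducing.eq_induced.symm

theorem isHomeomorph_of_coinduced {X Y : Type*} [TopologicalSpace X] (Φ : X ≃ Y) :
    @IsHomeomorph X Y _ (TopologicalSpace.coinduced Φ inferInstance) Φ := by
  let _ : TopologicalSpace Y := TopologicalSpace.coinduced Φ inferInstance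
  refine ⟨continuous_coinduced_rng, fun U hU => ?_, Φ.bijective⟩
  rw [isOpen_coinduced, Φ.preimage_image]
  exact hU

namespace LieAlgebroid

section Topology

variable {E : Type*} [NormedAddCommGroup E] [NormedSpace ℝ E] [FiniteDimensional ℝ E]
  {M : Type*} [TopologicalSpace M] [T2Space M] [ChartedSpace E M] [IsManifold 𝓘(ℝ, E) ∞ M]
  {F : Type*} [NormedAddCommGroup F] [NormedSpace ℝ F] [FiniteDimensional ℝ F]
  {V : M → Type*} [TopologicalSpace (TotalSpace F V)]
  [∀ x, AddCommGroup (V x)] [∀ x, Module ℝ (V x)] [∀ x, TopologicalSpace (V x)]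
  [FiberBundle F V] [VectorBundle ℝ F V] [ContMDiffVectorBundle ∞ F V 𝓘(ℝ, E)]
  (A : LieAlgebroid E F V)

theorem sphereEquivPath_intervalExtend (a : A.Sphere 1) (w : Fin 1 → ℝ) :
    intervalExtend (sphereEquivPath A a).toFun (w 0) = cubeExtend (a.1.comp 0) w := by
  rw [intervalExtend, sphereEquivPath_toFun, cubeExtend]
  congr 1
  funext i
  rw [Subsingleton.elim i 0]

theorem sphereTopology_eq_induced (r : ℕ∞) :
    A.sphereTopology 1 r = (A.pathTopology r).induced (sphereEquivPath A) := by
  have h1 : crTopology (𝓘(ℝ, E).prod 𝓘(ℝ, F)) (Icc 0 1)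
      (fun a : A.Sphere 1 => cubeExtend (a.1.comp 0)) r =
      (A.pathTopology r).induced (sphereEquivPath A) := by
    simp only [pathTopology, crTopology, induced_iInf, induced_compose]
    refine iInf_congr fun f => iInf_congr fun j => iInf_congr fun _ => ?_
    refine Eq.trans ?_ (induced_iteratedFDerivWithin_comp_apply_zero
      (fun (a : A.Sphere 1) t => f (intervalExtend (sphereEquivPath A a).toFun t)) j)
    simp only [A.sphereEquivPath_intervalExtend]
  rw [sphereTopology, iInf_unique, ← h1]
  -- The base map adds no open sets: f applied to it is the smooth function f ∘ π on the total space
  -- applied to the component.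
  refine inf_eq_right.2 (le_iInf fun f => le_iInf fun j => le_iInf fun hj => ?_)
  refine (iInf_le _ (⟨_, contMDiff_comp_proj f⟩ :
    C^∞⟮𝓘(ℝ, E).prod 𝓘(ℝ, F), TotalSpace F V; ℝ⟯)).trans ((iInf_le _ j).trans
    ((iInf_le _ hj).trans (le_of_eq ?_)))
  refine congrArg₂ _ (funext fun a => ?_) rfl
  have e : (fun w => f (cubeExtend a.1.base w)) = fun w => f (cubeExtend (a.1.comp 0) w).proj := by
    funext w
    exact congrArg f (a.1.proj_comp 0 _).symm
  rw [e]
  rfl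

theorem pathTopology_eq_coinduced (r : ℕ∞) :
    A.pathTopology r = (A.sphereTopology 1 r).coinduced (sphereEquivPath A) := by
  rw [sphereTopology_eq_induced, ← Equiv.induced_symm]
  exact ((@induced_compose _ _ _ (A.pathTopology r) _ _).trans
    ((congrArg (fun k => TopologicalSpace.induced k (A.pathTopology r))
      (sphereEquivPath A).self_comp_symm).trans (@induced_id _ (A.pathTopology r)))).symm

end Topology

/-! ### The two formulas for concatenation -/

section Concat

variable {E : Type*} [NormedAddCommGroup E] [NormedSpace ℝ E] [FiniteDimensional ℝ E]
  {M : Type*} [TopologicalSpace M] [T2Space M] [ChartedSpace E M] [IsManifold 𝓘(ℝ, E) ∞ M]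
  {F : Type*} [NormedAddCommGroup F] [NormedSpace ℝ F] [FiniteDimensional ℝ F]
  {V : M → Type*} [TopologicalSpace (TotalSpace F V)]
  [∀ x, AddCommGroup (V x)] [∀ x, Module ℝ (V x)] [∀ x, TopologicalSpace (V x)]
  [FiberBundle F V] [VectorBundle ℝ F V] [ContMDiffVectorBundle ∞ F V 𝓘(ℝ, E)]
  {A : LieAlgebroid E F V} {τ : ℝ → ℝ}

theorem APath.concat_eq_pathOdot (hτ : IsCutoff τ) (a₁ a₀ : A.APath)
    (h : (a₁.toFun 0).proj = (a₀.toFun 1).proj) :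
    (APath.concat hτ a₁ a₀ h).toFun =
      pathOdot (pathReparam τ a₁.toFun) (pathReparam τ a₀.toFun) := by
  funext t
  rw [APath.concat_toFun, join, pathOdot]
  by_cases ht : (t : ℝ) ≤ 1 / 2
  · have hm : 2 * (t : ℝ) ∈ Icc (0 : ℝ) 1 := ⟨by linarith [t.2.1], by linarith⟩
    rw [if_pos ht, if_pos ht, intervalExtend_of_mem _ hm, pathReparam, fiberSMul_fiberSMul]
  · have hm : 2 * (t : ℝ) - 1 ∈ Icc (0 : ℝ) 1 := ⟨by linarith, by linarith [t.2.2]⟩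
    rw [if_neg ht, if_neg ht, intervalExtend_of_mem _ hm, pathReparam, fiberSMul_fiberSMul]

/-- `IsConcat` prescribes both formulas at t = 1/2, where `join` uses the first; both give the zero
vector over the common end point. -/
theorem join_of_half_le (hτ : IsCutoff τ) {α₁ α₀ : ℝ → TotalSpace F V}
    (h : (α₁ 0).proj = (α₀ 1).proj) {t : ℝ} (ht : 1 / 2 ≤ t) :
    join τ α₁ α₀ t = fiberSMul (2 * deriv τ (2 * t - 1)) (α₁ (τ (2 * t - 1))) := by
  rcases ht.eq_or_lt with rfl | ht
  · rw [join, if_pos le_rfl, hτ.deriv_eq_zero_of_one_le (by norm_num), hτ.eq_one _ (by norm_num),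
      hτ.deriv_eq_zero_of_nonpos (by norm_num), hτ.eq_zero (2 * (1 / 2) - 1) (by norm_num), mul_zero]
    exact fiberSMul_eq_of_zero h.symm
  · rw [join, if_neg (not_le.2 ht)]

theorem Sphere.comp_eq (a : A.Sphere 1) (k : Fin 1) (s : Fin 1 → I) :
    a.1.comp k s = (sphereEquivPath A a).toFun (s 0) := by
  rw [sphereEquivPath_toFun, Subsingleton.elim k 0]
  congr 1
  funext i
  rw [Subsingleton.elim i 0]

theorem isConcat_concat (hτ : IsCutoff τ) (a₁ a₀ : A.Sphere 1)
    (h : ((sphereEquivPath A a₁).toFun 0).proj = ((sphereEquivPath A a₀).toFun 1).proj) :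
    A.IsConcat τ a₁.1 a₀.1 ((sphereEquivPath A).symm
      (APath.concat hτ (sphereEquivPath A a₁) (sphereEquivPath A a₀) h)).1 := by
  set c := (sphereEquivPath A).symm
    (APath.concat hτ (sphereEquivPath A a₁) (sphereEquivPath A a₀) h) with hc
  have hcomp : ∀ (k : Fin 1) (s : Fin 1 → I), c.1.comp k s =
      join τ (intervalExtend (sphereEquivPath A a₁).toFun)
        (intervalExtend (sphereEquivPath A a₀).toFun) (s 0) := by
    intro k s
    rw [Sphere.comp_eq, hc, Equiv.apply_symm_apply, APath.concat_toFun]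
  have key : ∀ (a : A.Sphere 1) (t : Fin 1 → I) (c₀ x : ℝ),
      (∀ k, c.1.comp k t = fiberSMul c₀ (intervalExtend (sphereEquivPath A a).toFun x)) →
      c.1.base t = a.1.base (Function.update t (Fin.last 0) (projIcc 0 1 zero_le_one x)) ∧
        ∀ k, c.1.comp k t = fiberSMul (if k = Fin.last 0 then c₀ else 1)
          (a.1.comp k (Function.update t (Fin.last 0) (projIcc 0 1 zero_le_one x))) := by
    intro a t c₀ x hk
    have hcomp' : ∀ k, c.1.comp k t = fiberSMul c₀
        (a.1.comp k (Function.update t (Fin.last 0) (projIcc 0 1 zero_le_one x))) := by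
      intro k
      rw [hk, Sphere.comp_eq]
      rfl
    refine ⟨?_, fun k => ?_⟩
    · rw [← c.1.proj_comp 0, ← a.1.proj_comp 0, hcomp']
      rfl
    · rw [if_pos (Subsingleton.elim _ _), hcomp']
  have hproj : (intervalExtend (sphereEquivPath A a₁).toFun 0).proj =
      (intervalExtend (sphereEquivPath A a₀).toFun 1).proj := by
    rw [intervalExtend_of_mem _ zero_mem_unit, intervalExtend_of_mem _ one_mem_unit]
    exact h
  intro t
  refine ⟨fun ht => key a₀ t _ _ fun k => ?_, fun ht => key a₁ t _ _ fun k => ?_⟩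
  · rw [hcomp, join, if_pos (by exact ht)]
    rfl
  · rw [hcomp, join_of_half_le hτ hproj (by exact ht)]
    rfl

end Concat

end LieAlgebroid

end

/-! ### The isomorphism -/

theorem proposition3p5
    {E : Type*} [NormedAddCommGroup E] [NormedSpace ℝ E] [FiniteDimensional ℝ E]
    {M : Type*} [TopologicalSpace M] [T2Space M] [SigmaCompactSpace M] [ChartedSpace E M]
    [IsManifold 𝓘(ℝ, E) ∞ M]
    {F : Type*} [NormedAddCommGroup F] [NormedSpace ℝ F] [FiniteDimensional ℝ F]
    {V : M → Type*} [TopologicalSpace (TotalSpace F V)]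
    [∀ x, AddCommGroup (V x)] [∀ x, Module ℝ (V x)] [∀ x, TopologicalSpace (V x)]
    [∀ x, IsTopologicalAddGroup (V x)] [∀ x, ContinuousSMul ℝ (V x)]
    [FiberBundle F V] [VectorBundle ℝ F V] [ContMDiffVectorBundle ∞ F V 𝓘(ℝ, E)]
    (A : LieAlgebroid E F V)
    (nabla : CovariantDerivative 𝓘(ℝ, E) F V) [CovariantDerivative.ContMDiffCovariantDerivative nabla ∞] :
    Equivalence (A.SphereHomotopic (n := 1)) ∧
    Equivalence (A.APathHomotopic nabla) ∧
    ∃ (e : A.Sphere 1 ≃ A.APath) (Φ : A.HomotopyGroup 1 ≃ A.WeinsteinArrows nabla)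
      (P₁ : ArrowGroupoid (A.HomotopyGroup 1) M)
      (𝒢 : ArrowGroupoid (A.WeinsteinArrows nabla) M),
      (∀ (a : A.Sphere 1) (t : unitInterval), (e a).toFun t = a.1.comp 0 (fun _ => t)) ∧
      (∀ a₀ a₁ : A.Sphere 1,
        A.SphereHomotopic a₀ a₁ ↔ A.APathHomotopic nabla (e a₀) (e a₁)) ∧
      (∀ a : A.Sphere 1, Φ (A.sphereClass a) = A.pathClass nabla (e a)) ∧
      A.IsPiOneGroupoid P₁ ∧
      A.IsWeinsteinGroupoid nabla 𝒢 ∧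
      P₁.IsIso 𝒢 Φ ∧
      ∀ r : ℕ∞, @IsHomeomorph _ _ (A.homotopyGroupTopology 1 r) (A.weinsteinTopology nabla r) Φ := by
  have hpath := LieAlgebroid.apathHomotopic_iff (A := A) nabla
  have hsph : ∀ a₀ a₁ : A.Sphere 1, A.SphereHomotopic a₀ a₁ ↔
      A.APathHomotopic nabla (LieAlgebroid.sphereEquivPath A a₀)
        (LieAlgebroid.sphereEquivPath A a₁) := fun a₀ a₁ =>
    (LieAlgebroid.sphereHomotopic_iff a₀ a₁).trans (hpath _ _).symm
  have hsq := LieAlgebroid.SquareHomotopic.equivalence (A := A)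
  set e := LieAlgebroid.sphereEquivPath A with he
  let Φ : A.HomotopyGroup 1 ≃ A.WeinsteinArrows nabla := Quot.congr e hsph
  let 𝒢 : ArrowGroupoid (A.WeinsteinArrows nabla) M := LieAlgebroid.pathGroupoid hpath
  have hΦ : ∀ a : A.Sphere 1, Φ (A.sphereClass a) = A.pathClass nabla (e a) := fun _ => rfl
  have hproj : ∀ (a : A.Sphere 1) (t : I), ((e a).toFun t).proj = a.1.base fun _ => t :=
    fun a t => by rw [he, LieAlgebroid.sphereEquivPath_toFun, a.1.proj_comp]
  -- The structure on π₁(A) is transported along Φ, so Φ is an isomorphism by construction. What has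
  -- to be checked is that the transported operations are those prescribed for spheres.
  refine ⟨?_, ?_, e, Φ, 𝒢.transport Φ, 𝒢, LieAlgebroid.sphereEquivPath_toFun, hsph, hΦ, ?_, ?_,
    𝒢.transport_isIso Φ, fun r => ?_⟩
  · have h : A.SphereHomotopic (n := 1) = fun a₀ a₁ => A.SquareHomotopic (e a₀) (e a₁) := by
      funext a₀ a₁
      exact propext (LieAlgebroid.sphereHomotopic_iff a₀ a₁)
    rw [h]
    exact hsq.comap e
  · have h : A.APathHomotopic nabla = A.SquareHomotopic := by
      funext a₀ a₁
      exact propext (hpath a₀ a₁)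
    rw [h]
    exact hsq
  · refine ⟨fun a => ?_, fun a => ?_, fun τ hτ a₁ a₀ p => ?_⟩
    · exact (LieAlgebroid.pathGroupoid_source hpath (e a)).trans (hproj a 0)
    · exact (LieAlgebroid.pathGroupoid_target hpath (e a)).trans (hproj a 1)
    · have h : ((e a₁).toFun 0).proj = ((e a₀).toFun 1).proj :=
        ((LieAlgebroid.pathGroupoid_source hpath (e a₁)).symm.trans p).trans
          (LieAlgebroid.pathGroupoid_target hpath (e a₀))
      refine ⟨_, LieAlgebroid.isConcat_concat hτ a₁ a₀ h, ?_⟩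
      refine Φ.symm_apply_eq.2 ((LieAlgebroid.pathGroupoid_mul hpath hτ _ _ p h).trans ?_)
      rw [hΦ, Equiv.apply_symm_apply]
      rfl
  · refine ⟨LieAlgebroid.pathGroupoid_source hpath, LieAlgebroid.pathGroupoid_target hpath,
      fun x => ⟨LieAlgebroid.APath.zero A x, LieAlgebroid.APath.zero_toFun x, rfl⟩,
      fun a => ⟨a.inv, a.inv_toFun, LieAlgebroid.pathGroupoid_inv hpath a⟩, fun τ hτ a₁ a₀ p => ?_⟩
    have h : (a₁.toFun 0).proj = (a₀.toFun 1).proj :=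
      ((LieAlgebroid.pathGroupoid_source hpath a₁).symm.trans p).trans
        (LieAlgebroid.pathGroupoid_target hpath a₀)
    exact ⟨_, LieAlgebroid.APath.concat_eq_pathOdot hτ a₁ a₀ h,
      LieAlgebroid.pathGroupoid_mul hpath hτ a₁ a₀ p h⟩
  -- Both sides are pushed forward from the space of spheres, along the class map after e and along
  -- Φ after the class map; these composites coincide.
  · have ht : A.weinsteinTopology nabla r = (A.homotopyGroupTopology 1 r).coinduced Φ := by
      rw [LieAlgebroid.weinsteinTopology, LieAlgebroid.pathTopology_eq_coinduced,
        LieAlgebroid.homotopyGroupTopology]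
      exact (@coinduced_compose _ _ _ (A.sphereTopology 1 r) _ _).trans
        (@coinduced_compose _ _ _ (A.sphereTopology 1 r) _ _).symm
    rw [ht]
    exact @isHomeomorph_of_coinduced _ _ (A.homotopyGroupTopology 1 r) Φ
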